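/- **Setting.** Let $X$ be a metric Lie group: a simply connected three-dimensional Lie group with a left invariant Riemannian metric $\langle\,,\rangle$. Let $(E_1,E_2,E_3)$ be a canonical basis of $X$, i.e. an orthonormal left invariant frame such that * ($X$ unimodular) $[E_2,E_3]=c_1E_1$, $[E_3,E_1]=c_2E_2$, $[E_1,E_2]=c_3E_3$ with $c_1,c_2,c_3\in\mathbb R$, at most one of them negative; or * ($X$ non-unimodular, the metric being normalized by scaling) $[E_1,E_2]=0$, $[E_3,E_1]=(1+a)E_1+(1+a)b\,E_2$, $[E_3,E_2]=-(1-a)b\,E_1+(1-a)E_2$ with $a,b\ge 0$. Orient $X$ by $(E_1,E_2,E_3)$. For $H\in\mathbb R$, the $H$-potential $R$ of $X$ is, in the unimodular case, $$R(q)=H(1+|q|^2)^2-\tfrac i2\left(\mu_2|1+q^2|^2+\mu_1|1-q^2|^2+4\mu_3|q|^2\right),$$ where $\mu_1=\frac12(-c_1+c_2+c_3)$, $\mu_2=\frac12(c_1-c_2+c_3)$, $\mu_3=\frac12(c_1+c_2-c_3)$, and in the non-unimodular case $$R(q)=H(1+|q|^2)^2-(1-|q|^4)-a(q^2-\bar q^2)-ib\left(2|q|^2-a(q^2+\bar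 q^2)\right).$$ The limit of $R(q)/|q|^4$ as $q\to\infty$ exists; $R$ is said to vanish at $\infty$ if this limit is $0$. Let $\Sigma$ be a simply connected Riemann surface. A conformally immersed $H$-surface $f:\Sigma\to X$ is a smooth conformal immersion with constant mean curvature $H$ with respect to the unit normal $N$ for which $(f_x,f_y,N)$ is positively oriented for every conformal parameter $z=x+iy$ of $\Sigma$. Its left invariant Gauss map $G:\Sigma\to\mathbb S^2\subset T_eX$ is defined by $(dl_{f(p)})_e(G(p))=N_p$, where $l_x$ is left translation by $x$. Its Gauss map $g:\Sigma\to\overline{\mathbb C}=\mathbb C\cup\{\infty\}$ is $G$ followed by the stereographic projection from the south pole, $g=(G_1+iG_2)/(1+G_3)$, where $G=\sum_i G_i (E_i)_e$ (and $g=\infty$ where $G_3=-1$). For a smooth map $g:\Sigma\to\overline{\mathbb C}$ with $R\neq 0$ on $g(\Sigma)$, consider the equation $$g_{z\bar z}=\frac{R_q}{R}(g)\,g_zg_{\bar z}+\left(\frac{R_{\bar q}}{R}-\frac{\overline{R_q}}{\overline R}\right)(g)\,|g_z|^2\qquad(\ast)$$ in every conformal parameter $z$. At points where $g=\infty$ it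 is read in the coordinate $h=1/q$ of $\overline{\mathbb C}$, in which it has the same form with $g$ replaced by $1/g$ and $R$ replaced by $|h|^4R(1/h)$, extended to $h=0$ by its limit. The condition "$g_z\neq0$" at a point where $g=\infty$ means $(1/g)_z\neq 0$ there, i.e. $\lim g_z/g^2\ne0$. **Theorem.** Let $\Sigma$, $X$, $(E_1,E_2,E_3)$, $H$ and $R$ be as above, and let $g:\Sigma\to\overline{\mathbb C}$ be a map such that $R$ does not vanish at any point of $g(\Sigma)$. 1. If $g$ is a smooth solution of $(\ast)$ with $g_z\neq0$ everywhere, then there exists a conformally immersed $H$-surface $f:\Sigma\to X$ whose Gauss map is $g$. It is unique up to left translations: if $f_1,f_2$ are two such surfaces, then there is $x\in X$ with $f_2=l_x\circ f_1$. 2. Conversely, if $g$ is the Gauss map of a conformally immersed $H$-surface $f:\Sigma\to X$, then $g$ is a smooth solution of $(\ast)$ and $g_z\neq 0$ everywhere. -/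

import Mathlib

open scoped Manifold ContDiff Topology

noncomputable section

namespace MetricLie

/-! ### Metric Lie groups of dimension three -/

/-- The model space of three-dimensional manifolds. -/
abbrev E3 : Type := EuclideanSpace ℝ (Fin 3)

/-- The model with corners of three-dimensional real manifolds. -/
abbrev I3 : ModelWithCorners ℝ E3 E3 := 𝓘(ℝ, E3)

/-- A left invariant Riemannian metric on a three-dimensional Lie group: a smooth Riemannian metric
for which all left translations `p ↦ a * p` are isometries. -/
structure LeftInvariantMetric (X : Type*) [TopologicalSpace X] [ChartedSpace E3 X] [Group X]
    [LieGroup I3 ∞ X] where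
  /-- the underlying Riemannian metric -/
  metric : Bundle.ContMDiffRiemannianMetric I3 ∞ E3 (fun p : X ↦ TangentSpace I3 p)
  left_invariant : ∀ (a p : X) (v w : TangentSpace I3 p),
    metric.inner (a * p) (mfderiv I3 I3 (fun x : X ↦ a * x) p v)
      (mfderiv I3 I3 (fun x : X ↦ a * x) p w) = metric.inner p v w

/-- The constants attached to a canonical basis: `(c₁, c₂, c₃)` in the unimodular case, and `(a, b)`
in the non-unimodular case. -/
inductive StructureConstants : Type
  | unimodular (c₁ c₂ c₃ : ℝ)
  | nonUnimodular (a b : ℝ)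

section Group

variable {X : Type*} [TopologicalSpace X] [ChartedSpace E3 X] [Group X] [LieGroup I3 ∞ X]

/-- `e` is a canonical basis of the metric Lie group `(X, γ)` with structure constants `s`; the
vectors `E₁, E₂, E₃` of the literature are `e 0, e 1, e 2`, extended as left invariant fields.

Unimodular case: an orthonormal basis with `[E₂,E₃] = c₁E₁`, `[E₃,E₁] = c₂E₂`, `[E₁,E₂] = c₃E₃`,
at most one of the `cᵢ` being negative.

Non-unimodular case: an orthonormal basis with `[E₁,E₂] = 0`, `[E₃,E₁] = (1+a)E₁ + (1+a)b E₂`,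
`[E₃,E₂] = -(1-a)b E₁ + (1-a)E₂`, where `a, b ≥ 0`. -/
def IsCanonicalBasis (γ : LeftInvariantMetric X) (e : Module.Basis (Fin 3) ℝ (GroupLieAlgebra I3 X))
    (s : StructureConstants) : Prop :=
  (∀ i j, γ.metric.inner 1 (e i) (e j) = if i = j then 1 else 0) ∧
  match s with
  | .unimodular c₁ c₂ c₃ =>
      ⁅e 1, e 2⁆ = c₁ • e 0 ∧ ⁅e 2, e 0⁆ = c₂ • e 1 ∧ ⁅e 0, e 1⁆ = c₃ • e 2 ∧
      ¬ (c₁ < 0 ∧ c₂ < 0) ∧ ¬ (c₁ < 0 ∧ c₃ < 0) ∧ ¬ (c₂ < 0 ∧ c₃ < 0)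
  | .nonUnimodular a b =>
      ⁅e 0, e 1⁆ = 0 ∧
      ⁅e 2, e 0⁆ = (1 + a) • e 0 + ((1 + a) * b) • e 1 ∧
      ⁅e 2, e 1⁆ = (-((1 - a) * b)) • e 0 + (1 - a) • e 1 ∧
      0 ≤ a ∧ 0 ≤ b

/-- The Levi-Civita connection of a left invariant metric on left invariant vector fields, through
the Koszul formula: `leviCivita γ u v x` is `⟨∇_u v, x⟩`. (The functions `⟨u, v⟩`, `⟨v, x⟩`,
`⟨x, u⟩` are constant, so that their derivatives do not occur.) -/
def leviCivita (γ : LeftInvariantMetric X) (u v x : GroupLieAlgebra I3 X) : ℝ :=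
  (γ.metric.inner 1 ⁅u, v⁆ x - γ.metric.inner 1 ⁅v, x⁆ u + γ.metric.inner 1 ⁅x, u⁆ v) / 2

/-- The connection is compatible with the metric. -/
theorem leviCivita_metric (γ : LeftInvariantMetric X) (u v x : GroupLieAlgebra I3 X) :
    leviCivita γ u v x + leviCivita γ u x v = 0 := by
  have sk : ∀ a b : GroupLieAlgebra I3 X, ⁅a, b⁆ = -⁅b, a⁆ := fun a b ↦ by
    simp only [GroupLieAlgebra.bracket_def]
    exact congrFun VectorField.mlieBracket_swap 1
  have hn : ∀ a b c : GroupLieAlgebra I3 X,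
      γ.metric.inner 1 ⁅a, b⁆ c = -γ.metric.inner 1 ⁅b, a⁆ c := fun a b c ↦ by
    rw [sk a b, map_neg]; rfl
  simp only [leviCivita]
  rw [hn x v, hn v u, hn x u]
  ring

/-- The connection is torsion free. -/
theorem leviCivita_torsion (γ : LeftInvariantMetric X) (u v x : GroupLieAlgebra I3 X) :
    leviCivita γ u v x - leviCivita γ v u x = γ.metric.inner 1 ⁅u, v⁆ x := by
  have sk : ∀ a b : GroupLieAlgebra I3 X, ⁅a, b⁆ = -⁅b, a⁆ := fun a b ↦ by
    simp only [GroupLieAlgebra.bracket_def]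
    exact congrFun VectorField.mlieBracket_swap 1
  have hn : ∀ a b c : GroupLieAlgebra I3 X,
      γ.metric.inner 1 ⁅a, b⁆ c = -γ.metric.inner 1 ⁅b, a⁆ c := fun a b c ↦ by
    rw [sk a b, map_neg]; rfl
  simp only [leviCivita]
  rw [hn v u, hn x u, hn x v]
  ring

/-! ### Surfaces in a metric Lie group, in a conformal parameter -/

/-- The derivative `dF_w(v)` of a parametrized surface `F`. -/
def surfaceDeriv (F : ℂ → X) (w v : ℂ) : TangentSpace I3 (F w) :=
  mfderiv 𝓘(ℝ, ℂ) I3 F w v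

/-- The derivative `dF_w(v)`, left translated to the identity: `F⁻¹ dF_w(v)`. -/
def leftLogDeriv (F : ℂ → X) (w v : ℂ) : GroupLieAlgebra I3 X :=
  mfderiv I3 I3 (fun x : X ↦ (F w)⁻¹ * x) (F w) (surfaceDeriv F w v)

/-- The first fundamental form of the parametrized surface `F`. -/
def firstForm (γ : LeftInvariantMetric X) (F : ℂ → X) (w v v' : ℂ) : ℝ :=
  γ.metric.inner (F w) (surfaceDeriv F w v) (surfaceDeriv F w v')

/-- The second fundamental form `⟨∇_v (dF(v')), N⟩` at `w` of the parametrized surface `F`, with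
respect to the normal vector `N` whose left translation to the identity is `ν`.

In terms of a left invariant frame, `dF(v') = ∑ ωᵢ Eᵢ` along `F`, where `∑ ωᵢ(w) Eᵢ(1)` is
`leftLogDeriv F w v'`, and `∇_v (∑ ωᵢ Eᵢ) = ∑ (∂_v ωᵢ) Eᵢ + ∑ ωᵢ ∇_{dF(v)} Eᵢ`. -/
def secondForm (γ : LeftInvariantMetric X) (F : ℂ → X) (ν : GroupLieAlgebra I3 X)
    (w v v' : ℂ) : ℝ :=
  fderiv ℝ (fun w' : ℂ ↦ γ.metric.inner 1 (leftLogDeriv F w' v') ν) w v +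
    leviCivita γ (leftLogDeriv F w v) (leftLogDeriv F w v') ν

/-- The mean curvature: half the trace of the second fundamental form with respect to the first,
computed in the real basis `1, i` of the parameter plane. -/
def meanCurvature (γ : LeftInvariantMetric X) (F : ℂ → X) (ν : GroupLieAlgebra I3 X) (w : ℂ) : ℝ :=
  (firstForm γ F w 1 1 * secondForm γ F ν w Complex.I Complex.I
    - firstForm γ F w 1 Complex.I * secondForm γ F ν w 1 Complex.I
    - firstForm γ F w 1 Complex.I * secondForm γ F ν w Complex.I 1
    + firstForm γ F w Complex.I Complex.I * secondForm γ F ν w 1 1) /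
  (2 * (firstForm γ F w 1 1 * firstForm γ F w Complex.I Complex.I
    - firstForm γ F w 1 Complex.I ^ 2))

/-! ### Surfaces parametrized by a Riemann surface -/

variable {S : Type*} [TopologicalSpace S] [ChartedSpace ℂ S]

/-- The conformal parameters (holomorphic charts) of a Riemann surface. -/
abbrev conformalParameters (S : Type*) [TopologicalSpace S] [ChartedSpace ℂ S] :
    Set (OpenPartialHomeomorph S ℂ) :=
  IsManifold.maximalAtlas 𝓘(ℂ) ω S

/-- `f` is a conformal immersion: in every conformal parameter `z` the induced metric is `λ |dz|²`
with `λ > 0`. -/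
def IsConformalImmersion (γ : LeftInvariantMetric X) (f : S → X) : Prop :=
  ContMDiff 𝓘(ℝ, ℂ) I3 ∞ f ∧
  ∀ φ ∈ conformalParameters S, ∀ w ∈ φ.target,
    ∃ lam : ℝ, 0 < lam ∧ ∀ v : ℂ, firstForm γ (f ∘ φ.symm) w v v = lam * ‖v‖ ^ 2

/-- `G : S → T_1 X` is the left invariant Gauss map of the immersion `f`: the left translation of
`G p` to `f p` is the unit normal vector `N` of `f` at `p` for which `(f_x, f_y, N)` is positively
oriented in every conformal parameter `x + iy`. The orientation of `X` is the one for which the left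
invariant extension of the basis `e` is positive. -/
def IsLeftGaussMap (γ : LeftInvariantMetric X) (e : Module.Basis (Fin 3) ℝ (GroupLieAlgebra I3 X))
    (f : S → X) (G : S → GroupLieAlgebra I3 X) : Prop :=
  ∀ φ ∈ conformalParameters S, ∀ p ∈ φ.source,
    let F : ℂ → X := f ∘ φ.symm
    let w : ℂ := φ p
    let N : TangentSpace I3 (F w) := mulInvariantVectorField (G p) (F w)
    γ.metric.inner (F w) N N = 1 ∧
    (∀ v : ℂ, γ.metric.inner (F w) N (surfaceDeriv F w v) = 0) ∧
    0 < e.det ![leftLogDeriv F w 1, leftLogDeriv F w Complex.I, G p]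

/-- `f` is a conformally immersed `H`-surface: a conformal immersion of constant mean curvature `H`
with respect to its oriented unit normal. -/
def IsHSurface (γ : LeftInvariantMetric X) (e : Module.Basis (Fin 3) ℝ (GroupLieAlgebra I3 X))
    (H : ℝ) (f : S → X) : Prop :=
  IsConformalImmersion γ f ∧
  ∃ G : S → GroupLieAlgebra I3 X, IsLeftGaussMap γ e f G ∧
    ∀ φ ∈ conformalParameters S, ∀ p ∈ φ.source,
      meanCurvature γ (f ∘ φ.symm) (G p) (φ p) = H

/-- Stereographic projection from the south pole `-e 2` of the unit sphere of `T_1 X`. -/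
def stereographic (e : Module.Basis (Fin 3) ℝ (GroupLieAlgebra I3 X)) (v : GroupLieAlgebra I3 X) :
    OnePoint ℂ :=
  if e.repr v 2 = -1 then OnePoint.infty
  else (((e.repr v 0 + e.repr v 1 * Complex.I) / (1 + e.repr v 2) : ℂ) : OnePoint ℂ)

/-- `g` is the stereographically projected left invariant Gauss map of `f`. -/
def HasGaussMap (γ : LeftInvariantMetric X) (e : Module.Basis (Fin 3) ℝ (GroupLieAlgebra I3 X))
    (f : S → X) (g : S → OnePoint ℂ) : Prop :=
  ∃ G : S → GroupLieAlgebra I3 X, IsLeftGaussMap γ e f G ∧ ∀ p, g p = stereographic e (G p)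

end Group

/-! ### The potential and the Gauss map equation -/

/-- The `H`-potential on `ℂ`. -/
def hPotential (H : ℝ) : StructureConstants → ℂ → ℂ
  | .unimodular c₁ c₂ c₃, q =>
      let μ₁ : ℝ := (-c₁ + c₂ + c₃) / 2
      let μ₂ : ℝ := (c₁ - c₂ + c₃) / 2
      let μ₃ : ℝ := (c₁ + c₂ - c₃) / 2
      H * (1 + ‖q‖ ^ 2) ^ 2 - Complex.I / 2 *
        (μ₂ * ‖1 + q ^ 2‖ ^ 2 + μ₁ * ‖1 - q ^ 2‖ ^ 2 + 4 * μ₃ * ‖q‖ ^ 2)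
  | .nonUnimodular a b, q =>
      H * (1 + ‖q‖ ^ 2) ^ 2 - (1 - ‖q‖ ^ 4) - a * (q ^ 2 - (starRingEnd ℂ q) ^ 2)
        - Complex.I * b * (2 * ‖q‖ ^ 2 - a * (q ^ 2 + (starRingEnd ℂ q) ^ 2))

/-- A potential `R` vanishes at a point of the Riemann sphere; at `∞` this means that
`R(q)/|q|⁴ → 0` as `q → ∞`. -/
def PotentialVanishesAt (R : ℂ → ℂ) : OnePoint ℂ → Prop
  | .infty => Filter.Tendsto (fun q : ℂ ↦ R q / ‖q‖ ^ 4) (Filter.cocompact ℂ) (𝓝 0)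
  | .some q => R q = 0

/-- The potential expressed in the coordinate `h = 1/q` of the Riemann sphere near `∞`, that is
`|h|⁴ R(1/h)`, extended to `h = 0` by its limit (which is `lim R(q)/|q|⁴` as `q → ∞`). -/
def potentialAtInfinity (R : ℂ → ℂ) (h : ℂ) : ℂ :=
  if h = 0 then Filter.limUnder (Filter.cocompact ℂ) (fun q : ℂ ↦ R q / ‖q‖ ^ 4)
  else ‖h‖ ^ 4 * R h⁻¹

/-- The limit of `R(q)/|q|⁴` as `q → ∞` exists for the `H`-potential. -/
theorem exists_tendsto_hPotential (H : ℝ) (s : StructureConstants) :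
    ∃ l : ℂ, Filter.Tendsto (fun q : ℂ ↦ hPotential H s q / ‖q‖ ^ 4) (Filter.cocompact ℂ) (𝓝 l) := by
  have hinv : Filter.Tendsto (fun q : ℂ ↦ q⁻¹) (Filter.cocompact ℂ) (𝓝 0) := by
    rw [← Metric.cobounded_eq_cocompact]
    exact Filter.tendsto_inv₀_cobounded
  have hne : ∀ᶠ q : ℂ in Filter.cocompact ℂ, q ≠ 0 := by
    rw [← Metric.cobounded_eq_cocompact]
    exact Bornology.eventually_ne_cobounded 0
  suffices h : ∃ P : ℂ → ℂ, Continuous P ∧ ∀ q : ℂ, q ≠ 0 →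
      P q⁻¹ = hPotential H s q / ‖q‖ ^ 4 by
    obtain ⟨P, hP, h⟩ := h
    exact ⟨P 0, ((hP.tendsto 0).comp hinv).congr' (hne.mono fun q hq ↦ h q hq)⟩
  have key : ∀ q : ℂ, (‖q‖ : ℂ) ^ 2 = q * starRingEnd ℂ q := fun q ↦ (Complex.mul_conj' q).symm
  have key4 : ∀ q : ℂ, (‖q‖ : ℂ) ^ 4 = (q * starRingEnd ℂ q) ^ 2 := fun q ↦ by
    rw [← key]; ring
  cases s with
  | unimodular c₁ c₂ c₃ =>
    refine ⟨hPotential H (.unimodular c₁ c₂ c₃), ?_, fun q hq ↦ ?_⟩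
    · unfold hPotential; fun_prop
    · have hq' : starRingEnd ℂ q ≠ 0 := by simpa using hq
      simp only [hPotential, key, key4, map_add, map_sub, map_one, map_pow, map_inv₀]
      field_simp
      ring
  | nonUnimodular a b =>
    refine ⟨fun h ↦ H * (1 + ‖h‖ ^ 2) ^ 2 - (‖h‖ ^ 4 - 1)
      - a * ((starRingEnd ℂ h) ^ 2 - h ^ 2)
      - Complex.I * b * (2 * ‖h‖ ^ 2 - a * (h ^ 2 + (starRingEnd ℂ h) ^ 2)), ?_, fun q hq ↦ ?_⟩
    · have := Complex.continuous_conj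
      fun_prop
    · have hq' : starRingEnd ℂ q ≠ 0 := by simpa using hq
      simp only [hPotential, key, key4, map_inv₀]
      field_simp
      ring

/-- The Wirtinger derivative `u_z = (u_x - i u_y) / 2`. -/
def dz (u : ℂ → ℂ) (w : ℂ) : ℂ :=
  (fderiv ℝ u w 1 - Complex.I * fderiv ℝ u w Complex.I) / 2

/-- The Wirtinger derivative `u_z̄ = (u_x + i u_y) / 2`. -/
def dzbar (u : ℂ → ℂ) (w : ℂ) : ℂ :=
  (fderiv ℝ u w 1 + Complex.I * fderiv ℝ u w Complex.I) / 2

/-- The equation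
`u_{zz̄} = (R_q/R)(u) u_z u_z̄ + (R_q̄/R - conj (R_q)/conj R)(u) |u_z|²` at the point `w`. -/
def GaussEquationAt (R : ℂ → ℂ) (u : ℂ → ℂ) (w : ℂ) : Prop :=
  dzbar (dz u) w =
    dz R (u w) / R (u w) * dz u w * dzbar u w +
    (dzbar R (u w) / R (u w) - starRingEnd ℂ (dz R (u w)) / starRingEnd ℂ (R (u w)))
      * ‖dz u w‖ ^ 2

/-- The affine coordinate of the Riemann sphere around the point `q₀`: the standard coordinate `q`
if `q₀ ∈ ℂ`, and `1/q` if `q₀ = ∞`. (The value at the one point outside of the domain of the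
coordinate is irrelevant.) -/
def sphereCoord (q₀ : OnePoint ℂ) : OnePoint ℂ → ℂ :=
  match q₀ with
  | .infty => fun q ↦ q.elim 0 (fun x ↦ x⁻¹)
  | .some _ => fun q ↦ q.elim 0 id

/-- The potential in the affine coordinate around `q₀`. -/
def potentialCoord (R : ℂ → ℂ) (q₀ : OnePoint ℂ) : ℂ → ℂ :=
  match q₀ with
  | .infty => potentialAtInfinity R
  | .some _ => R

section Surface

variable {S : Type*} [TopologicalSpace S] [ChartedSpace ℂ S]

/-- The expression of `g : S → ℂ ∪ {∞}` in the parameter `φ` of `S` and in the affine coordinate of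
the sphere around `g p`. -/
def localRep (g : S → OnePoint ℂ) (φ : OpenPartialHomeomorph S ℂ) (p : S) : ℂ → ℂ :=
  sphereCoord (g p) ∘ g ∘ φ.symm

/-- `g` is a smooth map into the Riemann sphere. -/
def IsSmoothToSphere (g : S → OnePoint ℂ) : Prop :=
  Continuous g ∧
  ∀ φ ∈ conformalParameters S, ∀ p ∈ φ.source, ContDiffAt ℝ ∞ (localRep g φ p) (φ p)

/-- `g` is a (smooth) solution of the Gauss map equation with potential `R`: at every point, with
respect to every conformal parameter; at the points with `g = ∞` the equation is read in the
coordinate `1/q` of the sphere, in which it has the same form. -/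
def SolvesGaussEquation (R : ℂ → ℂ) (g : S → OnePoint ℂ) : Prop :=
  IsSmoothToSphere g ∧
  ∀ φ ∈ conformalParameters S, ∀ p ∈ φ.source,
    GaussEquationAt (potentialCoord R (g p)) (localRep g φ p) (φ p)

/-- `g_z ≠ 0` everywhere; where `g = ∞` this means `(1/g)_z ≠ 0`, i.e. `lim g_z / g² ≠ 0`. -/
def NowhereAntiholomorphic (g : S → OnePoint ℂ) : Prop :=
  ∀ φ ∈ conformalParameters S, ∀ p ∈ φ.source, dz (localRep g φ p) (φ p) ≠ 0

end Surface

end MetricLie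

end

open MetricLie

/-!
A conformal immersion `F` into `X` is studied through its left logarithmic derivative `F⁻¹ dF`,
in coordinates with respect to an orthonormal basis in which the bracket is
`[x, y]ₖ = ∑ₘ (x × y)ₘ Lₘₖ`. Both kinds of canonical bases are of this form, and the potentials
of both are instances of one polynomial `pot L H` (`hPotential_eq_pot`).

**The system.** Conformality says that `F⁻¹ F_z` is isotropic, hence `F⁻¹ F_z = ζ isoVec(ū)`, where
`u` is the Gauss map and `ζ` a nonvanishing function (`eq_mul_isoVec`). By the Koszul formula,
`∇_{∂_z̄} F_z` is the sum of its value for an `H`-surface, `(λ/2) H N`, of a multiple of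
`isoVec(ū)`, and of a multiple of `isoVec'(ū)`. The two coefficients vanish exactly when
`u_z = R(u) ζ` and `ζ_z̄ = -conj(R_q(u)) |ζ|²`, with `R = pot L H`; the potential is precisely the
polynomial that makes this true (`koszul_isoVec`, `nablaZ_eq`).

The Maurer–Cartan equation for `F⁻¹ dF` says that `∇_{∂_z̄} F_z` is real. An `H`-surface satisfies
it, and its mean curvature gives the normal component; together they force both coefficients to vanish,
so that the system holds (`weierstrassSystemAt_of_isHSurfaceAt`). Conversely, for a solution of the
system `∇_{∂_z̄} F_z` is a real multiple of the normal, so that the form `2 Re (ζ isoVec(ū) dz)`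
satisfies the Maurer–Cartan equation. It is then locally the logarithmic derivative of a map to
`X`, unique up to left translation, and this map is an `H`-surface
(`exists_logForm_eq`, `eventually_eq_mul_of_logForm_eq`). The integration rests on Frobenius'
theorem for total differential equations (`exists_hasFDerivAt_of_integrable`), proved here by
solving along rays.

**The Gauss map equation.** Where `R(u) ≠ 0`, the first equation of the system determines
`ζ = u_z / R(u)`, and the second one becomes the Gauss map equation for `u`
(`gaussEquationAt_iff`). Hence `u` determines the logarithmic derivative of the surface, and
`ζ ≠ 0` is the condition `u_z ≠ 0`.

**The point at infinity.** The half turn `(b₀, -b₁, -b₂)` of the basis preserves the form of the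
bracket, replaces the stereographic projection `q` by `1/q`, and the potential by `|q|⁴ R(1/q)`
(`flipBasis`, `pot_flipMatrix`). Everything above therefore applies in both affine coordinates of
the sphere, and `WeierstrassSystemAt.inv` shows that they agree where both are defined.

**Globalization.** The local surfaces exist around each point and are unique up to left
translation. Their germs form a covering space of the simply connected Riemann surface, which has
a section (`exists_global_solution`).
-/

noncomputable section

namespace MetricLie

/-! ### Total differential equations -/

section Frobenius

open Set Metric Filter
open scoped NNReal

variable {P E F : Type*} [NormedAddCommGroup P] [NormedSpace ℝ P]
  [NormedAddCommGroup E] [NormedSpace ℝ E] [NormedAddCommGroup F] [NormedSpace ℝ F]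

theorem norm_sub_sub_fderiv_le_of_lipschitzOnWith {f : E → F} {s : Set E} {C : ℝ≥0}
    (hs : Convex ℝ s) (hf : ∀ z ∈ s, DifferentiableAt ℝ f z) (hC : LipschitzOnWith C (fderiv ℝ f) s)
    {z z' : E} (hz : z ∈ s) (hz' : z' ∈ s) :
    ‖f z' - f z - fderiv ℝ f z (z' - z)‖ ≤ C * ‖z' - z‖ ^ 2 := by
  have hconv : Convex ℝ (s ∩ closedBall z ‖z' - z‖) := hs.inter (convex_closedBall _ _)
  have := hconv.norm_image_sub_le_of_norm_hasFDerivWithin_le' (f := f) (f' := fderiv ℝ f)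
    (φ := fderiv ℝ f z) (C := C * ‖z' - z‖) (x := z) (y := z')
    (fun x hx ↦ (hf x hx.1).hasFDerivAt.hasFDerivWithinAt)
    (fun x hx ↦ by
      have h1 := hC.dist_le_mul x hx.1 z hz
      rw [dist_eq_norm, dist_eq_norm] at h1
      refine h1.trans ?_
      gcongr
      simpa [dist_eq_norm] using hx.2)
    ⟨hz, by simp⟩ ⟨hz', by simp [dist_eq_norm]⟩
  refine this.trans (le_of_eq ?_)
  ring

/-- The Picard–Lindelöf theorem on `[0, 1]`, keeping track of the ball in which the solution
stays. -/
theorem exists_solution_mem_closedBall [CompleteSpace E] {f : ℝ → E → E} {y₀ : E} {a L K : ℝ≥0}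
    (hf : IsPicardLindelof f (⟨0, by simp⟩ : Icc (0 : ℝ) 1) y₀ a 0 L K) :
    ∃ c : ℝ → E, c 0 = y₀ ∧ (∀ t, c t ∈ closedBall y₀ a) ∧
      ∀ t ∈ Icc (0 : ℝ) 1, HasDerivWithinAt c (f t (c t)) (Icc 0 1) t := by
  obtain ⟨α, hα⟩ := ODE.FunSpace.exists_isFixedPt_next hf (mem_closedBall_self le_rfl)
  refine ⟨α.compProj, ?_, fun t ↦ α.compProj_mem_closedBall hf.mul_max_le, fun t ht ↦ ?_⟩
  · have := ODE.FunSpace.compProj_val (α := α) (t := (⟨0, by simp⟩ : Icc (0 : ℝ) 1))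
    simp only at this
    rw [this, ← hα, ODE.FunSpace.next_apply₀]
  · apply ODE.hasDerivWithinAt_picard_Icc (t₀ := 0) (by simp) hf.continuousOn_uncurry
      α.continuous_compProj.continuousOn (fun _ ht' ↦ α.compProj_mem_closedBall hf.mul_max_le)
      y₀ ht |>.congr_of_mem _ ht
    intro t' ht'
    nth_rw 1 [← hα]
    rw [ODE.FunSpace.compProj_of_mem ht', ODE.FunSpace.next_apply]

/-- A neighbourhood on which a `C²` map and its derivative are bounded and Lipschitz. -/
theorem exists_closedBall_bounds {f : E → F} {z₀ : E} (hf : ContDiffAt ℝ 2 f z₀) {p : E → Prop}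
    (hp : ∀ᶠ z in 𝓝 z₀, p z) :
    ∃ r : ℝ, 0 < r ∧ ∃ C : ℝ≥0, 1 ≤ C ∧ LipschitzOnWith C (fderiv ℝ f) (closedBall z₀ r) ∧
      ∀ z ∈ closedBall z₀ r, p z ∧ DifferentiableAt ℝ f z ∧ ‖f z‖ ≤ C ∧ ‖fderiv ℝ f z‖ ≤ C := by
  have h1 : ContDiffAt ℝ 1 (fderiv ℝ f) z₀ := hf.fderiv_right (by norm_num)
  obtain ⟨K, s, hs, hK⟩ := h1.exists_lipschitzOnWith
  have h2 : ∀ᶠ z in 𝓝 z₀, DifferentiableAt ℝ f z :=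
    (hf.eventually (by simp)).mono fun z hz ↦ hz.differentiableAt (by simp)
  have h3 : ∀ᶠ z in 𝓝 z₀, ‖f z‖ < ‖f z₀‖ + 1 :=
    hf.continuousAt.norm.eventually (gt_mem_nhds (lt_add_one _))
  have h4 : ∀ᶠ z in 𝓝 z₀, ‖fderiv ℝ f z‖ < ‖fderiv ℝ f z₀‖ + 1 :=
    h1.continuousAt.norm.eventually (gt_mem_nhds (lt_add_one _))
  obtain ⟨r, hr, hrs⟩ := nhds_basis_closedBall.mem_iff.1
    (inter_mem hs (hp.and (h2.and (h3.and h4))))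
  let C : ℝ≥0 := 1 + K + ‖f z₀‖₊ + ‖fderiv ℝ f z₀‖₊ + 1
  have hC : (C : ℝ) = 1 + K + ‖f z₀‖ + ‖fderiv ℝ f z₀‖ + 1 := by simp [C]
  have p1 := norm_nonneg (f z₀)
  have p2 := norm_nonneg (fderiv ℝ f z₀)
  have p3 := K.2
  simp only [NNReal.val_eq_coe] at p3
  refine ⟨r, hr, C, ?_, (hK.mono fun z hz ↦ (hrs hz).1).weaken ?_, fun z hz ↦ ?_⟩
  · rw [← NNReal.coe_le_coe, hC, NNReal.coe_one]; linarith
  · rw [← NNReal.coe_le_coe, hC]; linarith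
  · obtain ⟨-, hp, hd, hn, hn'⟩ := hrs hz
    refine ⟨hp, hd, ?_, ?_⟩ <;> rw [hC] <;> linarith

/-- Frobenius' theorem for a total differential equation `du_w = Φ(w, u(w))`: under the
integrability condition (the symmetry of the second derivative that the equation prescribes) there
is a local solution with given initial value.

The solution is constructed along the rays through `w₀`. If `c` solves the ray equation for `w`,
then `t ↦ c t + t Φ(w₀ + t (w - w₀), c t) h` solves the one for `w + h` up to an error `O(|h|²)`,
by integrability; Grönwall's inequality then gives `u (w + h) = u w + Φ(w, u w) h + O(|h|²)`. -/
theorem exists_hasFDerivAt_of_integrable [CompleteSpace E] {Φ : P × E → P →L[ℝ] E} {w₀ : P} {y₀ : E}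
    (hΦ : ContDiffAt ℝ 2 Φ (w₀, y₀))
    (hint : ∀ᶠ z in 𝓝 (w₀, y₀), ∀ v v' : P,
      fderiv ℝ Φ z (v, Φ z v) v' = fderiv ℝ Φ z (v', Φ z v') v) :
    ∃ u : P → E, u w₀ = y₀ ∧ ∀ᶠ w in 𝓝 w₀, HasFDerivAt u (Φ (w, u w)) w := by
  obtain ⟨r, hr, C, hC1, hlip', hball⟩ := exists_closedBall_bounds hΦ hint
  have hC1' : (1 : ℝ) ≤ C := by exact_mod_cast hC1
  have hC0 : (0 : ℝ) < C := by linarith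
  have hlip : LipschitzOnWith C Φ (closedBall (w₀, y₀) r) :=
    (convex_closedBall _ _).lipschitzOnWith_of_nnnorm_fderiv_le (𝕜 := ℝ)
      (fun z hz ↦ (hball z hz).2.1)
      (fun z hz ↦ by exact_mod_cast (hball z hz).2.2.2)
  obtain ⟨δ, hδ, hδr, hδC⟩ : ∃ δ : ℝ, 0 < δ ∧ δ ≤ r ∧ C * δ ≤ r / 4 := by
    refine ⟨min r (r / (4 * C)), by positivity, min_le_left _ _, ?_⟩
    calc C * min r (r / (4 * C)) ≤ C * (r / (4 * C)) := by gcongr; exact min_le_right _ _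
      _ = r / 4 := by field_simp
  obtain ⟨δ', hδ'⟩ : ∃ d : ℝ≥0, (d : ℝ) = δ := ⟨δ.toNNReal, Real.coe_toNNReal _ hδ.le⟩
  obtain ⟨ρ, hρ⟩ : ∃ d : ℝ≥0, (d : ℝ) = r / 4 :=
    ⟨(r / 4).toNNReal, Real.coe_toNNReal _ (by positivity)⟩
  have hmem : ∀ w ∈ ball w₀ δ, ∀ t ∈ Icc (0 : ℝ) 1, ∀ y ∈ closedBall y₀ r,
      (w₀ + t • (w - w₀), y) ∈ closedBall (w₀, y₀) r := by
    intro w hw t ht y hy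
    rw [mem_ball, dist_eq_norm] at hw
    rw [← closedBall_prod_same]
    refine ⟨?_, hy⟩
    simp only [mem_closedBall, dist_self_add_left, norm_smul, Real.norm_eq_abs, abs_of_nonneg ht.1]
    nlinarith [ht.2, norm_nonneg (w - w₀)]
  have hdirlip : ∀ w ∈ ball w₀ δ, ∀ t ∈ Icc (0 : ℝ) 1,
      LipschitzOnWith (C * δ') (fun y ↦ Φ (w₀ + t • (w - w₀), y) (w - w₀))
        (closedBall y₀ r) := by
    intro w hw t ht
    refine LipschitzOnWith.of_dist_le_mul fun y hy y' hy' ↦ ?_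
    rw [dist_eq_norm, ← sub_apply]
    refine (ContinuousLinearMap.le_opNorm _ _).trans ?_
    have h1 := hlip.dist_le_mul _ (hmem w hw t ht y hy) _ (hmem w hw t ht y' hy')
    rw [dist_eq_norm, dist_prod_same_left] at h1
    rw [mem_ball, dist_eq_norm] at hw
    calc _ ≤ (C * dist y y') * δ := by gcongr
      _ = _ := by push_cast; rw [hδ']; ring
  have hsol : ∀ w ∈ ball w₀ δ, ∃ c : ℝ → E, c 0 = y₀ ∧ (∀ t, c t ∈ closedBall y₀ (r / 4)) ∧
      ∀ t ∈ Icc (0 : ℝ) 1,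
        HasDerivWithinAt c (Φ (w₀ + t • (w - w₀), c t) (w - w₀)) (Icc 0 1) t := by
    intro w hw
    refine hρ ▸ exists_solution_mem_closedBall (a := ρ) (L := C * δ')
      (K := C * δ') (f := fun t y ↦ Φ (w₀ + t • (w - w₀), y) (w - w₀)) ⟨?_, ?_, ?_, ?_⟩
    · intro t ht
      exact (hdirlip w hw t ht).mono (closedBall_subset_closedBall (by rw [hρ]; linarith))
    · intro y hy t ht
      have hz := hmem w hw t ht y (closedBall_subset_closedBall (by rw [hρ]; linarith) hy)
      have hc : ContinuousAt (fun t : ℝ ↦ Φ (w₀ + t • (w - w₀), y)) t :=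
        ContinuousAt.comp (g := Φ) (f := fun t : ℝ ↦ (w₀ + t • (w - w₀), y))
          (hball _ hz).2.1.continuousAt (by fun_prop)
      exact (hc.clm_apply continuousAt_const).continuousWithinAt
    · intro t ht y hy
      have hz := hmem w hw t ht y (closedBall_subset_closedBall (by rw [hρ]; linarith) hy)
      refine (ContinuousLinearMap.le_opNorm _ _).trans ?_
      rw [mem_ball, dist_eq_norm] at hw
      push_cast
      rw [hδ']
      exact mul_le_mul (hball _ hz).2.2.1 hw.le (norm_nonneg _) hC0.le
    · simpa [hδ', hρ] using hδC
  choose! c hc0 hcmem hcder using hsol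
  refine ⟨fun w ↦ c w 1, ?_, ?_⟩
  · have hw₀ : w₀ ∈ ball w₀ δ := mem_ball_self hδ
    have := constant_of_has_deriv_right_zero (f := c w₀) (a := 0) (b := 1)
      (fun t ht ↦ (hcder w₀ hw₀ t ht).continuousWithinAt)
      (fun t ht ↦ by
        have := (hcder w₀ hw₀ t ⟨ht.1, ht.2.le⟩).mono_of_mem_nhdsWithin
          (Icc_mem_nhdsGE_of_mem ht)
        simpa using this)
    exact (this 1 (by simp)).trans (hc0 _ hw₀)
  filter_upwards [isOpen_ball.mem_nhds (mem_ball_self hδ)] with w hw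
  have hz1 := hmem w hw 1 (by simp) (c w 1)
    (closedBall_subset_closedBall (by linarith) (hcmem w hw 1))
  -- the quadratic error estimate
  obtain ⟨B, hB⟩ : ∃ B : ℝ, ∀ w' ∈ ball w₀ δ,
      ‖c w' 1 - c w 1 - Φ (w, c w 1) (w' - w)‖ ≤ B * ‖w' - w‖ ^ 2 := by
    set K : ℝ≥0 := C * δ' with hK
    have hK0 : (K : ℝ) ≠ 0 := by
      rw [hK, NNReal.coe_mul, hδ']; positivity
    refine ⟨(C * C ^ 2 * δ + C * C) / K * (Real.exp (K * 1) - 1), fun w' hw' ↦ ?_⟩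
    set h := w' - w with hh
    let z : ℝ → P × E := fun t ↦ (w₀ + t • (w - w₀), c w t)
    let ψ : ℝ → E := fun t ↦ c w t + t • Φ (z t) h
    have hzmem : ∀ t ∈ Icc (0 : ℝ) 1, z t ∈ closedBall (w₀, y₀) r := fun t ht ↦
      hmem w hw t ht _ (closedBall_subset_closedBall (by linarith) (hcmem w hw t))
    have hhδ : ‖h‖ ≤ 2 * δ := by
      have : h = (w' - w₀) - (w - w₀) := by rw [hh]; abel
      rw [mem_ball, dist_eq_norm] at hw hw'
      rw [this]
      refine (norm_sub_le _ _).trans (by linarith)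
    have hψmem : ∀ t ∈ Icc (0 : ℝ) 1, ψ t ∈ closedBall y₀ r := by
      intro t ht
      have h1 := hcmem w hw t
      rw [mem_closedBall, dist_eq_norm] at h1 ⊢
      have h2 : ‖t • Φ (z t) h‖ ≤ 1 * (C * (2 * δ)) := by
        rw [norm_smul]
        refine mul_le_mul ?_ ((ContinuousLinearMap.le_opNorm _ _).trans ?_) (norm_nonneg _)
          zero_le_one
        · rw [Real.norm_eq_abs, abs_of_nonneg ht.1]; exact ht.2
        · exact mul_le_mul (hball _ (hzmem t ht)).2.2.1 hhδ (norm_nonneg _) hC0.le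
      calc ‖ψ t - y₀‖ = ‖(c w t - y₀) + t • Φ (z t) h‖ := by congr 1; simp only [ψ]; abel
        _ ≤ r / 4 + 1 * (C * (2 * δ)) := (norm_add_le _ _).trans (add_le_add h1 h2)
        _ ≤ r := by nlinarith
    have hzder : ∀ t ∈ Icc (0 : ℝ) 1,
        HasDerivWithinAt z (w - w₀, Φ (z t) (w - w₀)) (Icc 0 1) t := by
      intro t ht
      refine HasDerivWithinAt.prodMk ?_ (hcder w hw t ht)
      simpa using ((hasDerivWithinAt_id t (Icc (0:ℝ) 1)).smul_const (w - w₀)).const_add w₀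
    have hψder : ∀ t ∈ Icc (0 : ℝ) 1, HasDerivWithinAt ψ (Φ (z t) (w - w₀) + (Φ (z t) h +
        t • fderiv ℝ Φ (z t) (w - w₀, Φ (z t) (w - w₀)) h)) (Icc 0 1) t := by
      intro t ht
      have h1 : HasDerivWithinAt (fun t ↦ Φ (z t))
          (fderiv ℝ Φ (z t) (w - w₀, Φ (z t) (w - w₀))) (Icc 0 1) t :=
        (hball _ (hzmem t ht)).2.1.hasFDerivAt.comp_hasDerivWithinAt t (hzder t ht)
      have h2 := h1.clm_apply (hasDerivWithinAt_const t (Icc (0:ℝ) 1) h)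
      have h3 := (hasDerivWithinAt_id t (Icc (0:ℝ) 1)).smul h2
      have h4 := (hcder w hw t ht).add h3
      refine h4.congr_deriv ?_
      simp [z, add_comm]
    have key := dist_le_of_approx_trajectories_ODE_of_mem (a := 0) (b := 1) (K := K) (δ := 0)
      (εf := 0) (εg := (C * C ^ 2 * δ + C * C) * ‖h‖ ^ 2)
      (v := fun t y ↦ Φ (w₀ + t • (w' - w₀), y) (w' - w₀)) (s := fun _ ↦ closedBall y₀ r)
      (f := c w') (g := ψ)
      (f' := fun t ↦ Φ (w₀ + t • (w' - w₀), c w' t) (w' - w₀))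
      (g' := fun t ↦ Φ (z t) (w - w₀) + (Φ (z t) h +
        t • fderiv ℝ Φ (z t) (w - w₀, Φ (z t) (w - w₀)) h))
      (fun t ht ↦ hdirlip w' hw' t ⟨ht.1, ht.2.le⟩)
      (fun t ht ↦ (hcder w' hw' t ht).continuousWithinAt)
      (fun t ht ↦ (hcder w' hw' t ⟨ht.1, ht.2.le⟩).mono_of_mem_nhdsWithin
        (Icc_mem_nhdsGE_of_mem ht))
      (fun t ht ↦ by simp)
      (fun t ht ↦ closedBall_subset_closedBall (by linarith) (hcmem w' hw' t))
      (fun t ht ↦ (hψder t ht).continuousWithinAt)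
      (fun t ht ↦ (hψder t ⟨ht.1, ht.2.le⟩).mono_of_mem_nhdsWithin (Icc_mem_nhdsGE_of_mem ht))
      (fun t ht ↦ ?_)
      (fun t ht ↦ hψmem t ⟨ht.1, ht.2.le⟩)
      (by simp [ψ, hc0 _ hw, hc0 _ hw'])
      1 (by simp)
    · rw [gronwallBound_of_K_ne_0 hK0, dist_eq_norm] at key
      have e1 : c w' 1 - c w 1 - Φ (w, c w 1) h = c w' 1 - ψ 1 := by
        simp only [ψ, z, one_smul, add_sub_cancel]; abel
      rw [e1]
      refine key.trans (le_of_eq ?_)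
      simp only [sub_zero]
      ring
    · have ht' : t ∈ Icc (0 : ℝ) 1 := ⟨ht.1, ht.2.le⟩
      have hz := hzmem t ht'
      set z' : P × E := (w₀ + t • (w' - w₀), ψ t) with hz'
      have hz'mem : z' ∈ closedBall (w₀, y₀) r := hmem w' hw' t ht' _ (hψmem t ht')
      have hk : z' - z t = t • (h, Φ (z t) h) := by
        simp only [hz', z, ψ, Prod.mk_sub_mk, Prod.smul_mk, Prod.mk.injEq]
        refine ⟨?_, by abel⟩
        rw [hh, add_sub_add_left_eq_sub, ← smul_sub]
        congr 1; abel
      have hkn : ‖z' - z t‖ ≤ C * ‖h‖ := by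
        rw [hk, norm_smul, Real.norm_eq_abs, abs_of_nonneg ht'.1, Prod.norm_def]
        have : max ‖h‖ ‖Φ (z t) h‖ ≤ C * ‖h‖ := by
          refine max_le (le_mul_of_one_le_left (norm_nonneg _) hC1') ?_
          exact (ContinuousLinearMap.le_opNorm _ _).trans
            (mul_le_mul_of_nonneg_right (hball _ hz).2.2.1 (norm_nonneg _))
        calc t * max ‖h‖ ‖Φ (z t) h‖ ≤ 1 * max ‖h‖ ‖Φ (z t) h‖ := by gcongr; exact ht'.2
          _ ≤ _ := by rw [one_mul]; exact this
      have htay := norm_sub_sub_fderiv_le_of_lipschitzOnWith (convex_closedBall _ _)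
        (fun z hz ↦ (hball z hz).2.1) hlip' hz hz'mem
      have hsym := (hball _ hz).1 h (w - w₀)
      have e1 : Φ (z t) (w - w₀) + (Φ (z t) h +
            t • fderiv ℝ Φ (z t) (w - w₀, Φ (z t) (w - w₀)) h) - Φ z' (w' - w₀)
          = -((Φ z' - Φ (z t) - fderiv ℝ Φ (z t) (z' - z t)) (w' - w₀))
            - fderiv ℝ Φ (z t) (z' - z t) h := by
        have e2 : w' - w₀ = (w - w₀) + h := by rw [hh]; abel
        rw [← hsym, hk, e2]
        simp only [map_smul, sub_apply, smul_apply, map_add]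
        module
      rw [dist_eq_norm, e1]
      rw [mem_ball, dist_eq_norm] at hw'
      calc _ ≤ (C * ‖z' - z t‖ ^ 2) * δ + (C * ‖z' - z t‖) * ‖h‖ := by
            refine (norm_sub_le _ _).trans (add_le_add ?_ ?_)
            · rw [norm_neg]
              refine (ContinuousLinearMap.le_opNorm _ _).trans ?_
              gcongr
            · refine (ContinuousLinearMap.le_opNorm _ _).trans ?_
              gcongr
              refine (ContinuousLinearMap.le_opNorm _ _).trans ?_
              gcongr
              exact (hball _ hz).2.2.2
        _ ≤ (C * (C * ‖h‖) ^ 2) * δ + (C * (C * ‖h‖)) * ‖h‖ := by gcongr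
        _ = _ := by ring
  refine HasFDerivAt.of_isLittleO ?_
  refine Asymptotics.IsBigO.trans_isLittleO (g := fun w' ↦ ‖w' - w‖ ^ 2) ?_ ?_
  · refine Asymptotics.IsBigO.of_bound B ?_
    filter_upwards [isOpen_ball.mem_nhds hw] with w' hw'
    simpa using hB w' hw'
  · have : (fun w' : P ↦ ‖w' - w‖ ^ 2) = (fun x : P ↦ ‖x‖ ^ 2) ∘ fun w' ↦ w' - w := rfl
    rw [this]
    have h2 : (fun x : P ↦ ‖x‖ ^ 2) =o[𝓝 0] fun x : P ↦ x := by
      simpa using (Asymptotics.isLittleO_norm_pow_id (E' := P) one_lt_two)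
    refine h2.comp_tendsto (k := fun w' ↦ w' - w) ?_
    have : Continuous fun w' : P ↦ w' - w := by fun_prop
    simpa using this.tendsto w

/-- Solutions of a smooth total differential equation are smooth. -/
theorem contDiffAt_of_hasFDerivAt {Φ : P × E → P →L[ℝ] E} {u : P → E} {w₀ : P}
    (hΦ : ContDiffAt ℝ ∞ Φ (w₀, u w₀)) (hu : ∀ᶠ w in 𝓝 w₀, HasFDerivAt u (Φ (w, u w)) w) :
    ContDiffAt ℝ ∞ u w₀ := by
  rw [contDiffAt_infty]
  intro n
  induction n with
  | zero =>
    rw [Nat.cast_zero, contDiffAt_zero]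
    refine ⟨{w | HasFDerivAt u (Φ (w, u w)) w}, hu, fun w hw ↦ ?_⟩
    exact HasFDerivAt.continuousAt hw |>.continuousWithinAt
  | succ n ih =>
    rw [Nat.cast_succ, contDiffAt_succ_iff_hasFDerivAt]
    refine ⟨fun w ↦ Φ (w, u w), ⟨_, hu, fun w hw ↦ hw⟩, ?_⟩
    exact ContDiffAt.comp w₀ (g := Φ) (f := fun w ↦ (w, u w)) (hΦ.of_le (by exact_mod_cast le_top))
      (contDiffAt_id.prodMk ih)

/-- Local uniqueness for a total differential equation. -/
theorem eventuallyEq_of_hasFDerivAt {Φ : P × E → P →L[ℝ] E} {u₁ u₂ : P → E} {w₀ : P}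
    (hΦ : ContDiffAt ℝ 2 Φ (w₀, u₁ w₀))
    (h₁ : ∀ᶠ w in 𝓝 w₀, HasFDerivAt u₁ (Φ (w, u₁ w)) w)
    (h₂ : ∀ᶠ w in 𝓝 w₀, HasFDerivAt u₂ (Φ (w, u₂ w)) w) (h : u₁ w₀ = u₂ w₀) :
    u₁ =ᶠ[𝓝 w₀] u₂ := by
  obtain ⟨r, hr, C, hC1, -, hball⟩ := exists_closedBall_bounds hΦ (p := fun _ ↦ True) (by simp)
  have hlip : LipschitzOnWith C Φ (closedBall (w₀, u₁ w₀) r) :=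
    (convex_closedBall _ _).lipschitzOnWith_of_nnnorm_fderiv_le (𝕜 := ℝ)
      (fun z hz ↦ (hball z hz).2.1)
      (fun z hz ↦ by exact_mod_cast (hball z hz).2.2.2)
  have c₁ : ContinuousAt u₁ w₀ := h₁.self_of_nhds.continuousAt
  have c₂ : ContinuousAt u₂ w₀ := h₂.self_of_nhds.continuousAt
  have m₁ := c₁.preimage_mem_nhds (closedBall_mem_nhds _ hr)
  have m₂ := c₂.preimage_mem_nhds (closedBall_mem_nhds _ hr)
  rw [← h] at m₂
  obtain ⟨δ, hδ, hδs⟩ := nhds_basis_closedBall.mem_iff.1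
    (inter_mem (inter_mem h₁ h₂) (inter_mem m₁ m₂))
  filter_upwards [closedBall_mem_nhds w₀ (lt_min hδ hr)] with w hw
  rw [mem_closedBall, dist_eq_norm] at hw
  have hseg : ∀ t ∈ Icc (0 : ℝ) 1, ‖t • (w - w₀)‖ ≤ min δ r := by
    intro t ht
    rw [norm_smul, Real.norm_eq_abs, abs_of_nonneg ht.1]
    nlinarith [ht.2, norm_nonneg (w - w₀)]
  have hs : ∀ t ∈ Icc (0 : ℝ) 1, w₀ + t • (w - w₀) ∈ closedBall w₀ δ := by
    intro t ht
    simpa using (hseg t ht).trans (min_le_left _ _)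
  have hs' : ∀ t ∈ Icc (0 : ℝ) 1, w₀ + t • (w - w₀) ∈ closedBall w₀ r := by
    intro t ht
    simpa using (hseg t ht).trans (min_le_right _ _)
  have hline : ∀ t : ℝ, HasDerivAt (fun t : ℝ ↦ w₀ + t • (w - w₀)) (w - w₀) t := by
    intro t
    simpa using ((hasDerivAt_id t).smul_const (w - w₀)).const_add w₀
  have d₁ : ∀ t ∈ Icc (0 : ℝ) 1, HasDerivAt (fun t : ℝ ↦ u₁ (w₀ + t • (w - w₀)))
      (Φ (w₀ + t • (w - w₀), u₁ (w₀ + t • (w - w₀))) (w - w₀)) t := fun t ht ↦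
    HasFDerivAt.comp_hasDerivAt t (hδs (hs t ht)).1.1 (hline t)
  have d₂ : ∀ t ∈ Icc (0 : ℝ) 1, HasDerivAt (fun t : ℝ ↦ u₂ (w₀ + t • (w - w₀)))
      (Φ (w₀ + t • (w - w₀), u₂ (w₀ + t • (w - w₀))) (w - w₀)) t := fun t ht ↦
    HasFDerivAt.comp_hasDerivAt t (hδs (hs t ht)).1.2 (hline t)
  have key := ODE_solution_unique_of_mem_Icc_right (a := 0) (b := 1) (K := C * ‖w - w₀‖₊)
    (v := fun t y ↦ Φ (w₀ + t • (w - w₀), y) (w - w₀)) (s := fun _ ↦ closedBall (u₁ w₀) r)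
    (f := fun t : ℝ ↦ u₁ (w₀ + t • (w - w₀))) (g := fun t : ℝ ↦ u₂ (w₀ + t • (w - w₀)))
    (fun t ht ↦ ?_)
    (fun t ht ↦ (d₁ t ht).continuousAt.continuousWithinAt)
    (fun t ht ↦ (d₁ t ⟨ht.1, ht.2.le⟩).hasDerivWithinAt)
    (fun t ht ↦ (hδs (hs t ⟨ht.1, ht.2.le⟩)).2.1)
    (fun t ht ↦ (d₂ t ht).continuousAt.continuousWithinAt)
    (fun t ht ↦ (d₂ t ⟨ht.1, ht.2.le⟩).hasDerivWithinAt)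
    (fun t ht ↦ (hδs (hs t ⟨ht.1, ht.2.le⟩)).2.2)
    (by simp [h]) (x := 1) (by simp)
  · simpa using key
  · have ht' : t ∈ Icc (0 : ℝ) 1 := ⟨ht.1, ht.2.le⟩
    refine LipschitzOnWith.of_dist_le_mul fun y hy y' hy' ↦ ?_
    rw [dist_eq_norm, ← sub_apply]
    refine (ContinuousLinearMap.le_opNorm _ _).trans ?_
    have h1 := hlip.dist_le_mul (w₀ + t • (w - w₀), y)
      (by rw [← closedBall_prod_same]; exact ⟨hs' t ht', hy⟩) (w₀ + t • (w - w₀), y')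
      (by rw [← closedBall_prod_same]; exact ⟨hs' t ht', hy'⟩)
    rw [dist_eq_norm, dist_prod_same_left] at h1
    calc _ ≤ (C * dist y y') * ‖w - w₀‖ := by gcongr
      _ = _ := by push_cast; ring

end Frobenius

/-! ### Left invariant vector fields in a chart -/

section LieGroup

open Set Filter VectorField Bundle

variable {X : Type*} [TopologicalSpace X] [ChartedSpace E3 X] [Group X] [LieGroup I3 ∞ X]

instance lieGroup_minSmoothness : LieGroup I3 (minSmoothness ℝ 3) X :=
  LieGroup.of_le (n := ∞) (by
    rw [minSmoothness_of_isRCLikeNormedField]; exact ENat.LEInfty.out)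

/-- Left invariant vector fields of a smooth Lie group are smooth. The field is the composition of
`p ↦ ((p, 0), (1, v))` with the derivative of the multiplication. -/
theorem contMDiff_mulInvariantVectorField_infty (v : GroupLieAlgebra I3 X) :
    ContMDiff I3 I3.tangent ∞
      (fun p : X ↦ (⟨p, mulInvariantVectorField v p⟩ : TangentBundle I3 X)) := by
  let fg : X → TangentBundle I3 X := fun p ↦ TotalSpace.mk' E3 p 0
  have sfg : ContMDiff I3 I3.tangent ∞ fg := contMDiff_zeroSection _ _
  let fv : X → TangentBundle I3 X := fun _ ↦ TotalSpace.mk' E3 1 v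
  have sfv : ContMDiff I3 I3.tangent ∞ fv := contMDiff_const
  let F₁ : X → (TangentBundle I3 X × TangentBundle I3 X) := fun p ↦ (fg p, fv p)
  have S₁ : ContMDiff I3 (I3.tangent.prod I3.tangent) ∞ F₁ := sfg.prodMk sfv
  let F₂ : (TangentBundle I3 X × TangentBundle I3 X) → TangentBundle (I3.prod I3) (X × X) :=
    (equivTangentBundleProd I3 X I3 X).symm
  have S₂ : ContMDiff (I3.tangent.prod I3.tangent) (I3.prod I3).tangent ∞ F₂ :=
    contMDiff_equivTangentBundleProd_symm
  let F₃ : TangentBundle (I3.prod I3) (X × X) → TangentBundle I3 X :=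
    tangentMap (I3.prod I3) I3 (fun p : X × X ↦ p.1 * p.2)
  have S₃ : ContMDiff (I3.prod I3).tangent I3.tangent ∞ F₃ :=
    ContMDiff.contMDiff_tangentMap (n := ∞) (contMDiff_mul I3 ∞) (m := ∞) le_rfl
  convert! (S₃.comp S₂).comp S₁ with p
  · simp [F₁, F₂, F₃, fg, fv]
  · simp only [Function.comp_apply, tangentMap, F₃, F₂, F₁, fg, fv]
    rw [mfderiv_prod_eq_add_apply ((contMDiff_mul I3 ∞).mdifferentiableAt (by simp))]
    simp +instances only [mulInvariantVectorField]
    refine Eq.trans ?_ (congrArg₂ (fun x y : E3 ↦ x + y) (ContinuousLinearMap.map_zero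
      (mfderiv I3 I3 (fun z : X ↦ z * 1) p)).symm rfl)
    exact (zero_add _).symm

/-- The left invariant vector field with value `v` at the identity, in the chart around `x₀`. -/
def chartField (x₀ : X) (v : GroupLieAlgebra I3 X) : E3 → E3 :=
  mpullback 𝓘(ℝ, E3) I3 (extChartAt I3 x₀).symm (mulInvariantVectorField v)

theorem isInvertible_mfderiv_chart_symm {x₀ : X} {y : E3} (hy : y ∈ (extChartAt I3 x₀).target) :
    (mfderiv 𝓘(ℝ, E3) I3 (extChartAt I3 x₀).symm y).IsInvertible := by
  have := isInvertible_mfderivWithin_extChartAt_symm hy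
  rwa [I3.range_eq_univ, mfderivWithin_univ] at this

theorem contMDiffAt_chart_symm {x₀ : X} {y : E3} (hy : y ∈ (extChartAt I3 x₀).target) :
    ContMDiffAt 𝓘(ℝ, E3) I3 ∞ (extChartAt I3 x₀).symm y :=
  (contMDiffOn_extChartAt_symm (n := ∞) x₀).contMDiffAt ((isOpen_extChartAt_target x₀).mem_nhds hy)

theorem mfderiv_chartField {x₀ : X} (v : GroupLieAlgebra I3 X) {y : E3}
    (hy : y ∈ (extChartAt I3 x₀).target) :
    mfderiv 𝓘(ℝ, E3) I3 (extChartAt I3 x₀).symm y (chartField x₀ v y) =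
      mulInvariantVectorField v ((extChartAt I3 x₀).symm y) :=
  ((isInvertible_mfderiv_chart_symm hy).inverse_apply_eq.1 rfl).symm

theorem contDiffAt_chartField {x₀ : X} (v : GroupLieAlgebra I3 X) {y : E3}
    (hy : y ∈ (extChartAt I3 x₀).target) : ContDiffAt ℝ ∞ (chartField x₀ v) y := by
  have := ContMDiffAt.mpullback_vectorField_preimage (n := ∞) (m := ∞)
    (contMDiff_mulInvariantVectorField_infty v _)
    (contMDiffAt_chart_symm hy) (isInvertible_mfderiv_chart_symm hy) (by simp)
  rw [← contMDiffWithinAt_univ] at this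
  exact contDiffWithinAt_univ.1 (contMDiffWithinAt_vectorSpace_iff_contDiffWithinAt.1 this)

theorem lieBracket_chartField {x₀ : X} (v w : GroupLieAlgebra I3 X) {y : E3}
    (hy : y ∈ (extChartAt I3 x₀).target) :
    lieBracket ℝ (chartField x₀ v) (chartField x₀ w) y = chartField x₀ ⁅v, w⁆ y := by
  have h := mpullback_mlieBracket (n := ∞) (V := mulInvariantVectorField v)
    (W := mulInvariantVectorField w)
    (f := (extChartAt I3 x₀).symm) (x₀ := y) (I := 𝓘(ℝ, E3)) (I' := I3)
    (mdifferentiableAt_mulInvariantVectorField v) (mdifferentiableAt_mulInvariantVectorField w)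
    (contMDiffAt_chart_symm hy) (by
      rw [minSmoothness_of_isRCLikeNormedField]; exact ENat.LEInfty.out)
  rw [← mulInvariantVector_mlieBracket] at h
  have h2 : ∀ V W : (x : E3) → TangentSpace 𝓘(ℝ, E3) x,
      mlieBracket 𝓘(ℝ, E3) V W y = lieBracket ℝ V W y := fun V W ↦ by
    rw [← mlieBracketWithin_univ, mlieBracketWithin_eq_lieBracketWithin]
    exact congrFun lieBracketWithin_univ y
  exact (h.trans (h2 _ _)).symm


/-- Left translation by `p⁻¹` undoes left translation by `p`, at the level of derivatives. -/
theorem mfderiv_mul_left_inv_mulInvariantVectorField (p : X) (a : GroupLieAlgebra I3 X) :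
    (mfderiv I3 I3 (fun x : X ↦ p⁻¹ * x) p (mulInvariantVectorField a p) : E3) = a := by
  have h1 : MDifferentiableAt I3 I3 (fun x : X ↦ p * x) 1 :=
    (contMDiff_mul_left (I := I3) (n := ∞)).mdifferentiableAt (by simp)
  have h2 : MDifferentiableAt I3 I3 (fun x : X ↦ p⁻¹ * x) (p * 1) :=
    (contMDiff_mul_left (I := I3) (n := ∞)).mdifferentiableAt (by simp)
  have h3 := mfderiv_comp (1 : X) h2 h1
  have h4 : (fun x : X ↦ p⁻¹ * x) ∘ (fun x : X ↦ p * x) = id := by ext x; simp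
  rw [h4, mfderiv_id] at h3
  have h5 := congrArg (fun L ↦ L a) h3
  have h6 : ∀ q : X, q = p → (mfderiv I3 I3 (fun x : X ↦ p⁻¹ * x) q
      (mfderiv I3 I3 (fun x : X ↦ p * x) 1 a : E3) : E3) = mfderiv I3 I3 (fun x : X ↦ p⁻¹ * x) p
      (mulInvariantVectorField a p) := by
    rintro q rfl; rfl
  exact (h6 _ (mul_one p)).symm.trans h5.symm

/-- Left translation by `p` undoes left translation by `p⁻¹`, at the level of derivatives. -/
theorem mulInvariantVectorField_mfderiv_mul_left_inv (p : X) (a : TangentSpace I3 p) :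
    mulInvariantVectorField (I := I3) (mfderiv I3 I3 (fun x : X ↦ p⁻¹ * x) p a : E3) p = a := by
  have h1 : MDifferentiableAt I3 I3 (fun x : X ↦ p * x) (p⁻¹ * p) :=
    (contMDiff_mul_left (I := I3) (n := ∞)).mdifferentiableAt (by simp)
  have h2 : MDifferentiableAt I3 I3 (fun x : X ↦ p⁻¹ * x) p :=
    (contMDiff_mul_left (I := I3) (n := ∞)).mdifferentiableAt (by simp)
  have h3 := mfderiv_comp p h1 h2
  have h4 : (fun x : X ↦ p * x) ∘ (fun x : X ↦ p⁻¹ * x) = id := by ext x; simp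
  rw [h4, mfderiv_id] at h3
  have h5 := congrArg (fun L ↦ L a) h3
  have h6 : ∀ q : X, q = 1 → (mfderiv I3 I3 (fun x : X ↦ p * x) q
      (mfderiv I3 I3 (fun x : X ↦ p⁻¹ * x) p a : E3) : E3) =
      mulInvariantVectorField (I := I3) (mfderiv I3 I3 (fun x : X ↦ p⁻¹ * x) p a : E3) p := by
    rintro q rfl; rfl
  exact (h6 _ (inv_mul_cancel p)).symm.trans h5.symm

theorem leftLogDeriv_eq_iff (F : ℂ → X) (w v : ℂ) (a : GroupLieAlgebra I3 X) :
    leftLogDeriv F w v = a ↔ surfaceDeriv F w v = mulInvariantVectorField a (F w) := by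
  constructor
  · rintro rfl
    exact (mulInvariantVectorField_mfderiv_mul_left_inv (F w) (surfaceDeriv F w v)).symm
  · intro h
    rw [leftLogDeriv, h]
    exact mfderiv_mul_left_inv_mulInvariantVectorField (F w) a

theorem surfaceDeriv_eq (F : ℂ → X) (w v : ℂ) :
    surfaceDeriv F w v = mulInvariantVectorField (leftLogDeriv F w v) (F w) :=
  (leftLogDeriv_eq_iff F w v _).1 rfl

/-- The metric in the left invariant trivialisation of the tangent bundle. -/
theorem inner_mulInvariantVectorField (γ : LeftInvariantMetric X) (p : X)
    (a c : GroupLieAlgebra I3 X) :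
    γ.metric.inner p (mulInvariantVectorField a p) (mulInvariantVectorField c p) =
      γ.metric.inner 1 a c := by
  rw [← γ.left_invariant p 1 a c]
  have h6 : ∀ q : X, q = p → γ.metric.inner p (mulInvariantVectorField a p : E3)
      (mulInvariantVectorField c p : E3) = γ.metric.inner q (mulInvariantVectorField a p : E3)
      (mulInvariantVectorField c p : E3) := by
    rintro q rfl; rfl
  exact h6 _ (mul_one p)

theorem firstForm_eq (γ : LeftInvariantMetric X) (F : ℂ → X) (w v v' : ℂ) :
    firstForm γ F w v v' = γ.metric.inner 1 (leftLogDeriv F w v) (leftLogDeriv F w v') := by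
  rw [firstForm, surfaceDeriv_eq, surfaceDeriv_eq, inner_mulInvariantVectorField]

/-- Left translates have the same left logarithmic derivative. -/
theorem leftLogDeriv_mul_left {F : ℂ → X} {w : ℂ} (hF : MDifferentiableAt 𝓘(ℝ, ℂ) I3 F w) (a : X)
    (v : ℂ) : leftLogDeriv (fun w ↦ a * F w) w v = leftLogDeriv F w v := by
  rw [leftLogDeriv_eq_iff]
  have h1 : MDifferentiableAt I3 I3 (fun x : X ↦ a * x) (F w) :=
    (contMDiff_mul_left (I := I3) (n := ∞)).mdifferentiableAt (by simp)
  have h2 : surfaceDeriv (fun w ↦ a * F w) w v =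
      mfderiv I3 I3 (fun x : X ↦ a * x) (F w) (surfaceDeriv F w v) := by
    rw [surfaceDeriv, surfaceDeriv]
    have := mfderiv_comp w h1 hF
    exact congrArg (fun L ↦ L v) this
  have h3 : MDifferentiableAt I3 I3 (fun x : X ↦ F w * x) 1 :=
    (contMDiff_mul_left (I := I3) (n := ∞)).mdifferentiableAt (by simp)
  have h1' : MDifferentiableAt I3 I3 (fun x : X ↦ a * x) (F w * 1) :=
    (contMDiff_mul_left (I := I3) (n := ∞)).mdifferentiableAt (by simp)
  have h4 := mfderiv_comp (1 : X) h1' h3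
  have h5 : (fun x : X ↦ a * x) ∘ (fun x : X ↦ F w * x) = fun x ↦ a * F w * x := by
    ext x; simp [mul_assoc]
  rw [h5] at h4
  rw [h2, surfaceDeriv_eq]
  have h6 : ∀ q : X, q = F w → (mfderiv I3 I3 (fun x : X ↦ a * x) (F w)
      (mulInvariantVectorField (leftLogDeriv F w v) (F w)) : E3) =
      mfderiv I3 I3 (fun x : X ↦ a * x) q
      (mulInvariantVectorField (leftLogDeriv F w v) (F w) : E3) := by
    rintro q rfl; rfl
  exact (h6 _ (mul_one _)).trans (congrArg (fun L ↦ L (leftLogDeriv F w v)) h4).symm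

end LieGroup

/-! ### The Maurer–Cartan equation -/

section MaurerCartan

open Set Filter VectorField

variable {X : Type*} [TopologicalSpace X] [ChartedSpace E3 X] [Group X] [LieGroup I3 ∞ X]

/-- The structure constants of a basis of the Lie algebra: the `k`-th coordinate of `[bᵢ, bⱼ]`. -/
def structConst (b : Module.Basis (Fin 3) ℝ (GroupLieAlgebra I3 X)) (i j k : Fin 3) : ℝ :=
  b.repr ⁅b i, b j⁆ k

/-- The coordinates, with respect to a basis of the Lie algebra, of the pull-back under `F` of the
Maurer–Cartan form. -/
def logForm (b : Module.Basis (Fin 3) ℝ (GroupLieAlgebra I3 X)) (F : ℂ → X) (k : Fin 3) (w : ℂ) :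
    ℂ →L[ℝ] ℝ :=
  LinearMap.toContinuousLinearMap
    { toFun := fun v ↦ b.repr (leftLogDeriv F w v) k
      map_add' := fun v v' ↦ by
        have : leftLogDeriv F w (v + v') = leftLogDeriv F w v + leftLogDeriv F w v' := by
          rw [leftLogDeriv, surfaceDeriv]
          exact (congrArg _ (map_add _ _ _)).trans (map_add _ _ _)
        rw [this, map_add]; rfl
      map_smul' := fun c v ↦ by
        have : leftLogDeriv F w (c • v) = c • leftLogDeriv F w v := by
          rw [leftLogDeriv, surfaceDeriv]
          exact (congrArg _ (map_smul _ _ _)).trans (map_smul _ _ _)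
        rw [this, map_smul]; rfl }

theorem logForm_apply (b : Module.Basis (Fin 3) ℝ (GroupLieAlgebra I3 X)) (F : ℂ → X) (k : Fin 3)
    (w v : ℂ) : logForm b F k w v = b.repr (leftLogDeriv F w v) k := rfl

/-- The coordinates of `dα + ½ [α ∧ α]`, evaluated at `v, v'`, for a Lie algebra valued 1-form `α`
on the plane. -/
def maurerCartan (C : Fin 3 → Fin 3 → Fin 3 → ℝ) (α : Fin 3 → ℂ → ℂ →L[ℝ] ℝ) (w v v' : ℂ)
    (l : Fin 3) : ℝ :=
  fderiv ℝ (α l) w v v' - fderiv ℝ (α l) w v' v + ∑ i, ∑ j, C i j l * α i w v * α j w v'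

/-- The right hand side of the total differential equation `du = ∑ αₖ Vₖ(u)`. -/
def frameForm (V : Fin 3 → E3 → E3) (α : Fin 3 → ℂ → ℂ →L[ℝ] ℝ) (z : ℂ × E3) : ℂ →L[ℝ] E3 :=
  ∑ k, (α k z.1).smulRight (V k z.2)

theorem frameForm_apply (V : Fin 3 → E3 → E3) (α : Fin 3 → ℂ → ℂ →L[ℝ] ℝ) (z : ℂ × E3) (v : ℂ) :
    frameForm V α z v = ∑ k, α k z.1 v • V k z.2 := by
  simp [frameForm]

theorem contDiffAt_frameForm {V : Fin 3 → E3 → E3} {α : Fin 3 → ℂ → ℂ →L[ℝ] ℝ} {z : ℂ × E3}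
    (hV : ∀ k, ContDiffAt ℝ ∞ (V k) z.2) (hα : ∀ k, ContDiffAt ℝ ∞ (α k) z.1) :
    ContDiffAt ℝ ∞ (frameForm V α) z := by
  have : frameForm V α = fun z ↦ ∑ k, (α k z.1).smulRight (V k z.2) := rfl
  rw [this]
  refine ContDiffAt.sum fun k _ ↦ ContDiffAt.smulRight ?_ ?_
  · exact ContDiffAt.comp z (g := α k) (f := Prod.fst) (hα k) contDiffAt_fst
  · exact ContDiffAt.comp z (g := V k) (f := Prod.snd) (hV k) contDiffAt_snd

theorem fderiv_frameForm_apply {V : Fin 3 → E3 → E3} {α : Fin 3 → ℂ → ℂ →L[ℝ] ℝ} {z : ℂ × E3}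
    (hV : ∀ k, DifferentiableAt ℝ (V k) z.2) (hα : ∀ k, DifferentiableAt ℝ (α k) z.1)
    (v v' : ℂ) (η : E3) :
    fderiv ℝ (frameForm V α) z (v, η) v' =
      ∑ k, (fderiv ℝ (α k) z.1 v v' • V k z.2 + α k z.1 v' • fderiv ℝ (V k) z.2 η) := by
  have hk : ∀ k, HasFDerivAt (fun z : ℂ × E3 ↦ (α k z.1) v' • V k z.2)
      ((α k z.1 v') • (fderiv ℝ (V k) z.2 ∘L ContinuousLinearMap.snd ℝ ℂ E3) +
        ((ContinuousLinearMap.apply ℝ ℝ v' ∘L (fderiv ℝ (α k) z.1)) ∘L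
          ContinuousLinearMap.fst ℝ ℂ E3).smulRight (V k z.2)) z := fun k ↦ by
    have h1 : HasFDerivAt (fun z : ℂ × E3 ↦ V k z.2)
        (fderiv ℝ (V k) z.2 ∘L ContinuousLinearMap.snd ℝ ℂ E3) z :=
      (hV k).hasFDerivAt.comp z hasFDerivAt_snd
    have h2 : HasFDerivAt (fun z : ℂ × E3 ↦ α k z.1 v')
        ((ContinuousLinearMap.apply ℝ ℝ v' ∘L (fderiv ℝ (α k) z.1)) ∘L
          ContinuousLinearMap.fst ℝ ℂ E3) z := by
      have h3 : HasFDerivAt (fun w ↦ α k w v')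
          (ContinuousLinearMap.apply ℝ ℝ v' ∘L (fderiv ℝ (α k) z.1)) z.1 :=
        (ContinuousLinearMap.apply ℝ ℝ v').hasFDerivAt.comp z.1 (hα k).hasFDerivAt
      exact h3.comp z hasFDerivAt_fst
    exact h2.smul h1
  have hsum := HasFDerivAt.fun_sum (u := Finset.univ) fun k _ ↦ hk k
  have hd : DifferentiableAt ℝ (frameForm V α) z := by
    have : frameForm V α = fun z ↦ ∑ k, (α k z.1).smulRight (V k z.2) := rfl
    rw [this]
    refine DifferentiableAt.fun_sum fun k _ ↦ ?_
    have e : (fun z : ℂ × E3 ↦ (α k z.1).smulRight (V k z.2)) = fun z ↦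
      ContinuousLinearMap.smulRightL ℝ ℂ E3 (α k z.1) (V k z.2) := rfl
    rw [e]
    refine DifferentiableAt.clm_apply ?_ ((hV k).comp z differentiableAt_snd)
    exact (ContinuousLinearMap.differentiableAt _).comp z ((hα k).comp z differentiableAt_fst)
  have h4 := ((ContinuousLinearMap.apply ℝ E3 v').hasFDerivAt.comp z hd.hasFDerivAt)
  have h5 : (fun z ↦ ∑ k, (α k z.1) v' • V k z.2) =
      (ContinuousLinearMap.apply ℝ E3 v') ∘ frameForm V α := by
    ext1 z; simp [frameForm_apply]
  rw [h5] at hsum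
  have h6 := congrArg (fun L ↦ L (v, η)) (h4.unique hsum)
  simp only [ContinuousLinearMap.comp_apply, ContinuousLinearMap.apply_apply] at h6
  rw [h6]
  simp [add_comm]

/-- The failure of the integrability of `du = ∑ αₖ Vₖ(u)` is the Maurer–Cartan defect of `α`. -/
theorem fderiv_frameForm_sub {V : Fin 3 → E3 → E3} {α : Fin 3 → ℂ → ℂ →L[ℝ] ℝ} {z : ℂ × E3}
    {C : Fin 3 → Fin 3 → Fin 3 → ℝ}
    (hV : ∀ k, DifferentiableAt ℝ (V k) z.2) (hα : ∀ k, DifferentiableAt ℝ (α k) z.1)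
    (hC : ∀ i j, lieBracket ℝ (V i) (V j) z.2 = ∑ l, C i j l • V l z.2) (v v' : ℂ) :
    fderiv ℝ (frameForm V α) z (v, frameForm V α z v) v' -
      fderiv ℝ (frameForm V α) z (v', frameForm V α z v') v =
      ∑ l, maurerCartan C α z.1 v v' l • V l z.2 := by
  rw [fderiv_frameForm_apply hV hα, fderiv_frameForm_apply hV hα, frameForm_apply, frameForm_apply]
  simp only [Finset.sum_add_distrib, map_sum, map_smul, Finset.smul_sum, maurerCartan, add_smul,
    sub_smul, Finset.sum_sub_distrib]
  have e1 : ∑ l, (∑ i, ∑ j, C i j l * α i z.1 v * α j z.1 v') • V l z.2 =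
      ∑ j, ∑ i, (α j z.1 v' * α i z.1 v) • lieBracket ℝ (V i) (V j) z.2 := by
    simp only [hC, Finset.smul_sum, Finset.sum_smul, smul_smul]
    rw [Finset.sum_congr rfl fun l _ ↦ Finset.sum_comm, Finset.sum_comm]
    refine Finset.sum_congr rfl fun j _ ↦ ?_
    rw [Finset.sum_comm]
    refine Finset.sum_congr rfl fun i _ ↦ Finset.sum_congr rfl fun l _ ↦ ?_
    congr 1; ring
  rw [e1]
  simp only [lieBracket, smul_sub, Finset.sum_sub_distrib, smul_smul]
  have e2 : ∑ x, ∑ i, (α x z.1 v * α i z.1 v') • fderiv ℝ (V x) z.2 (V i z.2) =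
      ∑ x, ∑ i, (α x z.1 v' * α i z.1 v) • fderiv ℝ (V i) z.2 (V x z.2) := by
    rw [Finset.sum_comm]
    simp only [mul_comm]
  rw [e2]
  abel

theorem chartField_eq_sum (b : Module.Basis (Fin 3) ℝ (GroupLieAlgebra I3 X)) (x₀ : X)
    (a : GroupLieAlgebra I3 X) (y : E3) :
    chartField x₀ a y = ∑ k, b.repr a k • chartField x₀ (b k) y := by
  let f : GroupLieAlgebra I3 X →ₗ[ℝ] E3 :=
    { toFun := fun a ↦ chartField x₀ a y
      map_add' := fun a c ↦ by
        simp only [chartField]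
        rw [mulInvariantVectorField_add, mpullback_add_apply]; rfl
      map_smul' := fun r a ↦ by
        simp only [chartField]
        rw [mulInvariantVectorField_smul, mpullback_const_smul_apply]; rfl }
  change f a = ∑ k, b.repr a k • f (b k)
  calc f a = f (∑ k, b.repr a k • b k) := by rw [b.sum_repr]
    _ = _ := by rw [map_sum]; simp only [map_smul]

theorem chartField_injective {x₀ : X} {y : E3} (hy : y ∈ (extChartAt I3 x₀).target) :
    Function.Injective fun a : GroupLieAlgebra I3 X ↦ chartField x₀ a y := by
  intro a c hac
  have h : mulInvariantVectorField a ((extChartAt I3 x₀).symm y) =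
      mulInvariantVectorField c ((extChartAt I3 x₀).symm y) := by
    rw [← mfderiv_chartField a hy, ← mfderiv_chartField c hy]
    exact congrArg _ hac
  rw [← mfderiv_mul_left_inv_mulInvariantVectorField ((extChartAt I3 x₀).symm y) a, h,
    mfderiv_mul_left_inv_mulInvariantVectorField]

theorem linearIndependent_chartField (b : Module.Basis (Fin 3) ℝ (GroupLieAlgebra I3 X)) {x₀ : X}
    {y : E3} (hy : y ∈ (extChartAt I3 x₀).target) {c d : Fin 3 → ℝ}
    (h : ∑ k, c k • chartField x₀ (b k) y = ∑ k, d k • chartField x₀ (b k) y) : c = d := by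
  have e : ∀ c : Fin 3 → ℝ, ∑ k, c k • chartField x₀ (b k) y =
      chartField x₀ (∑ k, c k • b k) y := fun c ↦ by
    rw [chartField_eq_sum b x₀ (∑ k, c k • b k) y]
    rw [b.repr_sum_self]
  rw [e, e] at h
  have h2 := congrArg b.repr (chartField_injective hy h)
  ext k
  have h3 := DFunLike.congr_fun h2 k
  rwa [b.repr_sum_self, b.repr_sum_self] at h3

/-- A surface in the chart around `x₀` solves the total differential equation given by its
logarithmic derivative. -/
theorem hasFDerivAt_chart (b : Module.Basis (Fin 3) ℝ (GroupLieAlgebra I3 X)) {x₀ : X} {F : ℂ → X}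
    {w : ℂ} (hF : MDifferentiableAt 𝓘(ℝ, ℂ) I3 F w) (hw : F w ∈ (extChartAt I3 x₀).source) :
    HasFDerivAt (extChartAt I3 x₀ ∘ F)
      (frameForm (fun k ↦ chartField x₀ (b k)) (logForm b F) (w, extChartAt I3 x₀ (F w))) w := by
  set u : ℂ → E3 := extChartAt I3 x₀ ∘ F with hu
  have hy : u w ∈ (extChartAt I3 x₀).target := (extChartAt I3 x₀).map_source hw
  have hud : MDifferentiableAt 𝓘(ℝ, ℂ) I3 u w :=
    ((contMDiffAt_extChartAt' (n := ∞) (by rwa [← extChartAt_source I3])).mdifferentiableAt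
      (by simp)).comp w hF
  have hud' : DifferentiableAt ℝ u w := mdifferentiableAt_iff_differentiableAt.1 hud
  have hFe : F =ᶠ[𝓝 w] (extChartAt I3 x₀).symm ∘ u := by
    filter_upwards [hF.continuousAt.preimage_mem_nhds
      ((isOpen_extChartAt_source x₀).mem_nhds hw)] with w' hw'
    exact ((extChartAt I3 x₀).left_inv hw').symm
  have hσ : MDifferentiableAt 𝓘(ℝ, E3) I3 (extChartAt I3 x₀).symm (u w) :=
    (contMDiffAt_chart_symm hy).mdifferentiableAt (by simp)
  have h1 := mfderiv_comp w hσ hud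
  rw [← hFe.mfderiv_eq] at h1
  have h3 : (extChartAt I3 x₀).symm (u w) = F w := (extChartAt I3 x₀).left_inv hw
  refine hud'.hasFDerivAt.congr_fderiv (ContinuousLinearMap.ext fun v ↦ ?_)
  rw [frameForm_apply]
  simp only [logForm_apply]
  rw [← chartField_eq_sum]
  obtain ⟨L, hL⟩ := isInvertible_mfderiv_chart_symm hy
  have h2 := mfderiv_chartField (leftLogDeriv F w v) hy
  have h4 : ∀ q : X, q = F w → (mulInvariantVectorField (leftLogDeriv F w v) q : E3) =
      surfaceDeriv F w v := by
    rintro q rfl; exact (surfaceDeriv_eq F w v).symm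
  rw [← hL] at h1 h2
  have h5 : L (fderiv ℝ u w v) = L (chartField x₀ (leftLogDeriv F w v) (u w)) := by
    refine Eq.trans ?_ ((h4 _ h3).symm.trans h2.symm)
    rw [← mfderiv_eq_fderiv]
    exact (congrArg (fun M ↦ M v) h1).symm
  exact L.injective h5

/-- A solution in the chart around `x₀` of the total differential equation given by `α` is a
surface with logarithmic derivative `α`. -/
theorem logForm_of_hasFDerivAt (b : Module.Basis (Fin 3) ℝ (GroupLieAlgebra I3 X)) {x₀ : X}
    {u : ℂ → E3} {w : ℂ} {α : Fin 3 → ℂ → ℂ →L[ℝ] ℝ}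
    (hy : u w ∈ (extChartAt I3 x₀).target)
    (hu : HasFDerivAt u (frameForm (fun k ↦ chartField x₀ (b k)) α (w, u w)) w) (k : Fin 3) :
    logForm b ((extChartAt I3 x₀).symm ∘ u) k w = α k w := by
  have hσ : MDifferentiableAt 𝓘(ℝ, E3) I3 (extChartAt I3 x₀).symm (u w) :=
    (contMDiffAt_chart_symm hy).mdifferentiableAt (by simp)
  have h1 := hasFDerivAt_chart (F := (extChartAt I3 x₀).symm ∘ u) (w := w) b
    (hσ.comp w hu.differentiableAt.mdifferentiableAt) ((extChartAt I3 x₀).map_target hy)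
  have hue : extChartAt I3 x₀ ∘ (extChartAt I3 x₀).symm ∘ u =ᶠ[𝓝 w] u := by
    filter_upwards [hu.continuousAt.preimage_mem_nhds
      ((isOpen_extChartAt_target x₀).mem_nhds hy)] with w' hw'
    exact (extChartAt I3 x₀).right_inv hw'
  have h2 := (h1.congr_of_eventuallyEq hue.symm).unique hu
  ext v
  have h3 := congrArg (fun L ↦ L v) h2
  have h4 : extChartAt I3 x₀ (((extChartAt I3 x₀).symm ∘ u) w) = u w :=
    (extChartAt I3 x₀).right_inv hy
  simp only [frameForm_apply, h4] at h3
  exact congrFun (linearIndependent_chartField b hy h3) k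

theorem contDiffAt_logForm (b : Module.Basis (Fin 3) ℝ (GroupLieAlgebra I3 X)) {F : ℂ → X} {w₀ : ℂ}
    (hF : ContMDiffAt 𝓘(ℝ, ℂ) I3 ∞ F w₀) (k : Fin 3) : ContDiffAt ℝ ∞ (logForm b F k) w₀ := by
  set x₀ := F w₀ with hx₀
  set u : ℂ → E3 := extChartAt I3 x₀ ∘ F with hu
  have hw₀ : F w₀ ∈ (extChartAt I3 x₀).source := mem_extChartAt_source x₀
  have hud : ContDiffAt ℝ ∞ u w₀ := by
    rw [← contMDiffAt_iff_contDiffAt]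
    exact (contMDiffAt_extChartAt' (n := ∞) (by rwa [← extChartAt_source I3])).comp w₀ hF
  let fr : E3 → (Fin 3 → ℝ) →L[ℝ] E3 := fun y ↦
    ∑ k, (ContinuousLinearMap.proj k : (Fin 3 → ℝ) →L[ℝ] ℝ).smulRight (chartField x₀ (b k) y)
  have hfr_apply : ∀ y c, fr y c = ∑ k, c k • chartField x₀ (b k) y := fun y c ↦ by
    simp [fr]
  have hy₀ : u w₀ ∈ (extChartAt I3 x₀).target := (extChartAt I3 x₀).map_source hw₀
  have hfr : ContDiffAt ℝ ∞ (fun w ↦ fr (u w)) w₀ := by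
    refine ContDiffAt.sum fun k _ ↦ ContDiffAt.smulRight contDiffAt_const ?_
    exact ContDiffAt.comp w₀ (contDiffAt_chartField (b k) hy₀) hud
  have hinv : ∀ y ∈ (extChartAt I3 x₀).target, ∃ L : (Fin 3 → ℝ) ≃L[ℝ] E3, ↑L = fr y := by
    intro y hy
    have hinj : Function.Injective (fr y).toLinearMap := fun c d hcd ↦ by
      simp only [ContinuousLinearMap.coe_coe, hfr_apply] at hcd
      exact linearIndependent_chartField b hy hcd
    refine ⟨(LinearEquiv.ofInjectiveOfFinrankEq _ hinj (by simp)).toContinuousLinearEquiv, ?_⟩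
    ext c : 1
    simp [LinearEquiv.ofInjectiveOfFinrankEq]
  have hev : ∀ᶠ w in 𝓝 w₀, (ContinuousLinearMap.pi fun k ↦ logForm b F k w) =
      (fr (u w)).inverse ∘L fderiv ℝ u w := by
    have h1 : ∀ᶠ w in 𝓝 w₀, ContMDiffAt 𝓘(ℝ, ℂ) I3 1 F w :=
      (contMDiffAt_iff_contMDiffAt_nhds (by simp)).1 (hF.of_le (by simp))
    filter_upwards [h1, hF.continuousAt.preimage_mem_nhds
      ((isOpen_extChartAt_source x₀).mem_nhds hw₀)] with w hw1 hw2
    obtain ⟨L, hL⟩ := hinv (u w) ((extChartAt I3 x₀).map_source hw2)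
    have h3 := (hasFDerivAt_chart b (hw1.mdifferentiableAt (by simp)) hw2).fderiv
    rw [← hL, ContinuousLinearMap.inverse_equiv, hu, h3]
    ext1 v
    apply L.injective
    rw [ContinuousLinearMap.comp_apply, ContinuousLinearEquiv.coe_coe, L.apply_symm_apply,
      frameForm_apply]
    have : L ((ContinuousLinearMap.pi fun k ↦ logForm b F k w) v) =
      fr (u w) ((ContinuousLinearMap.pi fun k ↦ logForm b F k w) v) := by rw [← hL]; rfl
    rw [this, hfr_apply]
    rfl
  have hsm : ContDiffAt ℝ ∞ (fun w ↦ (fr (u w)).inverse ∘L fderiv ℝ u w) w₀ := by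
    refine ContDiffAt.clm_comp ?_ (hud.fderiv_right (by simp))
    obtain ⟨L, hL⟩ := hinv _ hy₀
    have := contDiffAt_map_inverse (𝕜 := ℝ) (n := ∞) L
    rw [hL] at this
    exact ContDiffAt.comp w₀ this hfr
  have h := hsm.congr_of_eventuallyEq hev
  have e : logForm b F k = fun w ↦ (ContinuousLinearMap.proj k : (Fin 3 → ℝ) →L[ℝ] ℝ) ∘L
    (ContinuousLinearMap.pi fun k ↦ logForm b F k w) := by
    ext w v; simp
  rw [e]
  exact contDiffAt_const.clm_comp h

/-- The brackets of the left invariant fields, in a chart. -/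
theorem lieBracket_chartField_basis (b : Module.Basis (Fin 3) ℝ (GroupLieAlgebra I3 X)) {x₀ : X}
    {y : E3} (hy : y ∈ (extChartAt I3 x₀).target) (i j : Fin 3) :
    lieBracket ℝ (chartField x₀ (b i)) (chartField x₀ (b j)) y =
      ∑ l, structConst b i j l • chartField x₀ (b l) y := by
  rw [lieBracket_chartField _ _ hy, chartField_eq_sum b]
  rfl

/-- The Maurer–Cartan equation for the logarithmic derivative of a surface: the symmetry of its
second derivative in a chart. -/
theorem maurerCartan_logForm (b : Module.Basis (Fin 3) ℝ (GroupLieAlgebra I3 X)) {F : ℂ → X}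
    {w₀ : ℂ} (hF : ContMDiffAt 𝓘(ℝ, ℂ) I3 ∞ F w₀) (v v' : ℂ) (l : Fin 3) :
    maurerCartan (structConst b) (logForm b F) w₀ v v' l = 0 := by
  set x₀ := F w₀ with hx₀
  set u : ℂ → E3 := extChartAt I3 x₀ ∘ F with hu
  have hw₀ : F w₀ ∈ (extChartAt I3 x₀).source := mem_extChartAt_source x₀
  have hud : ContDiffAt ℝ ∞ u w₀ := by
    rw [← contMDiffAt_iff_contDiffAt]
    exact (contMDiffAt_extChartAt' (n := ∞) (by rwa [← extChartAt_source I3])).comp w₀ hF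
  have hy₀ : u w₀ ∈ (extChartAt I3 x₀).target := (extChartAt I3 x₀).map_source hw₀
  set V : Fin 3 → E3 → E3 := fun k ↦ chartField x₀ (b k)
  set α := logForm b F
  have hV : ∀ k, ContDiffAt ℝ ∞ (V k) (u w₀) := fun k ↦ contDiffAt_chartField (b k) hy₀
  have hα : ∀ k, ContDiffAt ℝ ∞ (α k) w₀ := contDiffAt_logForm b hF
  have hev : fderiv ℝ u =ᶠ[𝓝 w₀] frameForm V α ∘ fun w ↦ (w, u w) := by
    have h1 : ∀ᶠ w in 𝓝 w₀, ContMDiffAt 𝓘(ℝ, ℂ) I3 1 F w :=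
      (contMDiffAt_iff_contMDiffAt_nhds (by simp)).1 (hF.of_le (by simp))
    filter_upwards [h1, hF.continuousAt.preimage_mem_nhds
      ((isOpen_extChartAt_source x₀).mem_nhds hw₀)] with w hw1 hw2
    exact (hasFDerivAt_chart b (hw1.mdifferentiableAt (by simp)) hw2).fderiv
  have hu1 : HasFDerivAt u (frameForm V α (w₀, u w₀)) w₀ := by
    have := (hud.differentiableAt (by simp)).hasFDerivAt
    rwa [hev.self_of_nhds] at this
  have h2 : ∀ v v', fderiv ℝ (fderiv ℝ u) w₀ v v' =
      fderiv ℝ (frameForm V α) (w₀, u w₀) (v, frameForm V α (w₀, u w₀) v) v' := by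
    intro v v'
    have hΦ : DifferentiableAt ℝ (frameForm V α) (w₀, u w₀) :=
      (contDiffAt_frameForm (z := (w₀, u w₀)) hV hα).differentiableAt (by simp)
    have h3 := HasFDerivAt.comp w₀ (g := frameForm V α) (f := fun w ↦ (w, u w)) hΦ.hasFDerivAt
      ((hasFDerivAt_id w₀).prodMk hu1)
    rw [hev.fderiv_eq, h3.fderiv]
    rfl
  have hsym : IsSymmSndFDerivAt ℝ u w₀ := hud.isSymmSndFDerivAt (by
    rw [minSmoothness_of_isRCLikeNormedField]; exact ENat.LEInfty.out)
  have h4 := fderiv_frameForm_sub (z := (w₀, u w₀)) (fun k ↦ (hV k).differentiableAt (by simp))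
    (fun k ↦ (hα k).differentiableAt (by simp)) (lieBracket_chartField_basis b hy₀) v v'
  rw [← h2, ← h2, hsym.eq v v', sub_self] at h4
  have h5 := linearIndependent_chartField b hy₀ (c := 0)
    (d := maurerCartan (structConst b) α w₀ v v') (by simpa using h4)
  rw [← h5]; rfl

/-- Local existence of surfaces with prescribed logarithmic derivative. -/
theorem exists_logForm_eq (b : Module.Basis (Fin 3) ℝ (GroupLieAlgebra I3 X))
    {α : Fin 3 → ℂ → ℂ →L[ℝ] ℝ} {w₀ : ℂ} (x₀ : X)
    (hα : ∀ᶠ w in 𝓝 w₀, ∀ k, ContDiffAt ℝ ∞ (α k) w)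
    (hmc : ∀ᶠ w in 𝓝 w₀, ∀ v v' l, maurerCartan (structConst b) α w v v' l = 0) :
    ∃ F : ℂ → X, F w₀ = x₀ ∧ ∀ᶠ w in 𝓝 w₀, ContMDiffAt 𝓘(ℝ, ℂ) I3 ∞ F w ∧
      ∀ k, logForm b F k w = α k w := by
  set V : Fin 3 → E3 → E3 := fun k ↦ chartField x₀ (b k)
  set y₀ := extChartAt I3 x₀ x₀
  have hy₀ : y₀ ∈ (extChartAt I3 x₀).target := mem_extChartAt_target x₀
  have hT : ∀ᶠ y in 𝓝 y₀, y ∈ (extChartAt I3 x₀).target :=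
    (isOpen_extChartAt_target x₀).mem_nhds hy₀
  have hΦ : ContDiffAt ℝ ∞ (frameForm V α) (w₀, y₀) :=
    contDiffAt_frameForm (fun k ↦ contDiffAt_chartField (b k) hy₀) hα.self_of_nhds
  obtain ⟨u, hu₀, hu⟩ := exists_hasFDerivAt_of_integrable (hΦ.of_le ENat.LEInfty.out) (by
    rw [nhds_prod_eq]
    filter_upwards [(hmc.and hα).prod_mk hT] with z hz v v'
    have h4 := fderiv_frameForm_sub (z := z)
      (fun k ↦ (contDiffAt_chartField (b k) hz.2).differentiableAt (by simp))
      (fun k ↦ (hz.1.2 k).differentiableAt (by simp)) (lieBracket_chartField_basis b hz.2) v v'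
    rw [← sub_eq_zero, h4]
    simp [hz.1.1 v v'])
  have hut : ∀ᶠ w in 𝓝 w₀, u w ∈ (extChartAt I3 x₀).target :=
    hu.self_of_nhds.continuousAt.eventually (by rwa [hu₀])
  refine ⟨(extChartAt I3 x₀).symm ∘ u, by simp [hu₀, y₀], ?_⟩
  filter_upwards [hu.eventually_nhds, hut, hα] with w h1 h2 h3
  have h4 : ContDiffAt ℝ ∞ u w := contDiffAt_of_hasFDerivAt
    (contDiffAt_frameForm (fun k ↦ contDiffAt_chartField (b k) h2) h3) h1
  exact ⟨(contMDiffAt_chart_symm h2).comp w h4.contMDiffAt,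
    logForm_of_hasFDerivAt b h2 h1.self_of_nhds⟩

/-- Two surfaces with the same logarithmic derivative differ locally by a left translation. -/
theorem eventually_eq_mul_of_logForm_eq (b : Module.Basis (Fin 3) ℝ (GroupLieAlgebra I3 X))
    {F₁ F₂ : ℂ → X} {w₀ : ℂ} (h₁ : ContMDiffAt 𝓘(ℝ, ℂ) I3 ∞ F₁ w₀)
    (h₂ : ContMDiffAt 𝓘(ℝ, ℂ) I3 ∞ F₂ w₀)
    (h : ∀ᶠ w in 𝓝 w₀, ∀ k, logForm b F₁ k w = logForm b F₂ k w) :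
    ∀ᶠ w in 𝓝 w₀, F₂ w = F₂ w₀ * (F₁ w₀)⁻¹ * F₁ w := by
  set a := F₂ w₀ * (F₁ w₀)⁻¹ with ha
  set F₃ : ℂ → X := fun w ↦ a * F₁ w with hF₃
  have h₃ : ContMDiffAt 𝓘(ℝ, ℂ) I3 ∞ F₃ w₀ :=
    (contMDiff_mul_left (I := I3) (n := ∞) (a := a)).contMDiffAt.comp w₀ h₁
  have h₀ : F₃ w₀ = F₂ w₀ := by simp [hF₃, ha]
  set x₀ := F₂ w₀ with hx₀
  have hs : x₀ ∈ (extChartAt I3 x₀).source := mem_extChartAt_source x₀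
  have n₂ := h₂.continuousAt.preimage_mem_nhds ((isOpen_extChartAt_source x₀).mem_nhds hs)
  have n₃ := h₃.continuousAt.preimage_mem_nhds
    ((isOpen_extChartAt_source x₀).mem_nhds (by rw [h₀]; exact hs))
  have d₁ := (contMDiffAt_iff_contMDiffAt_nhds (n := 1) (by simp)).1 (h₁.of_le (by simp))
  have d₂ := (contMDiffAt_iff_contMDiffAt_nhds (n := 1) (by simp)).1 (h₂.of_le (by simp))
  have d₃ := (contMDiffAt_iff_contMDiffAt_nhds (n := 1) (by simp)).1 (h₃.of_le (by simp))
  have key : extChartAt I3 x₀ ∘ F₃ =ᶠ[𝓝 w₀] extChartAt I3 x₀ ∘ F₂ := by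
    refine eventuallyEq_of_hasFDerivAt
      (Φ := frameForm (fun k ↦ chartField x₀ (b k)) (logForm b F₂)) ?_ ?_ ?_ ?_
    · refine (contDiffAt_frameForm (fun k ↦ contDiffAt_chartField (b k) ?_)
        (contDiffAt_logForm b h₂)).of_le ENat.LEInfty.out
      exact (extChartAt I3 x₀).map_source (by rw [h₀]; exact hs)
    · filter_upwards [n₃, d₁, d₃, h] with w hw hd1 hd hk
      have := hasFDerivAt_chart b (hd.mdifferentiableAt (by simp)) hw
      refine this.congr_fderiv (ContinuousLinearMap.ext fun v ↦ ?_)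
      rw [frameForm_apply, frameForm_apply]
      refine Finset.sum_congr rfl fun k _ ↦ ?_
      simp only [← hk]
      rw [logForm_apply, leftLogDeriv_mul_left (hd1.mdifferentiableAt (by simp))]
      rfl
    · filter_upwards [n₂, d₂] with w hw hd
      exact hasFDerivAt_chart b (hd.mdifferentiableAt (by simp)) hw
    · exact congrArg (extChartAt I3 x₀) (h₀.trans hx₀)
  filter_upwards [key, n₂, n₃] with w hw w2 w3
  exact ((extChartAt I3 x₀).injOn w3 w2 hw).symm

end MaurerCartan

/-! ### Wirtinger calculus -/

section Wirtinger

open Complex Filter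

local notation "conj" => starRingEnd ℂ

/-- The real linear map `v ↦ a v + b v̄`. -/
def wirtingerCLM (a b : ℂ) : ℂ →L[ℝ] ℂ :=
  a • (1 : ℂ →L[ℝ] ℂ) + b • (conjCLE : ℂ →L[ℝ] ℂ)

theorem wirtingerCLM_apply (a b v : ℂ) : wirtingerCLM a b v = a * v + b * conj v := by
  simp [wirtingerCLM]

/-- `u` is real differentiable at `w` with `u_z = a` and `u_z̄ = b`. -/
def HasWirtingerAt (u : ℂ → ℂ) (a b w : ℂ) : Prop := HasFDerivAt u (wirtingerCLM a b) w

variable {u f g : ℂ → ℂ} {a b c d w : ℂ}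

theorem HasWirtingerAt.dz_eq (h : HasWirtingerAt u a b w) : dz u w = a := by
  rw [dz, HasFDerivAt.fderiv h, wirtingerCLM_apply, wirtingerCLM_apply]
  simp only [map_one, conj_I]
  linear_combination (b / 2 - a / 2) * I_sq

theorem HasWirtingerAt.dzbar_eq (h : HasWirtingerAt u a b w) : dzbar u w = b := by
  rw [dzbar, HasFDerivAt.fderiv h, wirtingerCLM_apply, wirtingerCLM_apply]
  simp only [map_one, conj_I]
  linear_combination (a / 2 - b / 2) * I_sq

theorem hasWirtingerAt_of_differentiableAt (h : DifferentiableAt ℝ u w) :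
    HasWirtingerAt u (dz u w) (dzbar u w) w := by
  refine h.hasFDerivAt.congr_fderiv (ContinuousLinearMap.ext fun v ↦ ?_)
  have hv : v = v.re • (1 : ℂ) + v.im • I := by simp
  rw [wirtingerCLM_apply, dz, dzbar]
  conv_lhs => rw [hv, map_add, map_smul, map_smul]
  have h1 : conj v = v.re - v.im * I := by
    apply Complex.ext <;> simp
  have h2 : v = v.re + v.im * I := (re_add_im v).symm
  rw [h1]
  conv_rhs => rw [h2]
  simp only [add_re, ofReal_re, mul_re, I_re, mul_zero, ofReal_im, I_im, mul_one, sub_self,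
    add_zero,
    add_im, mul_im, zero_add, real_smul]
  linear_combination (v.im * fderiv ℝ u w I) * I_sq

theorem hasWirtingerAt_const (k : ℂ) : HasWirtingerAt (fun _ ↦ k) 0 0 w :=
  (hasFDerivAt_const k w).congr_fderiv (by ext v; simp [wirtingerCLM_apply])

theorem hasWirtingerAt_id : HasWirtingerAt (fun w ↦ w) 1 0 w :=
  (hasFDerivAt_id w).congr_fderiv (by ext v; simp [wirtingerCLM_apply])

theorem HasWirtingerAt.conj (h : HasWirtingerAt u a b w) :
    HasWirtingerAt (fun w ↦ conj (u w)) (conj b) (conj a) w :=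
  (((conjCLE : ℂ →L[ℝ] ℂ).hasFDerivAt.comp w h)).congr_fderiv (by
    ext v
    simp only [ContinuousLinearMap.comp_apply, wirtingerCLM_apply]
    simp [add_comm])

theorem HasWirtingerAt.add (hf : HasWirtingerAt f a b w) (hg : HasWirtingerAt g c d w) :
    HasWirtingerAt (fun w ↦ f w + g w) (a + c) (b + d) w :=
  (HasFDerivAt.add hf hg).congr_fderiv (by
    ext v; simp only [add_apply, wirtingerCLM_apply]; ring)

theorem HasWirtingerAt.sub (hf : HasWirtingerAt f a b w) (hg : HasWirtingerAt g c d w) :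
    HasWirtingerAt (fun w ↦ f w - g w) (a - c) (b - d) w :=
  (HasFDerivAt.sub hf hg).congr_fderiv (by
    ext v; simp only [sub_apply, wirtingerCLM_apply]; ring)

theorem HasWirtingerAt.mul (hf : HasWirtingerAt f a b w) (hg : HasWirtingerAt g c d w) :
    HasWirtingerAt (fun w ↦ f w * g w) (a * g w + f w * c) (b * g w + f w * d) w :=
  (HasFDerivAt.mul hf hg).congr_fderiv (by
    ext v
    simp only [add_apply, smul_apply, smul_eq_mul, wirtingerCLM_apply]; ring)

theorem HasWirtingerAt.const_mul (k : ℂ) (hf : HasWirtingerAt f a b w) :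
    HasWirtingerAt (fun w ↦ k * f w) (k * a) (k * b) w := by
  simpa using (hasWirtingerAt_const k).mul hf

theorem HasWirtingerAt.comp {F : ℂ → ℂ} (hF : HasWirtingerAt F c d (u w))
    (h : HasWirtingerAt u a b w) :
    HasWirtingerAt (fun w ↦ F (u w)) (c * a + d * starRingEnd ℂ b)
      (c * b + d * starRingEnd ℂ a) w :=
  (HasFDerivAt.comp w hF h).congr_fderiv (by
    ext v
    simp only [ContinuousLinearMap.comp_apply, wirtingerCLM_apply]
    simp only [map_add, map_mul, conj_conj]; ring)

theorem HasDerivAt.hasWirtingerAt {F : ℂ → ℂ} (h : HasDerivAt F c w) : HasWirtingerAt F c 0 w :=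
  (h.hasFDerivAt.restrictScalars ℝ).congr_fderiv (by
    ext v; simp [wirtingerCLM_apply, mul_comm])

theorem HasWirtingerAt.inv (h : HasWirtingerAt u a b w) (h0 : u w ≠ 0) :
    HasWirtingerAt (fun w ↦ (u w)⁻¹) (-a / u w ^ 2) (-b / u w ^ 2) w := by
  have := (HasDerivAt.hasWirtingerAt (hasDerivAt_inv h0)).comp h
  simp only [zero_mul, add_zero] at this
  convert this using 1 <;> ring

theorem HasWirtingerAt.congr_of_eventuallyEq (h : HasWirtingerAt f a b w) (e : g =ᶠ[𝓝 w] f) :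
    HasWirtingerAt g a b w := HasFDerivAt.congr_of_eventuallyEq h e

theorem HasWirtingerAt.congr_coeffs (h : HasWirtingerAt f a b w) (h1 : a = c) (h2 : b = d) :
    HasWirtingerAt f c d w := h1 ▸ h2 ▸ h

end Wirtinger

/-! ### The potential of a general metric Lie algebra -/

section Potential

open Complex

local notation "conj" => starRingEnd ℂ

/-- With `n = 1 + gh`, the vector `n N`, where `N` is the inverse stereographic projection of `g`
and `h = ḡ`. -/
def sphereVec (g h : ℂ) : Fin 3 → ℂ := ![g + h, -I * (g - h), 1 - g * h]

/-- The isotropic vector orthogonal to `sphereVec g h`, for `h = ḡ`; the left invariant derivative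
`f⁻¹ f_z` of a conformal immersion with Gauss map `g` is a multiple of it. -/
def isoVec (h : ℂ) : Fin 3 → ℂ := ![h ^ 2 - 1, I * (h ^ 2 + 1), 2 * h]

/-- The derivative of `isoVec`. -/
def isoVec' (h : ℂ) : Fin 3 → ℂ := ![2 * h, I * (2 * h), 2]

/-- The axial vector of the skew part of a matrix. -/
def axial (L : Fin 3 → Fin 3 → ℝ) : Fin 3 → ℝ :=
  ![(L 2 1 - L 1 2) / 2, (L 0 2 - L 2 0) / 2, (L 1 0 - L 0 1) / 2]

/-- The `H`-potential of the metric Lie algebra with brackets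
`[x, y]ₖ = ∑ₘ (x × y)ₘ Lₘₖ`, as a polynomial in `q` and `q̄`. The parameter `ι` is `i`; the value at
`ι = -i` gives the complex conjugate. -/
def potPoly (L : Fin 3 → Fin 3 → ℝ) (H : ℝ) (ι g h : ℂ) : ℂ :=
  H * (1 + g * h) ^ 2
    - ι / 2 * ∑ i, ∑ j, L i j * (sphereVec g h i * sphereVec g h j)
    - (1 + g * h) * ∑ i, axial L i * sphereVec g h i

/-- The partial derivative `∂/∂g` of `potPoly`. -/
def potPolyG (L : Fin 3 → Fin 3 → ℝ) (H : ℝ) (ι g h : ℂ) : ℂ :=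
  H * (2 * (1 + g * h) * h)
    - ι / 2 * ∑ i, ∑ j,
      L i j * (![1, -I, -h] i * sphereVec g h j + sphereVec g h i * ![1, -I, -h] j)
    - (h * ∑ i, axial L i * sphereVec g h i + (1 + g * h) * ∑ i, axial L i * ![1, -I, -h] i)

/-- The partial derivative `∂/∂h` of `potPoly`. -/
def potPolyH (L : Fin 3 → Fin 3 → ℝ) (H : ℝ) (ι g h : ℂ) : ℂ :=
  H * (2 * (1 + g * h) * g)
    - ι / 2 * ∑ i, ∑ j,
      L i j * (![1, I, -g] i * sphereVec g h j + sphereVec g h i * ![1, I, -g] j)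
    - (g * ∑ i, axial L i * sphereVec g h i + (1 + g * h) * ∑ i, axial L i * ![1, I, -g] i)

/-- The `H`-potential of the metric Lie algebra with brackets `[x, y]ₖ = ∑ₘ (x × y)ₘ Lₘₖ`. -/
def pot (L : Fin 3 → Fin 3 → ℝ) (H : ℝ) (q : ℂ) : ℂ := potPoly L H I q (conj q)

theorem hasWirtingerAt_pot (L : Fin 3 → Fin 3 → ℝ) (H : ℝ) (q : ℂ) :
    HasWirtingerAt (pot L H) (potPolyG L H I q (conj q)) (potPolyH L H I q (conj q)) q := by
  have hq : HasWirtingerAt (fun q ↦ q) 1 0 q := hasWirtingerAt_id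
  have hc : HasWirtingerAt (fun q ↦ conj q) 0 1 q := by simpa using hq.conj
  have hn : HasWirtingerAt (fun q ↦ 1 + q * conj q) (conj q) q q := by
    simpa using (hasWirtingerAt_const 1).add (hq.mul hc)
  have hs : ∀ i, HasWirtingerAt (fun q ↦ sphereVec q (conj q) i) (![1, -I, -conj q] i)
      (![1, I, -q] i) q := by
    intro i
    fin_cases i
    · simpa [sphereVec] using hq.add hc
    · simpa [sphereVec] using (hq.sub hc).const_mul (-I)
    · simpa [sphereVec] using (hasWirtingerAt_const 1).sub (hq.mul hc)
  have hsum : ∀ {n : ℕ} (f : Fin n → ℂ → ℂ) (a b : Fin n → ℂ),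
      (∀ i, HasWirtingerAt (f i) (a i) (b i) q) →
      HasWirtingerAt (fun q ↦ ∑ i, f i q) (∑ i, a i) (∑ i, b i) q := by
    intro n f a b h
    refine (HasFDerivAt.fun_sum (u := Finset.univ) fun i _ ↦ h i).congr_fderiv ?_
    ext v
    simp [wirtingerCLM_apply, Finset.sum_add_distrib, Finset.sum_mul]
  have h1 := ((hn.mul hn).const_mul (H : ℂ))
  have h2 := (hsum _ _ _ fun i ↦ hsum _ _ _ fun j ↦
    ((hs i).mul (hs j)).const_mul (L i j : ℂ)).const_mul (I / 2)
  have h3 := hn.mul (hsum _ _ _ fun i ↦ (hs i).const_mul (axial L i : ℂ))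
  have h4 := (h1.sub h2).sub h3
  have e : pot L H = fun q ↦ (H : ℂ) * ((1 + q * conj q) * (1 + q * conj q))
    - I / 2 * ∑ i, ∑ j, L i j * (sphereVec q (conj q) i * sphereVec q (conj q) j)
    - (1 + q * conj q) * ∑ i, axial L i * sphereVec q (conj q) i := by
    ext q
    rw [pot, potPoly]; ring
  rw [e]
  refine h4.congr_coeffs ?_ ?_
  · rw [potPolyG]; ring
  · rw [potPolyH]; ring

theorem dz_pot (L : Fin 3 → Fin 3 → ℝ) (H : ℝ) (q : ℂ) :
    dz (pot L H) q = potPolyG L H I q (conj q) := (hasWirtingerAt_pot L H q).dz_eq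

theorem conj_pot (L : Fin 3 → Fin 3 → ℝ) (H : ℝ) (q : ℂ) :
    conj (pot L H q) = potPoly L H (-I) q (conj q) := by
  simp only [pot, potPoly, sphereVec, Fin.sum_univ_three, Matrix.cons_val_zero, Matrix.cons_val_one,
    Matrix.cons_val, map_sub, map_mul, map_add, map_pow, map_one, conj_ofReal, conj_I, map_div₀,
    map_ofNat, conj_conj, map_neg]
  ring

theorem conj_dz_pot (L : Fin 3 → Fin 3 → ℝ) (H : ℝ) (q : ℂ) :
    conj (dz (pot L H) q) = potPolyH L H (-I) q (conj q) := by
  rw [dz_pot]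
  simp only [potPolyG, potPolyH, sphereVec, Fin.sum_univ_three, Matrix.cons_val_zero,
    Matrix.cons_val_one, Matrix.cons_val, map_sub, map_mul, map_add, map_one, conj_ofReal, conj_I,
    map_div₀, map_ofNat, conj_conj, map_neg]
  ring

/-- The bracket `[x, y]ₖ = ∑ₘ (x × y)ₘ Lₘₖ` on `R³`. -/
def milnorBracket {R : Type*} [CommRing R] (L : Fin 3 → Fin 3 → R) (x y : Fin 3 → R) (k : Fin 3) :
    R :=
  (x 1 * y 2 - x 2 * y 1) * L 0 k + (x 2 * y 0 - x 0 * y 2) * L 1 k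
    + (x 0 * y 1 - x 1 * y 0) * L 2 k

/-- Twice the Levi-Civita connection `⟨∇ₓ y, z⟩` of the bracket `milnorBracket L`, by the Koszul
formula. -/
def koszul {R : Type*} [CommRing R] (L : Fin 3 → Fin 3 → R) (x y z : Fin 3 → R) : R :=
  (∑ k, milnorBracket L x y k * z k) - (∑ k, milnorBracket L y z k * x k)
    + ∑ k, milnorBracket L z x k * y k

/-- The `H`-potential of `L` encodes the connection: this is the equation
`∇_{f_z̄} f_z = (λ/2) H N` for `f⁻¹ f_z = isoVec ḡ`, up to the terms containing derivatives. -/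
theorem koszul_isoVec (L : Fin 3 → Fin 3 → ℝ) (H : ℝ) (g h : ℂ) (k : Fin 3) :
    koszul (fun i j ↦ (L i j : ℂ)) ![g ^ 2 - 1, -I * (g ^ 2 + 1), 2 * g] (isoVec h)
      (Pi.single k 1) / 2 =
    potPolyH L H (-I) g h * isoVec h k - potPoly L H (-I) g h * isoVec' h k
      + 2 * H * (1 + g * h) * sphereVec g h k := by
  have hI : I ^ 2 = -1 := I_sq
  have hI3 : I ^ 3 = -I := by rw [pow_succ, hI]; ring
  have hI4 : I ^ 4 = 1 := by rw [pow_succ, hI3]; linear_combination -hI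
  fin_cases k <;>
  · simp [koszul, milnorBracket, isoVec, isoVec', potPolyH, potPoly, sphereVec, axial,
      Fin.sum_univ_three, Pi.single_apply]
    ring_nf
    simp only [hI, hI3, hI4]
    ring

end Potential

/-! ### Conformal surfaces in terms of the logarithmic derivative -/

section Frame

open Complex Filter

local notation "conj" => starRingEnd ℂ

variable {X : Type*} [TopologicalSpace X] [ChartedSpace E3 X] [Group X] [LieGroup I3 ∞ X]

/-- `b` is an orthonormal basis of the Lie algebra, in which the bracket has the matrix `L`. -/
structure IsOrthoFrame (γ : LeftInvariantMetric X)
    (b : Module.Basis (Fin 3) ℝ (GroupLieAlgebra I3 X)) (L : Fin 3 → Fin 3 → ℝ) : Prop where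
  orthonormal : ∀ i j, γ.metric.inner 1 (b i) (b j) = if i = j then 1 else 0
  bracket : ∀ (x y : GroupLieAlgebra I3 X) (k : Fin 3),
    b.repr ⁅x, y⁆ k = milnorBracket L (b.repr x) (b.repr y) k

variable {γ : LeftInvariantMetric X} {b : Module.Basis (Fin 3) ℝ (GroupLieAlgebra I3 X)}
  {L : Fin 3 → Fin 3 → ℝ}

theorem IsOrthoFrame.inner_eq (hb : IsOrthoFrame γ b L) (x y : GroupLieAlgebra I3 X) :
    γ.metric.inner 1 x y = ∑ k, b.repr x k * b.repr y k := by
  let B : GroupLieAlgebra I3 X →ₗ[ℝ] GroupLieAlgebra I3 X →ₗ[ℝ] ℝ :=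
    LinearMap.mk₂ ℝ (fun x y ↦ γ.metric.inner 1 x y)
      (fun x y z ↦ by rw [map_add]; rfl) (fun c x y ↦ by rw [map_smul]; rfl)
      (fun x y z ↦ by rw [map_add]) (fun c x y ↦ by rw [map_smul])
  have h : ∀ i j, B (b i) (b j) = if i = j then 1 else 0 := hb.orthonormal
  calc B x y = B (∑ i, b.repr x i • b i) (∑ j, b.repr y j • b j) := by
        rw [b.sum_repr, b.sum_repr]
    _ = _ := by
        simp only [map_sum, map_smul, LinearMap.sum_apply, LinearMap.smul_apply, h]
        simp [Fin.sum_univ_three, mul_comm]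

theorem IsOrthoFrame.leviCivita_eq (hb : IsOrthoFrame γ b L) (x y z : GroupLieAlgebra I3 X) :
    leviCivita γ x y z = koszul L (b.repr x) (b.repr y) (b.repr z) / 2 := by
  simp only [leviCivita, hb.inner_eq, hb.bracket, koszul]

theorem IsOrthoFrame.sum_structConst (hb : IsOrthoFrame γ b L) (x y : Fin 3 → ℝ) (k : Fin 3) :
    ∑ i, ∑ j, structConst b i j k * x i * y j = milnorBracket L x y k := by
  simp only [structConst, hb.bracket, milnorBracket, Module.Basis.repr_self, Fin.sum_univ_three]
  simp
  ring

/-- The coordinates of the `dz`-part of a Lie algebra valued 1-form on the plane; for the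
logarithmic derivative of `F`, these are the coordinates of `F⁻¹ F_z`. -/
def zPart (α : Fin 3 → ℂ → ℂ →L[ℝ] ℝ) (k : Fin 3) (w : ℂ) : ℂ := (α k w 1 - I * α k w I) / 2

theorem apply_one_eq_zPart (α : Fin 3 → ℂ → ℂ →L[ℝ] ℝ) (k : Fin 3) (w : ℂ) :
    α k w 1 = 2 * (zPart α k w).re := by
  simp [zPart]; ring

theorem apply_I_eq_zPart (α : Fin 3 → ℂ → ℂ →L[ℝ] ℝ) (k : Fin 3) (w : ℂ) :
    α k w I = -2 * (zPart α k w).im := by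
  simp [zPart]; ring

theorem apply_eq_zPart (α : Fin 3 → ℂ → ℂ →L[ℝ] ℝ) (k : Fin 3) (w v : ℂ) :
    α k w v = 2 * (zPart α k w * v).re := by
  have hv : v = v.re • (1 : ℂ) + v.im • I := by simp
  conv_lhs => rw [hv, map_add, map_smul, map_smul, apply_one_eq_zPart, apply_I_eq_zPart]
  simp; ring

/-- The coordinates of the covariant derivative `∇_{∂_z̄} F_z`. -/
def nablaZ (L : Fin 3 → Fin 3 → ℝ) (α : Fin 3 → ℂ → ℂ →L[ℝ] ℝ) (k : Fin 3) (w : ℂ) : ℂ :=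
  dzbar (zPart α k) w + koszul (fun i j ↦ (L i j : ℂ)) (fun i ↦ conj (zPart α i w))
    (fun i ↦ zPart α i w) (Pi.single k 1) / 2

theorem zPart_re (α : Fin 3 → ℂ → ℂ →L[ℝ] ℝ) (k : Fin 3) (w : ℂ) :
    (zPart α k w).re = α k w 1 / 2 := by
  simp [zPart]

theorem zPart_im (α : Fin 3 → ℂ → ℂ →L[ℝ] ℝ) (k : Fin 3) (w : ℂ) :
    (zPart α k w).im = -α k w I / 2 := by
  simp [zPart]

theorem dzbar_zPart {α : Fin 3 → ℂ → ℂ →L[ℝ] ℝ} {k : Fin 3} {w : ℂ}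
    (h : DifferentiableAt ℝ (α k) w) :
    dzbar (zPart α k) w = (fderiv ℝ (α k) w 1 1 + fderiv ℝ (α k) w I I
      + I * (fderiv ℝ (α k) w I 1 - fderiv ℝ (α k) w 1 I)) / 4 := by
  have h1 : ∀ v, HasFDerivAt (fun w ↦ ((α k w v : ℝ) : ℂ))
      (ofRealCLM ∘L (ContinuousLinearMap.apply ℝ ℝ v ∘L fderiv ℝ (α k) w)) w := fun v ↦
    ofRealCLM.hasFDerivAt.comp w
      ((ContinuousLinearMap.apply ℝ ℝ v).hasFDerivAt.comp w h.hasFDerivAt)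
  have h2 := ((h1 1).fun_sub ((h1 I).const_mul I)).const_mul (1 / 2)
  have e : zPart α k = fun w ↦ (1 / 2 : ℂ) * ((α k w 1 : ℂ) - I * (α k w I : ℂ)) := by
    ext w; rw [zPart]; ring
  rw [dzbar, e, HasFDerivAt.fderiv h2]
  simp only [smul_apply, sub_apply, ContinuousLinearMap.comp_apply, ofRealCLM_apply,
    ContinuousLinearMap.apply_apply, smul_eq_mul]
  linear_combination (-(fderiv ℝ (α k) w I I : ℂ) / 4) * I_sq

theorem nablaZ_re {α : Fin 3 → ℂ → ℂ →L[ℝ] ℝ} {k : Fin 3} {w : ℂ}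
    (h : DifferentiableAt ℝ (α k) w) :
    (nablaZ L α k w).re = (fderiv ℝ (α k) w 1 1 + fderiv ℝ (α k) w I I) / 4 +
      (koszul L (fun i ↦ α i w 1) (fun i ↦ α i w 1) (Pi.single k 1) +
        koszul L (fun i ↦ α i w I) (fun i ↦ α i w I) (Pi.single k 1)) / 8 := by
  rw [nablaZ, dzbar_zPart h]
  fin_cases k <;>
  · simp [koszul, milnorBracket, zPart_re, zPart_im, Fin.sum_univ_three, Pi.single_apply]
    ring

theorem IsOrthoFrame.nablaZ_im (hb : IsOrthoFrame γ b L) {α : Fin 3 → ℂ → ℂ →L[ℝ] ℝ}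
    {k : Fin 3} {w : ℂ} (h : DifferentiableAt ℝ (α k) w) :
    (nablaZ L α k w).im = -maurerCartan (structConst b) α w 1 I k / 4 := by
  rw [nablaZ, dzbar_zPart h, maurerCartan,
    hb.sum_structConst (fun i ↦ α i w 1) (fun i ↦ α i w I)]
  fin_cases k <;>
  · simp [koszul, milnorBracket, zPart_re, zPart_im, Fin.sum_univ_three, Pi.single_apply]
    ring

/-- The Maurer–Cartan equation need only be checked on the real basis `1, i` of the plane. -/
theorem IsOrthoFrame.maurerCartan_eq (hb : IsOrthoFrame γ b L) (α : Fin 3 → ℂ → ℂ →L[ℝ] ℝ)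
    (w v v' : ℂ) (k : Fin 3) :
    maurerCartan (structConst b) α w v v' k =
      (v.re * v'.im - v.im * v'.re) * maurerCartan (structConst b) α w 1 I k := by
  have hv : ∀ v : ℂ, v = v.re • (1 : ℂ) + v.im • I := fun v ↦ by simp
  have h1 : ∀ i v, α i w v = v.re * α i w 1 + v.im * α i w I := fun i v ↦ by
    conv_lhs => rw [hv v, map_add, map_smul, map_smul]
    rfl
  have h2 : fderiv ℝ (α k) w v v' = v.re * (v'.re * fderiv ℝ (α k) w 1 1
      + v'.im * fderiv ℝ (α k) w 1 I) + v.im * (v'.re * fderiv ℝ (α k) w I 1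
      + v'.im * fderiv ℝ (α k) w I I) := by
    conv_lhs => rw [hv v, hv v']
    simp only [map_add, map_smul, add_apply, smul_apply, smul_eq_mul]
    ring
  have h3 : fderiv ℝ (α k) w v' v = v'.re * (v.re * fderiv ℝ (α k) w 1 1
      + v.im * fderiv ℝ (α k) w 1 I) + v'.im * (v.re * fderiv ℝ (α k) w I 1
      + v.im * fderiv ℝ (α k) w I I) := by
    conv_lhs => rw [hv v, hv v']
    simp only [map_add, map_smul, add_apply, smul_apply, smul_eq_mul]
    ring
  rw [maurerCartan, maurerCartan, hb.sum_structConst (fun i ↦ α i w v) (fun i ↦ α i w v'),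
    hb.sum_structConst (fun i ↦ α i w 1) (fun i ↦ α i w I), h2, h3]
  simp only [milnorBracket, h1 _ v, h1 _ v']
  ring

theorem IsOrthoFrame.firstForm_eq (hb : IsOrthoFrame γ b L) (F : ℂ → X) (w v v' : ℂ) :
    firstForm γ F w v v' = ∑ k, logForm b F k w v * logForm b F k w v' := by
  rw [MetricLie.firstForm_eq, hb.inner_eq]
  rfl

theorem IsOrthoFrame.secondForm_eq (hb : IsOrthoFrame γ b L) {F : ℂ → X} {w : ℂ}
    (hF : ContMDiffAt 𝓘(ℝ, ℂ) I3 ∞ F w) (ν : GroupLieAlgebra I3 X) (v v' : ℂ) :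
    secondForm γ F ν w v v' = ∑ k, b.repr ν k * (fderiv ℝ (logForm b F k) w v v' +
      koszul L (fun i ↦ logForm b F i w v) (fun i ↦ logForm b F i w v') (Pi.single k 1) / 2) := by
  have h1 : HasFDerivAt (fun w' ↦ γ.metric.inner 1 (leftLogDeriv F w' v') ν)
      (∑ k, b.repr ν k • (ContinuousLinearMap.apply ℝ ℝ v' ∘L fderiv ℝ (logForm b F k) w)) w := by
    have h2 : (fun w' ↦ γ.metric.inner 1 (leftLogDeriv F w' v') ν) =
        fun w' ↦ ∑ k, logForm b F k w' v' * b.repr ν k := by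
      ext w'
      rw [hb.inner_eq]; rfl
    rw [h2]
    refine HasFDerivAt.fun_sum fun k _ ↦ ?_
    have hd := ((contDiffAt_logForm b hF k).differentiableAt (by simp)).hasFDerivAt
    exact ((ContinuousLinearMap.apply ℝ ℝ v').hasFDerivAt.comp w hd).mul_const _
  rw [secondForm, h1.fderiv, hb.leviCivita_eq]
  have e : ∀ v, (⇑(b.repr (leftLogDeriv F w v)) : Fin 3 → ℝ) = fun i ↦ logForm b F i w v :=
    fun v ↦ rfl
  rw [e, e]
  simp [koszul, milnorBracket, Fin.sum_univ_three, Pi.single_apply]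
  ring

/-- The mean curvature of a conformal surface is `2 ⟨∇_{∂_z̄} F_z, ν⟩ / λ`. -/
theorem IsOrthoFrame.meanCurvature_eq (hb : IsOrthoFrame γ b L) {F : ℂ → X} {w : ℂ}
    (hF : ContMDiffAt 𝓘(ℝ, ℂ) I3 ∞ F w) (ν : GroupLieAlgebra I3 X) {lam : ℝ} (hlam : 0 < lam)
    (hc : ∀ v : ℂ, firstForm γ F w v v = lam * ‖v‖ ^ 2) :
    meanCurvature γ F ν w =
      2 * (∑ k, b.repr ν k * (nablaZ L (logForm b F) k w).re) / lam := by
  have h1 : firstForm γ F w 1 1 = lam := by simp [hc]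
  have h2 : firstForm γ F w I I = lam := by simp [hc]
  have h3 : firstForm γ F w 1 I = 0 := by
    have h4 := hc (1 + I)
    have h5 : ‖(1 + I : ℂ)‖ ^ 2 = 2 := by
      rw [← normSq_eq_norm_sq]; simp [normSq_apply]; norm_num
    rw [h5, hb.firstForm_eq] at h4
    rw [hb.firstForm_eq] at h1 h2 ⊢
    simp only [map_add, Fin.sum_univ_three] at *
    linarith
  rw [meanCurvature, h1, h2, h3, hb.secondForm_eq hF ν 1 1, hb.secondForm_eq hF ν I I]
  simp only [nablaZ_re ((contDiffAt_logForm b hF _).differentiableAt (by simp)), zero_mul, sub_zero]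
  simp only [Fin.sum_univ_three]
  field_simp
  ring

end Frame

/-! ### The representation of a conformal surface by its Gauss map -/

section Representation

open Complex Filter

local notation "conj" => starRingEnd ℂ

/-- The form `2 Re (ζ isoVec(ū) dz)`; it is the logarithmic derivative of the conformal surface with
Gauss map `u` and `f⁻¹ f_z = ζ isoVec(ū)`. -/
def weierstrassForm (ζ u : ℂ → ℂ) (k : Fin 3) (w : ℂ) : ℂ →L[ℝ] ℝ :=
  (2 : ℝ) • (reCLM ∘L wirtingerCLM (ζ w * isoVec (conj (u w)) k) 0)

theorem weierstrassForm_apply (ζ u : ℂ → ℂ) (k : Fin 3) (w v : ℂ) :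
    weierstrassForm ζ u k w v = 2 * (ζ w * isoVec (conj (u w)) k * v).re := by
  simp [weierstrassForm, wirtingerCLM_apply]

theorem zPart_weierstrassForm (ζ u : ℂ → ℂ) (k : Fin 3) (w : ℂ) :
    zPart (weierstrassForm ζ u) k w = ζ w * isoVec (conj (u w)) k := by
  apply Complex.ext
  · rw [zPart_re, weierstrassForm_apply]; simp
  · rw [zPart_im, weierstrassForm_apply]; simp; ring

theorem eq_weierstrassForm {α : Fin 3 → ℂ → ℂ →L[ℝ] ℝ} {ζ u : ℂ → ℂ} {k : Fin 3} {w : ℂ}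
    (h : zPart α k w = ζ w * isoVec (conj (u w)) k) : α k w = weierstrassForm ζ u k w := by
  ext1 v
  rw [apply_eq_zPart, h, weierstrassForm_apply]

variable {ζ u : ℂ → ℂ} {w : ℂ}

theorem contDiffAt_conj : ContDiffAt ℝ ∞ (fun z : ℂ ↦ conj z) w :=
  (conjCLE : ℂ →L[ℝ] ℂ).contDiff.contDiffAt

theorem contDiffAt_isoVec (hu : ContDiffAt ℝ ∞ u w) (k : Fin 3) :
    ContDiffAt ℝ ∞ (fun w ↦ isoVec (conj (u w)) k) w := by
  have hc : ContDiffAt ℝ ∞ (fun w ↦ conj (u w)) w := contDiffAt_conj.comp w hu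
  fin_cases k
  · exact (hc.pow 2).sub contDiffAt_const
  · exact contDiffAt_const.mul ((hc.pow 2).add contDiffAt_const)
  · exact contDiffAt_const.mul hc

theorem contDiffAt_weierstrassForm (hζ : ContDiffAt ℝ ∞ ζ w) (hu : ContDiffAt ℝ ∞ u w)
    (k : Fin 3) : ContDiffAt ℝ ∞ (weierstrassForm ζ u k) w := by
  have h : ContDiffAt ℝ ∞ (fun w ↦ wirtingerCLM (ζ w * isoVec (conj (u w)) k) 0) w :=
    ((hζ.mul (contDiffAt_isoVec hu k)).smul
      (contDiffAt_const (c := (1 : ℂ →L[ℝ] ℂ)))).add contDiffAt_const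
  exact (contDiffAt_const (c := (2 : ℝ))).smul ((contDiffAt_const (c := reCLM)).clm_comp h)

theorem hasWirtingerAt_isoVec {a c : ℂ} (hu : HasWirtingerAt u a c w) (k : Fin 3) :
    HasWirtingerAt (fun w ↦ isoVec (conj (u w)) k) (isoVec' (conj (u w)) k * conj c)
      (isoVec' (conj (u w)) k * conj a) w := by
  have hc := hu.conj
  fin_cases k
  · refine HasWirtingerAt.congr_of_eventuallyEq (((hc.mul hc).sub (hasWirtingerAt_const
      1)).congr_coeffs ?_ ?_) (Eventually.of_forall fun w ↦ ?_) <;> simp [isoVec, isoVec'] <;> ring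
  · refine HasWirtingerAt.congr_of_eventuallyEq ((((hc.mul hc).add (hasWirtingerAt_const
      1)).const_mul I).congr_coeffs ?_ ?_) (Eventually.of_forall fun w ↦ ?_) <;>
      simp [isoVec, isoVec'] <;> ring
  · refine (hc.const_mul 2).congr_coeffs ?_ ?_ <;> simp [isoVec']

/-- The system for the Gauss map `u` and the Weierstrass datum `ζ` of an `H`-surface:
`u_z = R(u) ζ` and `ζ_z̄ = - conj(R_q(u)) |ζ|²`. -/
def WeierstrassSystemAt (L : Fin 3 → Fin 3 → ℝ) (H : ℝ) (u ζ : ℂ → ℂ) (w : ℂ) : Prop :=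
  dz u w = pot L H (u w) * ζ w ∧
    dzbar ζ w = -(conj (dz (pot L H) (u w)) * (ζ w * conj (ζ w)))

/-- The covariant derivative `∇_{∂_z̄} F_z` of a surface with `F⁻¹ F_z = ζ isoVec(ū)`. The last two
terms measure the failure of the system `WeierstrassSystemAt`. -/
theorem nablaZ_eq (L : Fin 3 → Fin 3 → ℝ) (H : ℝ) {α : Fin 3 → ℂ → ℂ →L[ℝ] ℝ}
    (hζ : DifferentiableAt ℝ ζ w) (hu : DifferentiableAt ℝ u w)
    (hα : ∀ᶠ w' in 𝓝 w, ∀ k, zPart α k w' = ζ w' * isoVec (conj (u w')) k) (k : Fin 3) :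
    nablaZ L α k w = 2 * H * (ζ w * conj (ζ w)) * (1 + u w * conj (u w))
        * sphereVec (u w) (conj (u w)) k
      + (dzbar ζ w + conj (dz (pot L H) (u w)) * (ζ w * conj (ζ w))) * isoVec (conj (u w)) k
      + ζ w * (conj (dz u w) - conj (pot L H (u w)) * conj (ζ w)) * isoVec' (conj (u w)) k := by
  have h1 : dzbar (zPart α k) w = dzbar ζ w * isoVec (conj (u w)) k
      + ζ w * (isoVec' (conj (u w)) k * conj (dz u w)) :=
    (((hasWirtingerAt_of_differentiableAt hζ).mul (hasWirtingerAt_isoVec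
      (hasWirtingerAt_of_differentiableAt hu) k)).congr_of_eventuallyEq
        (hα.mono fun w' h ↦ h k)).dzbar_eq
  have h2 := koszul_isoVec L H (u w) (conj (u w)) k
  have h3 : koszul (fun i j ↦ (L i j : ℂ)) (fun i ↦ conj (zPart α i w)) (fun i ↦ zPart α i w)
      (Pi.single k 1) = ζ w * conj (ζ w) * koszul (fun i j ↦ (L i j : ℂ))
        ![u w ^ 2 - 1, -I * (u w ^ 2 + 1), 2 * u w] (isoVec (conj (u w))) (Pi.single k 1) := by
    have h4 : ∀ i, zPart α i w = ζ w * isoVec (conj (u w)) i := hα.self_of_nhds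
    have h5 : ∀ i, conj (isoVec (conj (u w)) i) =
        ![u w ^ 2 - 1, -I * (u w ^ 2 + 1), 2 * u w] i := by
      intro i
      fin_cases i <;> simp [isoVec, map_ofNat]
    simp only [h4, map_mul, h5, koszul, milnorBracket, Fin.sum_univ_three]
    ring
  rw [nablaZ, h1, h3, mul_div_assoc, h2, conj_pot, conj_dz_pot]
  ring

variable {q : ℂ}

theorem conj_sphereVec (q : ℂ) (k : Fin 3) :
    conj (sphereVec q (conj q) k) = sphereVec q (conj q) k := by
  fin_cases k <;> simp [sphereVec] <;> ring

theorem sphereVec_im (q : ℂ) (k : Fin 3) : (sphereVec q (conj q) k).im = 0 :=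
  conj_eq_iff_im.1 (conj_sphereVec q k)

theorem one_add_mul_conj (q : ℂ) : 1 + q * conj q = ((1 + normSq q : ℝ) : ℂ) := by
  rw [mul_conj]; push_cast; ring

theorem one_add_mul_conj_ne_zero (q : ℂ) : 1 + q * conj q ≠ 0 := by
  rw [one_add_mul_conj]
  exact_mod_cast (by linarith [normSq_nonneg q] : 1 + normSq q ≠ 0)

theorem sum_sphereVec_mul_isoVec (g h : ℂ) : ∑ k, sphereVec g h k * isoVec h k = 0 := by
  simp [sphereVec, isoVec, Fin.sum_univ_three]
  linear_combination (-(g - h) * (h ^ 2 + 1)) * I_sq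

theorem sum_sphereVec_mul_isoVec' (g h : ℂ) :
    ∑ k, sphereVec g h k * isoVec' h k = 2 * (1 + g * h) := by
  simp [sphereVec, isoVec', Fin.sum_univ_three]
  linear_combination (-(g - h) * (2 * h)) * I_sq

theorem sum_sphereVec_sq (g h : ℂ) : ∑ k, sphereVec g h k ^ 2 = (1 + g * h) ^ 2 := by
  simp [sphereVec, Fin.sum_univ_three]
  linear_combination ((g - h) ^ 2) * I_sq

theorem sum_isoVec_sq (h : ℂ) : ∑ k, isoVec h k ^ 2 = 0 := by
  simp [isoVec, Fin.sum_univ_three]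
  linear_combination ((h ^ 2 + 1) ^ 2) * I_sq

theorem sum_isoVec_mul_conj (q : ℂ) :
    ∑ k, isoVec (conj q) k * conj (isoVec (conj q) k) = 2 * (1 + q * conj q) ^ 2 := by
  simp [isoVec, Fin.sum_univ_three, map_ofNat]
  linear_combination (-(conj q ^ 2 + 1) * (q ^ 2 + 1)) * I_sq

/-- As `isoVec` is isotropic, a real vector which is a multiple of it vanishes. -/
theorem eq_zero_of_mul_isoVec_real {x : ℂ} (h : ∀ k, (x * isoVec (conj q) k).im = 0) : x = 0 := by
  have h1 : ∑ k, (x * isoVec (conj q) k) ^ 2 = 0 := by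
    simp only [mul_pow, ← Finset.mul_sum, sum_isoVec_sq, mul_zero]
  have h2 : ∀ k, x * isoVec (conj q) k = ((x * isoVec (conj q) k).re : ℂ) := fun k ↦
    Complex.ext rfl (h k)
  have h3 : ∑ k, (x * isoVec (conj q) k).re ^ 2 = 0 := by
    have h4 : ((∑ k, (x * isoVec (conj q) k).re ^ 2 : ℝ) : ℂ) = 0 := by
      rw [← h1]; push_cast
      exact Finset.sum_congr rfl fun k _ ↦ by rw [← h2 k]
    exact_mod_cast h4
  rw [Finset.sum_eq_zero_iff_of_nonneg fun _ _ ↦ sq_nonneg _] at h3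
  have h5 : ∀ k, x * isoVec (conj q) k = 0 := fun k ↦ by
    rw [h2 k, pow_eq_zero_iff two_ne_zero |>.1 (h3 k (Finset.mem_univ k)), ofReal_zero]
  have h6 : x * (2 * (1 + q * conj q) ^ 2) = 0 := by
    rw [← sum_isoVec_mul_conj, Finset.mul_sum]
    exact Finset.sum_eq_zero fun k _ ↦ by rw [← mul_assoc, h5, zero_mul]
  exact (mul_eq_zero.1 h6).resolve_right
    (mul_ne_zero two_ne_zero (pow_ne_zero 2 (one_add_mul_conj_ne_zero q)))

end Representation

/-! ### The normal vector of a conformal surface -/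

section Normal

open Complex

local notation "conj" => starRingEnd ℂ

/-- The triple product of three vectors in space. -/
def tripleProduct (p r n : Fin 3 → ℝ) : ℝ :=
  p 0 * (r 1 * n 2 - r 2 * n 1) - p 1 * (r 0 * n 2 - r 2 * n 0) + p 2 * (r 0 * n 1 - r 1 * n 0)

/-- For an orthogonal pair `p, r` of vectors of length `√λ` and a unit vector `n` orthogonal to
both, with `(p, r, n)` positively oriented, `r = n × p` and `p × r = λ n`. -/
theorem cross_eq_of_orthogonal {p r n : Fin 3 → ℝ} {lam : ℝ} (hlam : 0 < lam)
    (hp : ∑ k, p k * p k = lam) (hr : ∑ k, r k * r k = lam) (hpr : ∑ k, p k * r k = 0)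
    (hn : ∑ k, n k * n k = 1) (hnp : ∑ k, n k * p k = 0) (hnr : ∑ k, n k * r k = 0)
    (hdet : 0 < tripleProduct p r n) :
    (r 0 = n 1 * p 2 - n 2 * p 1 ∧ r 1 = n 2 * p 0 - n 0 * p 2 ∧ r 2 = n 0 * p 1 - n 1 * p 0) ∧
    (lam * n 0 = p 1 * r 2 - p 2 * r 1 ∧ lam * n 1 = p 2 * r 0 - p 0 * r 2 ∧
      lam * n 2 = p 0 * r 1 - p 1 * r 0) := by
  simp only [Fin.sum_univ_three] at hp hr hpr hn hnp hnr
  obtain ⟨d, hd⟩ : ∃ d, d = tripleProduct p r n := ⟨_, rfl⟩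
  rw [← hd] at hdet
  have hd' : d = p 0 * (r 1 * n 2 - r 2 * n 1) - p 1 * (r 0 * n 2 - r 2 * n 0)
      + p 2 * (r 0 * n 1 - r 1 * n 0) := by
    rw [hd, tripleProduct]
  have hd2 : d ^ 2 = lam ^ 2 := by
    have gram : d ^ 2 = (p 0 * p 0 + p 1 * p 1 + p 2 * p 2)
          * ((r 0 * r 0 + r 1 * r 1 + r 2 * r 2) * (n 0 * n 0 + n 1 * n 1 + n 2 * n 2)
            - (n 0 * r 0 + n 1 * r 1 + n 2 * r 2) ^ 2)
        - (p 0 * r 0 + p 1 * r 1 + p 2 * r 2)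
          * ((p 0 * r 0 + p 1 * r 1 + p 2 * r 2) * (n 0 * n 0 + n 1 * n 1 + n 2 * n 2)
            - (n 0 * r 0 + n 1 * r 1 + n 2 * r 2) * (n 0 * p 0 + n 1 * p 1 + n 2 * p 2))
        + (n 0 * p 0 + n 1 * p 1 + n 2 * p 2)
          * ((p 0 * r 0 + p 1 * r 1 + p 2 * r 2) * (n 0 * r 0 + n 1 * r 1 + n 2 * r 2)
            - (n 0 * p 0 + n 1 * p 1 + n 2 * p 2) * (r 0 * r 0 + r 1 * r 1 + r 2 * r 2)) := by
      rw [hd']; ring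
    rw [gram, hp, hr, hpr, hn, hnp, hnr]; ring
  have hdl : d = lam := by
    rcases sq_eq_sq_iff_eq_or_eq_neg.1 hd2 with h | h
    · exact h
    · linarith
  have e1 : (r 0 - (n 1 * p 2 - n 2 * p 1)) ^ 2 + (r 1 - (n 2 * p 0 - n 0 * p 2)) ^ 2
      + (r 2 - (n 0 * p 1 - n 1 * p 0)) ^ 2 = 0 := by
    have : (r 0 - (n 1 * p 2 - n 2 * p 1)) ^ 2 + (r 1 - (n 2 * p 0 - n 0 * p 2)) ^ 2
      + (r 2 - (n 0 * p 1 - n 1 * p 0)) ^ 2 = (r 0 * r 0 + r 1 * r 1 + r 2 * r 2) - 2 * d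
        + (n 0 * n 0 + n 1 * n 1 + n 2 * n 2) * (p 0 * p 0 + p 1 * p 1 + p 2 * p 2)
        - (n 0 * p 0 + n 1 * p 1 + n 2 * p 2) ^ 2 := by
      rw [hd']; ring
    rw [this, hr, hn, hp, hnp, hdl]; ring
  have e2 : (lam * n 0 - (p 1 * r 2 - p 2 * r 1)) ^ 2 + (lam * n 1 - (p 2 * r 0 - p 0 * r 2)) ^ 2
      + (lam * n 2 - (p 0 * r 1 - p 1 * r 0)) ^ 2 = 0 := by
    have : (lam * n 0 - (p 1 * r 2 - p 2 * r 1)) ^ 2 + (lam * n 1 - (p 2 * r 0 - p 0 * r 2)) ^ 2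
      + (lam * n 2 - (p 0 * r 1 - p 1 * r 0)) ^ 2 =
        lam ^ 2 * (n 0 * n 0 + n 1 * n 1 + n 2 * n 2) - 2 * lam * d
        + (p 0 * p 0 + p 1 * p 1 + p 2 * p 2) * (r 0 * r 0 + r 1 * r 1 + r 2 * r 2)
        - (p 0 * r 0 + p 1 * r 1 + p 2 * r 2) ^ 2 := by
      rw [hd']; ring
    rw [this, hr, hn, hp, hpr, hdl]; ring
  have z : ∀ x y z : ℝ, x ^ 2 + y ^ 2 + z ^ 2 = 0 → x = 0 ∧ y = 0 ∧ z = 0 := fun x y z h ↦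
    ⟨pow_eq_zero_iff two_ne_zero |>.1 (by linarith [sq_nonneg x, sq_nonneg y, sq_nonneg z]),
      pow_eq_zero_iff two_ne_zero |>.1 (by linarith [sq_nonneg x, sq_nonneg y, sq_nonneg z]),
      pow_eq_zero_iff two_ne_zero |>.1 (by linarith [sq_nonneg x, sq_nonneg y, sq_nonneg z])⟩
  obtain ⟨a1, a2, a3⟩ := z _ _ _ e1
  obtain ⟨b1, b2, b3⟩ := z _ _ _ e2
  exact ⟨⟨by linarith, by linarith, by linarith⟩, by linarith, by linarith, by linarith⟩

/-- The inverse of the stereographic projection from the south pole, as a real vector. -/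
def sphereVecReal (q : ℂ) (k : Fin 3) : ℝ := (sphereVec q (conj q) k).re / (1 + normSq q)

theorem ofReal_sphereVecReal (q : ℂ) (k : Fin 3) :
    (sphereVecReal q k : ℂ) * (1 + q * conj q) = sphereVec q (conj q) k := by
  have h : (1 + normSq q : ℝ) ≠ 0 := by linarith [normSq_nonneg q]
  rw [one_add_mul_conj, ← ofReal_mul, sphereVecReal, div_mul_cancel₀ _ h]
  exact Complex.ext rfl (sphereVec_im q k).symm

theorem sphereVecReal_apply (q : ℂ) :
    sphereVecReal q = ![2 * q.re / (1 + normSq q), 2 * q.im / (1 + normSq q),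
      (1 - normSq q) / (1 + normSq q)] := by
  ext k
  fin_cases k <;> simp [sphereVecReal, sphereVec, normSq_apply] <;> ring

theorem sum_sphereVecReal_sq (q : ℂ) : ∑ k, sphereVecReal q k * sphereVecReal q k = 1 := by
  have h : (1 + normSq q : ℝ) ≠ 0 := by linarith [normSq_nonneg q]
  simp only [sphereVecReal_apply, Fin.sum_univ_three, Matrix.cons_val_zero, Matrix.cons_val_one,
    Matrix.cons_val]
  field_simp
  rw [normSq_apply]
  ring

theorem sphereVecReal_two_ne (q : ℂ) : sphereVecReal q 2 ≠ -1 := by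
  have h : (1 + normSq q : ℝ) ≠ 0 := by linarith [normSq_nonneg q]
  rw [sphereVecReal_apply]
  simp only [Matrix.cons_val]
  rw [ne_eq, div_eq_iff h]
  intro h2
  linarith

/-- Stereographic projection from the south pole, on coordinate vectors. -/
def stereo (n : Fin 3 → ℝ) : ℂ := (n 0 + n 1 * I) / (1 + n 2)

theorem stereo_sphereVecReal (q : ℂ) : stereo (sphereVecReal q) = q := by
  have h : (1 + normSq q : ℝ) ≠ 0 := by linarith [normSq_nonneg q]
  have h2 : (1 + sphereVecReal q 2 : ℝ) = 2 / (1 + normSq q) := by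
    rw [sphereVecReal_apply]
    simp only [Matrix.cons_val]
    field_simp; ring
  have h3 : (1 + (sphereVecReal q 2 : ℂ)) = ((2 / (1 + normSq q) : ℝ) : ℂ) := by
    rw [← h2]; push_cast; ring
  have h4 : (2 / (1 + normSq q) : ℝ) ≠ 0 := div_ne_zero two_ne_zero h
  rw [stereo, h3, div_eq_iff (by exact_mod_cast h4), sphereVecReal_apply]
  apply Complex.ext
  · simp only [Matrix.cons_val_zero, Matrix.cons_val_one, add_re, mul_re, ofReal_re, ofReal_im,
      I_re,
      I_im]
    ring
  · simp only [Matrix.cons_val_zero, Matrix.cons_val_one, add_im, mul_im, ofReal_re, ofReal_im,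
      I_re,
      I_im]
    ring

theorem sphereVecReal_stereo {n : Fin 3 → ℝ} (hn : ∑ k, n k * n k = 1) (h2 : n 2 ≠ -1) :
    sphereVecReal (stereo n) = n := by
  have h : (1 + n 2 : ℝ) ≠ 0 := fun h ↦ h2 (by linarith)
  simp only [Fin.sum_univ_three] at hn
  have hs : stereo n = ((n 0 / (1 + n 2) : ℝ) : ℂ) + ((n 1 / (1 + n 2) : ℝ) : ℂ) * I := by
    rw [stereo]; push_cast; ring
  have hre : (stereo n).re = n 0 / (1 + n 2) := by
    rw [hs, add_re, re_ofReal_mul, ofReal_re, I_re, mul_zero, add_zero]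
  have him : (stereo n).im = n 1 / (1 + n 2) := by
    rw [hs, add_im, im_ofReal_mul, ofReal_im, I_im, mul_one, zero_add]
  have hN : 1 + normSq (stereo n) = 2 / (1 + n 2) := by
    rw [normSq_apply, hre, him]
    field_simp
    linarith
  have hN' : normSq (stereo n) = 2 / (1 + n 2) - 1 := by linarith
  rw [sphereVecReal_apply, hN, hre, him, hN']
  ext k
  fin_cases k <;> simp <;> field_simp
  ring

/-- The Weierstrass representation at a point: a vector `A = (p - i r) / 2` with `r = n × p`, `n` a
unit vector other than the south pole, is a multiple of `isoVec ū`, where `u` is the stereographic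
projection of `n`. -/
theorem eq_mul_isoVec {p r n : Fin 3 → ℝ} {lam : ℝ} (hlam : 0 < lam)
    (hp : ∑ k, p k * p k = lam) (hr : ∑ k, r k * r k = lam) (hpr : ∑ k, p k * r k = 0)
    (hn : ∑ k, n k * n k = 1) (hnp : ∑ k, n k * p k = 0) (hnr : ∑ k, n k * r k = 0)
    (hdet : 0 < tripleProduct p r n) (h2 : n 2 ≠ -1) {A : Fin 3 → ℂ}
    (hA : ∀ k, A k = (p k - I * r k) / 2) {ζ : ℂ} (hζ : ζ = -(A 0 + I * A 1) / 2) :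
    ζ ≠ 0 ∧ ∀ k, A k = ζ * isoVec (conj (stereo n)) k := by
  obtain ⟨⟨r0, r1, r2⟩, q0, q1, q2⟩ := cross_eq_of_orthogonal hlam hp hr hpr hn hnp hnr hdet
  have h : (1 + n 2 : ℂ) ≠ 0 := fun h ↦ h2 (by
    have : (1 + n 2 : ℝ) = 0 := by exact_mod_cast h
    linarith)
  -- the orthogonality and length conditions say that `A` is isotropic
  have hiso : A 0 * A 0 + A 1 * A 1 + A 2 * A 2 = 0 := by
    simp only [Fin.sum_univ_three] at hp hr hpr
    have hp' : (p 0 * p 0 + p 1 * p 1 + p 2 * p 2 : ℂ) = lam := by exact_mod_cast hp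
    have hr' : (r 0 * r 0 + r 1 * r 1 + r 2 * r 2 : ℂ) = lam := by exact_mod_cast hr
    have hpr' : (p 0 * r 0 + p 1 * r 1 + p 2 * r 2 : ℂ) = 0 := by exact_mod_cast hpr
    simp only [hA]
    linear_combination (hp' - hr' - 2 * I * hpr') / 4
      + (r 0 * r 0 + r 1 * r 1 + r 2 * r 2 : ℂ) / 4 * I_sq
  have hζ0 : ζ ≠ 0 := by
    intro h0
    have hre : p 0 + r 1 = 0 := by
      have := congrArg Complex.re (hζ.symm.trans h0)
      simp [hA] at this
      linarith
    have him : p 1 - r 0 = 0 := by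
      have := congrArg Complex.im (hζ.symm.trans h0)
      simp [hA] at this
      linarith
    -- then `λ n₂ = p₀ r₁ - p₁ r₀ ≤ 0`, while `p₂ = r₂ = 0` by isotropy
    have e0 : p 2 * p 2 = r 2 * r 2 := by
      simp only [Fin.sum_univ_three] at hp hr
      have h1 : r 1 = -p 0 := by linarith
      have h3 : r 0 = p 1 := by linarith
      rw [h1, h3] at hr
      linarith
    have e1 : p 2 * r 2 = 0 := by
      simp only [Fin.sum_univ_three] at hpr
      have h1 : r 1 = -p 0 := by linarith
      have h3 : r 0 = p 1 := by linarith
      rw [h1, h3] at hpr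
      linarith
    have e2 : p 2 = 0 := by
      rcases mul_eq_zero.1 e1 with h | h
      · exact h
      · rw [h] at e0; simpa using e0
    have e3 : lam * n 2 = -lam := by
      simp only [Fin.sum_univ_three] at hp
      have h1 : r 1 = -p 0 := by linarith
      have h3 : r 0 = p 1 := by linarith
      rw [q2, ← hp, e2, h1, h3]
      ring
    exact h2 (mul_left_cancel₀ hlam.ne' (by linarith))
  refine ⟨hζ0, ?_⟩
  have r2' : (r 2 : ℂ) = n 0 * p 1 - n 1 * p 0 := by exact_mod_cast r2
  have p2' : (p 2 : ℂ) = n 1 * r 0 - n 0 * r 1 := by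
    -- `p = -n × r`, as `n` is a unit vector orthogonal to `p`
    have : p 2 = n 1 * r 0 - n 0 * r 1 := by
      simp only [Fin.sum_univ_three] at hn hnp
      rw [r0, r1]
      linear_combination (-p 2) * hn + n 2 * hnp
    exact_mod_cast this
  have hn' : (n 0 * p 0 + n 1 * p 1 + n 2 * p 2 : ℂ) = 0 := by
    simp only [Fin.sum_univ_three] at hnp
    exact_mod_cast hnp
  have hnr' : (n 0 * r 0 + n 1 * r 1 + n 2 * r 2 : ℂ) = 0 := by
    simp only [Fin.sum_univ_three] at hnr
    exact_mod_cast hnr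
  have hc : conj (stereo n) = (n 0 - n 1 * I) / (1 + n 2) := by
    simp [stereo, sub_eq_add_neg]
  have hA2 : A 2 = 2 * ζ * conj (stereo n) := by
    rw [hc, mul_div_assoc', eq_div_iff h, hζ, hA, hA, hA]
    linear_combination (1 / 2 : ℂ) * p2' - (I / 2) * r2' + hn' / 2 - I / 2 * hnr'
      + ((n 1 * r 0 - n 0 * r 1 : ℂ) / 2 - (n 1 * p 1 : ℂ) / 2 + I * n 1 * r 1 / 2) * I_sq
  have hA01 : A 0 - I * A 1 = 2 * ζ * conj (stereo n) ^ 2 := by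
    have : ζ * (A 0 - I * A 1) = ζ * (2 * ζ * conj (stereo n) ^ 2) := by
      have e : (A 0 + I * A 1) = -2 * ζ := by rw [hζ]; ring
      linear_combination (-1 / 2) * hiso + (A 2 + 2 * ζ * conj (stereo n)) / 2 * hA2
        + (A 0 - I * A 1) / 2 * e + A 1 ^ 2 / 2 * I_sq
    exact mul_left_cancel₀ hζ0 this
  have e : (A 0 + I * A 1) = -2 * ζ := by rw [hζ]; ring
  intro k
  fin_cases k
  · simp [isoVec]
    linear_combination (e + hA01) / 2
  · simp [isoVec]
    linear_combination (e - hA01) * (-I) / 2 + A 1 * I_sq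
  · simp [isoVec]
    linear_combination hA2

/-- The pair `p, r` with `(p - i r) / 2 = ζ isoVec ū` is positively oriented with the inverse
stereographic projection of `u`. -/
theorem tripleProduct_pos_of_eq_mul_isoVec {p r : Fin 3 → ℝ} {u ζ : ℂ} (hζ : ζ ≠ 0)
    (hp : ∀ k, p k = 2 * (ζ * isoVec (conj u) k).re)
    (hr : ∀ k, r k = -2 * (ζ * isoVec (conj u) k).im) :
    0 < tripleProduct p r (sphereVecReal u) := by
  have h : (0 : ℝ) < 1 + normSq u := by linarith [normSq_nonneg u]
  have key : tripleProduct p r (sphereVecReal u) = 4 * normSq ζ * (1 + normSq u) ^ 2 := by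
    simp only [tripleProduct, sphereVecReal_apply, hp, hr, isoVec, Matrix.cons_val_zero,
      Matrix.cons_val_one, Matrix.cons_val]
    field_simp
    simp [pow_two, normSq_apply]
    ring
  rw [key]
  have := normSq_pos.2 hζ
  positivity

end Normal

/-! ### `H`-surfaces and solutions of the system, locally -/

section Local

open Complex Filter

local notation "conj" => starRingEnd ℂ

variable {X : Type*} [TopologicalSpace X] [ChartedSpace E3 X] [Group X] [LieGroup I3 ∞ X]

/-- The parametrized surface `F` is, at the point `w`, a smooth conformal immersion with mean
curvature `H` with respect to its oriented unit normal, whose left translation to the identity is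
`ν`. -/
structure IsHSurfaceAt (γ : LeftInvariantMetric X)
    (b : Module.Basis (Fin 3) ℝ (GroupLieAlgebra I3 X)) (H : ℝ) (F : ℂ → X)
    (ν : GroupLieAlgebra I3 X) (w : ℂ) : Prop where
  smooth : ContMDiffAt 𝓘(ℝ, ℂ) I3 ∞ F w
  conformal : ∃ lam : ℝ, 0 < lam ∧ ∀ v : ℂ, firstForm γ F w v v = lam * ‖v‖ ^ 2
  unit : γ.metric.inner (F w) (mulInvariantVectorField ν (F w))
    (mulInvariantVectorField ν (F w)) = 1
  normal : ∀ v : ℂ, γ.metric.inner (F w) (mulInvariantVectorField ν (F w)) (surfaceDeriv F w v) = 0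
  oriented : 0 < b.det ![leftLogDeriv F w 1, leftLogDeriv F w I, ν]
  curvature : meanCurvature γ F ν w = H

variable {γ : LeftInvariantMetric X} {b : Module.Basis (Fin 3) ℝ (GroupLieAlgebra I3 X)}
  {L : Fin 3 → Fin 3 → ℝ} {H : ℝ} {F : ℂ → X} {ν : GroupLieAlgebra I3 X} {w : ℂ}

theorem det_eq_tripleProduct (b : Module.Basis (Fin 3) ℝ (GroupLieAlgebra I3 X))
    (x y z : GroupLieAlgebra I3 X) :
    b.det ![x, y, z] = tripleProduct (b.repr x) (b.repr y) (b.repr z) := by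
  rw [b.det_apply, Matrix.det_fin_three, tripleProduct]
  simp only [Module.Basis.toMatrix_apply, Matrix.cons_val_zero, Matrix.cons_val_one,
    Matrix.cons_val]
  ring

theorem firstForm_eq_of_conformal (hb : IsOrthoFrame γ b L) {lam : ℝ}
    (hc : ∀ v : ℂ, firstForm γ F w v v = lam * ‖v‖ ^ 2) :
    ∑ k, logForm b F k w 1 * logForm b F k w 1 = lam ∧
    ∑ k, logForm b F k w I * logForm b F k w I = lam ∧
    ∑ k, logForm b F k w 1 * logForm b F k w I = 0 := by
  have h1 : firstForm γ F w 1 1 = lam := by simp [hc]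
  have h2 : firstForm γ F w I I = lam := by simp [hc]
  have h4 := hc (1 + I)
  have h5 : ‖(1 + I : ℂ)‖ ^ 2 = 2 := by
    rw [← normSq_eq_norm_sq]; simp [normSq_apply]; norm_num
  rw [h5, hb.firstForm_eq] at h4
  rw [hb.firstForm_eq] at h1 h2
  refine ⟨h1, h2, ?_⟩
  simp only [map_add, Fin.sum_univ_three] at *
  linarith

theorem IsHSurfaceAt.unit_repr (hb : IsOrthoFrame γ b L) (h : IsHSurfaceAt γ b H F ν w) :
    ∑ k, b.repr ν k * b.repr ν k = 1 := by
  rw [← hb.inner_eq, ← inner_mulInvariantVectorField γ (F w)]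
  exact h.unit

theorem IsHSurfaceAt.normal_repr (hb : IsOrthoFrame γ b L) (h : IsHSurfaceAt γ b H F ν w) (v : ℂ) :
    ∑ k, b.repr ν k * logForm b F k w v = 0 := by
  rw [← h.normal v, surfaceDeriv_eq, inner_mulInvariantVectorField, hb.inner_eq]
  rfl

theorem IsHSurfaceAt.oriented_repr (h : IsHSurfaceAt γ b H F ν w) :
    0 < tripleProduct (fun k ↦ logForm b F k w 1) (fun k ↦ logForm b F k w I) (b.repr ν) := by
  have := h.oriented
  rwa [det_eq_tripleProduct] at this

/-- The unit normal is determined by the surface. -/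
theorem IsHSurfaceAt.normal_unique (hb : IsOrthoFrame γ b L) {ν' : GroupLieAlgebra I3 X} {H' : ℝ}
    (h : IsHSurfaceAt γ b H F ν w) (h' : IsHSurfaceAt γ b H' F ν' w) : ν = ν' := by
  obtain ⟨lam, hlam, hc⟩ := h.conformal
  obtain ⟨h1, h2, h3⟩ := firstForm_eq_of_conformal hb hc
  obtain ⟨-, a0, a1, a2⟩ := cross_eq_of_orthogonal hlam h1 h2 h3 (h.unit_repr hb)
    (h.normal_repr hb 1) (h.normal_repr hb I) h.oriented_repr
  obtain ⟨-, b0, b1, b2⟩ := cross_eq_of_orthogonal hlam h1 h2 h3 (h'.unit_repr hb)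
    (h'.normal_repr hb 1) (h'.normal_repr hb I) h'.oriented_repr
  refine b.repr.injective (Finsupp.ext fun k ↦ mul_left_cancel₀ hlam.ne' ?_)
  fin_cases k
  · exact a0.trans b0.symm
  · exact a1.trans b1.symm
  · exact a2.trans b2.symm

/-- The Weierstrass datum `ζ` of a conformal surface. -/
def weierstrassDatum (b : Module.Basis (Fin 3) ℝ (GroupLieAlgebra I3 X)) (F : ℂ → X) (w : ℂ) : ℂ :=
  -(zPart (logForm b F) 0 w + I * zPart (logForm b F) 1 w) / 2

/-- The logarithmic derivative of a conformal surface, at a point where the normal is not the south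
pole. -/
theorem IsHSurfaceAt.zPart_eq (hb : IsOrthoFrame γ b L) (h : IsHSurfaceAt γ b H F ν w)
    (h2 : b.repr ν 2 ≠ -1) : weierstrassDatum b F w ≠ 0 ∧ ∀ k, zPart (logForm b F) k w =
      weierstrassDatum b F w * isoVec (conj (stereo (b.repr ν))) k := by
  obtain ⟨lam, hlam, hc⟩ := h.conformal
  obtain ⟨h1, h3, h4⟩ := firstForm_eq_of_conformal hb hc
  exact eq_mul_isoVec hlam h1 h3 h4 (h.unit_repr hb)
    (h.normal_repr hb 1) (h.normal_repr hb I) h.oriented_repr h2 (fun k ↦ rfl) rfl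

theorem IsHSurfaceAt.weierstrassDatum_eq_zero (hb : IsOrthoFrame γ b L)
    (h : IsHSurfaceAt γ b H F ν w) (h2 : b.repr ν 2 = -1) : weierstrassDatum b F w = 0 := by
  obtain ⟨lam, hlam, hc⟩ := h.conformal
  obtain ⟨h1, h3, h4⟩ := firstForm_eq_of_conformal hb hc
  obtain ⟨⟨a0, a1, -⟩, -⟩ := cross_eq_of_orthogonal hlam h1 h3 h4 (h.unit_repr hb)
    (h.normal_repr hb 1) (h.normal_repr hb I) h.oriented_repr
  have hn := h.unit_repr hb
  simp only [Fin.sum_univ_three, h2] at hn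
  have n0 : b.repr ν 0 = 0 := pow_eq_zero_iff two_ne_zero |>.1
    (by linarith [sq_nonneg (b.repr ν 0), mul_self_nonneg (b.repr ν 1)])
  have n1 : b.repr ν 1 = 0 := pow_eq_zero_iff two_ne_zero |>.1
    (by linarith [mul_self_nonneg (b.repr ν 0), sq_nonneg (b.repr ν 1)])
  rw [h2, n1] at a0
  rw [h2, n0] at a1
  rw [weierstrassDatum, zPart, zPart, a0, a1]
  push_cast
  linear_combination (-(logForm b F 0 w 1 : ℂ) / 4) * I_sq

theorem contDiffAt_zPart {α : Fin 3 → ℂ → ℂ →L[ℝ] ℝ} {k : Fin 3} (h : ContDiffAt ℝ ∞ (α k) w) :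
    ContDiffAt ℝ ∞ (zPart α k) w := by
  have h1 : ∀ v : ℂ, ContDiffAt ℝ ∞ (fun w ↦ ((α k w v : ℝ) : ℂ)) w := fun v ↦
    (ofRealCLM.contDiff.contDiffAt).comp w (h.clm_apply contDiffAt_const)
  exact ((h1 1).sub (contDiffAt_const.mul (h1 I))).div_const 2

/-- The Gauss map and the Weierstrass datum of an `H`-surface are smooth and solve the system, near
a point where the normal is not the south pole. -/
theorem weierstrassSystemAt_of_isHSurfaceAt (hb : IsOrthoFrame γ b L)
    {ν : ℂ → GroupLieAlgebra I3 X} (h : ∀ᶠ w' in 𝓝 w, IsHSurfaceAt γ b H F (ν w') w')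
    (h2 : b.repr (ν w) 2 ≠ -1) :
    ∀ᶠ w' in 𝓝 w, b.repr (ν w') 2 ≠ -1 ∧ weierstrassDatum b F w' ≠ 0 ∧
      ContDiffAt ℝ ∞ (fun w ↦ stereo (b.repr (ν w))) w' ∧
      ContDiffAt ℝ ∞ (weierstrassDatum b F) w' ∧
      (∀ k, zPart (logForm b F) k w' =
        weierstrassDatum b F w' * isoVec (conj (stereo (b.repr (ν w')))) k) ∧
      WeierstrassSystemAt L H (fun w ↦ stereo (b.repr (ν w))) (weierstrassDatum b F) w' := by
  have hA : ∀ᶠ w' in 𝓝 w, ∀ k, ContDiffAt ℝ ∞ (zPart (logForm b F) k) w' :=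
    h.mono fun w' hw' k ↦ contDiffAt_zPart (contDiffAt_logForm b hw'.smooth k)
  have hζs : ∀ᶠ w' in 𝓝 w, ContDiffAt ℝ ∞ (weierstrassDatum b F) w' :=
    hA.mono fun w' hw' ↦ (((hw' 0).add (contDiffAt_const.mul (hw' 1))).neg).div_const 2
  have hζ0 : ∀ᶠ w' in 𝓝 w, weierstrassDatum b F w' ≠ 0 :=
    hζs.self_of_nhds.continuousAt.eventually_ne (h.self_of_nhds.zPart_eq hb h2).1
  have hν : ∀ᶠ w' in 𝓝 w, b.repr (ν w') 2 ≠ -1 := by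
    filter_upwards [h, hζ0] with w' h1 h3 h4 using h3 (h1.weierstrassDatum_eq_zero hb h4)
  have hz : ∀ᶠ w' in 𝓝 w, ∀ k, zPart (logForm b F) k w' =
      weierstrassDatum b F w' * isoVec (conj (stereo (b.repr (ν w')))) k := by
    filter_upwards [h, hν] with w' h1 h3 using (h1.zPart_eq hb h3).2
  have hus : ∀ᶠ w' in 𝓝 w, ContDiffAt ℝ ∞ (fun w ↦ stereo (b.repr (ν w))) w' := by
    filter_upwards [hA, hζs, hζ0, (hz.and hζ0).eventually_nhds] with w' h1 h3 h4 h5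
    have h6 : ContDiffAt ℝ ∞ (fun w ↦ conj (zPart (logForm b F) 2 w *
        (2 * weierstrassDatum b F w)⁻¹)) w' := by
      refine contDiffAt_conj.comp w' ((h1 2).mul ((contDiffAt_const.mul h3).inv ?_))
      exact mul_ne_zero two_ne_zero h4
    refine h6.congr_of_eventuallyEq (h5.mono fun w'' h7 ↦ ?_)
    have h8 := h7.1 2
    have h9 := h7.2
    simp only [isoVec, Matrix.cons_val] at h8
    change stereo (b.repr (ν w'')) = conj (zPart (logForm b F) 2 w'' * _)
    have h10 : weierstrassDatum b F w'' * (2 * conj (stereo (b.repr (ν w'')))) *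
        (2 * weierstrassDatum b F w'')⁻¹ = conj (stereo (b.repr (ν w''))) := by
      field_simp
    rw [h8, h10, conj_conj]
  filter_upwards [h, hν, hζ0, hus, hζs, hz.eventually_nhds] with w' h1 h3 h4 h5 h6 h7
  refine ⟨h3, h4, h5, h6, h7.self_of_nhds, ?_⟩
  obtain ⟨lam, hlam, hc⟩ := h1.conformal
  set ζ := weierstrassDatum b F with hζ
  set u : ℂ → ℂ := fun w ↦ stereo (b.repr (ν w)) with hu
  have hnab := nablaZ_eq L H (h6.differentiableAt (by simp)) (h5.differentiableAt (by simp)) h7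
  -- the Maurer–Cartan equation says that `∇_{∂_z̄} F_z` is real
  have hreal : ∀ k, (nablaZ L (logForm b F) k w').im = 0 := fun k ↦ by
    rw [hb.nablaZ_im ((contDiffAt_logForm b h1.smooth k).differentiableAt (by simp)),
      maurerCartan_logForm b h1.smooth]
    simp
  have hreal' : ∀ k, (((nablaZ L (logForm b F) k w').re : ℝ) : ℂ) = nablaZ L (logForm b F) k w' :=
    fun k ↦ Complex.ext rfl (hreal k).symm
  have hH := h1.curvature
  rw [hb.meanCurvature_eq h1.smooth _ hlam hc, div_eq_iff hlam.ne'] at hH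
  have hn := one_add_mul_conj_ne_zero (u w')
  have hsv : ∀ k, (b.repr (ν w') k : ℂ) * (1 + u w' * conj (u w')) =
      sphereVec (u w') (conj (u w')) k := fun k ↦ by
    rw [← ofReal_sphereVecReal, hu, sphereVecReal_stereo (h1.unit_repr hb) h3]
  have hlam' : (lam : ℂ) = 4 * (ζ w' * conj (ζ w')) * (1 + u w' * conj (u w')) ^ 2 := by
    obtain ⟨e1, e2, -⟩ := firstForm_eq_of_conformal hb hc
    have e3 : (2 * lam : ℂ) = 4 * ∑ k, zPart (logForm b F) k w' *
        conj (zPart (logForm b F) k w') := by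
      have : ∀ k, zPart (logForm b F) k w' * conj (zPart (logForm b F) k w') =
          ((logForm b F k w' 1 * logForm b F k w' 1 + logForm b F k w' I * logForm b F k w' I) / 4
            : ℝ) := fun k ↦ by
        rw [mul_conj, normSq_apply, zPart_re, zPart_im]
        push_cast; ring
      simp only [this]
      rw [two_mul]
      nth_rewrite 1 [← e1]
      rw [← e2]
      push_cast
      simp only [Fin.sum_univ_three]
      ring
    have e4 : ∑ k, zPart (logForm b F) k w' * conj (zPart (logForm b F) k w') =
        ζ w' * conj (ζ w') * (2 * (1 + u w' * conj (u w')) ^ 2) := by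
      rw [← sum_isoVec_mul_conj, Finset.mul_sum]
      refine Finset.sum_congr rfl fun k _ ↦ ?_
      rw [h7.self_of_nhds k, map_mul]; ring
    rw [e4] at e3
    linear_combination e3 / 2
  have hH' : 2 * ∑ k, (b.repr (ν w') k : ℂ) * nablaZ L (logForm b F) k w' = H * lam := by
    have := congrArg (fun x : ℝ ↦ (x : ℂ)) hH
    push_cast at this
    simpa only [hreal'] using this
  obtain ⟨x, hx⟩ : ∃ x, x = dzbar ζ w' + conj (dz (pot L H) (u w')) * (ζ w' * conj (ζ w')) :=
    ⟨_, rfl⟩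
  obtain ⟨y, hy⟩ : ∃ y, y = ζ w' * (conj (dz u w') - conj (pot L H (u w')) * conj (ζ w')) :=
    ⟨_, rfl⟩
  simp only [← hx, ← hy] at hnab
  -- pairing with the normal kills the `isoVec` term
  have hy0 : y = 0 := by
    have s1 := sum_sphereVec_sq (u w') (conj (u w'))
    have s2 := sum_sphereVec_mul_isoVec (u w') (conj (u w'))
    have s3 := sum_sphereVec_mul_isoVec' (u w') (conj (u w'))
    have s4 : 2 * ∑ k, sphereVec (u w') (conj (u w')) k * nablaZ L (logForm b F) k w' =
        H * lam * (1 + u w' * conj (u w')) := by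
      rw [← hH']
      simp only [← hsv, Fin.sum_univ_three]
      ring
    simp only [hnab, Fin.sum_univ_three] at s1 s2 s3 s4
    have s5 : y * (4 * (1 + u w' * conj (u w'))) = 0 := by
      linear_combination s4 + H * (1 + u w' * conj (u w')) * hlam' - 2 * y * s3 - 2 * x * s2
        - 4 * H * (ζ w' * conj (ζ w')) * (1 + u w' * conj (u w')) * s1
    exact (mul_eq_zero.1 s5).resolve_right (mul_ne_zero (by norm_num) hn)
  -- and then the rest is real and isotropic
  have hx0 : x = 0 := by
    refine eq_zero_of_mul_isoVec_real (q := u w') fun k ↦ ?_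
    have e : x * isoVec (conj (u w')) k = nablaZ L (logForm b F) k w' -
        ((2 * H * normSq (ζ w') * (1 + normSq (u w')) : ℝ) : ℂ) *
          sphereVec (u w') (conj (u w')) k := by
      rw [hnab, hy0, mul_conj, one_add_mul_conj]; push_cast; ring
    rw [e, sub_im, hreal, im_ofReal_mul, sphereVec_im]; simp
  constructor
  · have h8 := (mul_eq_zero.1 (hy.symm.trans hy0)).resolve_left h4
    have h9 := congrArg conj (sub_eq_zero.1 h8)
    simpa using h9
  · exact eq_neg_of_add_eq_zero_left (hx.symm.trans hx0)

end Local

/-! ### From solutions of the system to `H`-surfaces, locally -/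

section LocalConverse

open Complex Filter

local notation "conj" => starRingEnd ℂ

variable {X : Type*} [TopologicalSpace X] [ChartedSpace E3 X] [Group X] [LieGroup I3 ∞ X]
  {γ : LeftInvariantMetric X} {b : Module.Basis (Fin 3) ℝ (GroupLieAlgebra I3 X)}
  {L : Fin 3 → Fin 3 → ℝ} {H : ℝ} {F : ℂ → X} {ν : GroupLieAlgebra I3 X} {u ζ : ℂ → ℂ} {w : ℂ}

/-- For a solution of the system, `∇_{∂_z̄} F_z` is a real multiple of the normal. -/
theorem WeierstrassSystemAt.nablaZ_eq (h : WeierstrassSystemAt L H u ζ w)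
    (hζ : DifferentiableAt ℝ ζ w) (hu : DifferentiableAt ℝ u w) {α : Fin 3 → ℂ → ℂ →L[ℝ] ℝ}
    (hα : ∀ᶠ w' in 𝓝 w, ∀ k, zPart α k w' = ζ w' * isoVec (conj (u w')) k) (k : Fin 3) :
    nablaZ L α k w =
      ((2 * H * normSq (ζ w) * (1 + normSq (u w)) ^ 2 * sphereVecReal (u w) k : ℝ) : ℂ) := by
  rw [MetricLie.nablaZ_eq L H hζ hu hα, h.1, h.2, ← ofReal_sphereVecReal, map_mul]
  push_cast
  simp only [mul_conj]
  ring

/-- The Maurer–Cartan equation for the form defined by a solution of the system. -/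
theorem WeierstrassSystemAt.maurerCartan_eq_zero (hb : IsOrthoFrame γ b L)
    (h : WeierstrassSystemAt L H u ζ w) (hζ : ContDiffAt ℝ ∞ ζ w) (hu : ContDiffAt ℝ ∞ u w)
    (v v' : ℂ) (k : Fin 3) :
    maurerCartan (structConst b) (weierstrassForm ζ u) w v v' k = 0 := by
  have h1 := h.nablaZ_eq (hζ.differentiableAt (by simp)) (hu.differentiableAt (by simp))
    (α := weierstrassForm ζ u) (Eventually.of_forall fun w' k ↦ zPart_weierstrassForm ζ u k w') k
  have h2 := hb.nablaZ_im (k := k)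
    ((contDiffAt_weierstrassForm hζ hu k).differentiableAt (by simp))
  rw [h1, ofReal_im] at h2
  rw [hb.maurerCartan_eq, show maurerCartan (structConst b) (weierstrassForm ζ u) w 1 I k = 0 by
    linarith, mul_zero]

/-- A surface whose logarithmic derivative is defined by a solution of the system is an
`H`-surface. -/
theorem WeierstrassSystemAt.isHSurfaceAt (hb : IsOrthoFrame γ b L)
    (h : WeierstrassSystemAt L H u ζ w) (hζ : DifferentiableAt ℝ ζ w) (hu : DifferentiableAt ℝ u w)
    (hζ0 : ζ w ≠ 0) (hF : ContMDiffAt 𝓘(ℝ, ℂ) I3 ∞ F w)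
    (hα : ∀ᶠ w' in 𝓝 w, ∀ k, logForm b F k w' = weierstrassForm ζ u k w')
    (hν : ∀ k, b.repr ν k = sphereVecReal (u w) k) : IsHSurfaceAt γ b H F ν w := by
  have hz : ∀ᶠ w' in 𝓝 w, ∀ k, zPart (logForm b F) k w' = ζ w' * isoVec (conj (u w')) k :=
    hα.mono fun w' h' k ↦ by rw [← zPart_weierstrassForm, zPart, zPart, h' k]
  have hnab := h.nablaZ_eq hζ hu hz
  have hα' : ∀ k v, logForm b F k w v = 2 * (ζ w * isoVec (conj (u w)) k * v).re := fun k v ↦ by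
    rw [hα.self_of_nhds k, weierstrassForm_apply]
  have hpos : (0 : ℝ) < 1 + normSq (u w) := by linarith [normSq_nonneg (u w)]
  have hlam : 0 < 4 * normSq (ζ w) * (1 + normSq (u w)) ^ 2 := by
    have := normSq_pos.2 hζ0
    positivity
  have hc : ∀ v, firstForm γ F w v v = 4 * normSq (ζ w) * (1 + normSq (u w)) ^ 2 * ‖v‖ ^ 2 := by
    intro v
    -- `(2 Re (a v))² = 2 |a|² |v|² + 2 Re (a² v²)`, and the vector `isoVec` is isotropic
    have e : ∀ x : ℂ, 2 * x.re * (2 * x.re) = 2 * normSq x + 2 * (x ^ 2).re := fun x ↦ by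
      rw [normSq_apply, pow_two, mul_re]; ring
    have e1 : ∑ k, normSq (isoVec (conj (u w)) k) = 2 * (1 + normSq (u w)) ^ 2 := by
      have := sum_isoVec_mul_conj (u w)
      simp only [mul_conj] at this
      exact_mod_cast this
    have e2 : ∑ k, ((ζ w * isoVec (conj (u w)) k * v) ^ 2).re = 0 := by
      rw [← re_sum]
      have : ∑ k, (ζ w * isoVec (conj (u w)) k * v) ^ 2 =
          (ζ w * v) ^ 2 * ∑ k, isoVec (conj (u w)) k ^ 2 := by
        rw [Finset.mul_sum]; exact Finset.sum_congr rfl fun k _ ↦ by ring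
      rw [this, sum_isoVec_sq]; simp
    rw [hb.firstForm_eq]
    simp only [hα', e, Finset.sum_add_distrib, ← Finset.mul_sum, e2, map_mul, mul_zero, add_zero]
    rw [← Finset.sum_mul, ← Finset.mul_sum, e1, normSq_eq_norm_sq v]
    ring
  have hnn : ∑ k, b.repr ν k * b.repr ν k = 1 := by
    simp only [hν]; exact sum_sphereVecReal_sq (u w)
  refine ⟨hF, ⟨_, hlam, hc⟩, ?_, fun v ↦ ?_, ?_, ?_⟩
  · rw [inner_mulInvariantVectorField, hb.inner_eq, hnn]
  · rw [surfaceDeriv_eq, inner_mulInvariantVectorField, hb.inner_eq]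
    simp only [← logForm_apply, hν, hα']
    have h1 : ∀ k, sphereVecReal (u w) k * (2 * (ζ w * isoVec (conj (u w)) k * v).re) =
        (2 * ζ w * v / (1 + u w * conj (u w)) *
          (sphereVec (u w) (conj (u w)) k * isoVec (conj (u w)) k)).re := fun k ↦ by
      have hn := one_add_mul_conj_ne_zero (u w)
      rw [← ofReal_sphereVecReal]
      have : 2 * ζ w * v / (1 + u w * conj (u w)) *
          (sphereVecReal (u w) k * (1 + u w * conj (u w)) * isoVec (conj (u w)) k) =
          ((sphereVecReal (u w) k * 2 : ℝ) : ℂ) * (ζ w * isoVec (conj (u w)) k * v) := by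
        push_cast; field_simp
      rw [this, re_ofReal_mul]; ring
    simp only [h1]
    rw [← re_sum, ← Finset.mul_sum, sum_sphereVec_mul_isoVec]; simp
  · rw [det_eq_tripleProduct]
    have : (⇑(b.repr ν) : Fin 3 → ℝ) = sphereVecReal (u w) := funext hν
    rw [this]
    refine tripleProduct_pos_of_eq_mul_isoVec hζ0 (fun k ↦ ?_) fun k ↦ ?_
    · exact (hα' k 1).trans (by simp)
    · exact (hα' k I).trans (by simp; ring)
  · rw [hb.meanCurvature_eq hF ν hlam hc]
    have : ∑ k, b.repr ν k * (nablaZ L (logForm b F) k w).re =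
        2 * H * normSq (ζ w) * (1 + normSq (u w)) ^ 2 * ∑ k, b.repr ν k * b.repr ν k := by
      simp only [hnab, ofReal_re, hν, Finset.mul_sum]
      exact Finset.sum_congr rfl fun k _ ↦ by ring
    rw [this, hnn, div_eq_iff hlam.ne']
    ring

theorem contDiffAt_dz (hu : ContDiffAt ℝ ∞ u w) : ContDiffAt ℝ ∞ (dz u) w := by
  have h1 : ContDiffAt ℝ ∞ (fderiv ℝ u) w := hu.fderiv_right (by simp)
  have h2 : ∀ v : ℂ, ContDiffAt ℝ ∞ (fun w ↦ fderiv ℝ u w v) w := fun v ↦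
    h1.clm_apply contDiffAt_const
  exact ((h2 1).sub (contDiffAt_const.mul (h2 I))).div_const 2

/-- The Gauss map equation is the second equation of the system, when the first one is taken as the
definition of `ζ`. -/
theorem gaussEquationAt_iff {R : ℂ → ℂ} (hu : ContDiffAt ℝ ∞ u w)
    (hR : DifferentiableAt ℝ R (u w)) (hR0 : R (u w) ≠ 0) :
    GaussEquationAt R u w ↔ dzbar (fun w ↦ dz u w * (R (u w))⁻¹) w =
      -(conj (dz R (u w)) * (dz u w * (R (u w))⁻¹ * conj (dz u w * (R (u w))⁻¹))) := by
  have hd : DifferentiableAt ℝ (dz u) w := (contDiffAt_dz hu).differentiableAt (by simp)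
  have h1 := (hasWirtingerAt_of_differentiableAt hd).mul
    (((hasWirtingerAt_of_differentiableAt hR).comp
      (hasWirtingerAt_of_differentiableAt (hu.differentiableAt (by simp)))).inv hR0)
  have hR0' : conj (R (u w)) ≠ 0 := by simpa using hR0
  rw [h1.dzbar_eq, GaussEquationAt, ← Complex.mul_conj', map_mul, map_inv₀]
  field_simp
  constructor <;> intro h <;> linear_combination h

theorem differentiableAt_pot (L : Fin 3 → Fin 3 → ℝ) (H : ℝ) (q : ℂ) :
    DifferentiableAt ℝ (pot L H) q := HasFDerivAt.differentiableAt (hasWirtingerAt_pot L H q)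

theorem contDiff_pot (L : Fin 3 → Fin 3 → ℝ) (H : ℝ) : ContDiff ℝ ∞ (pot L H) := by
  have hc : ContDiff ℝ ∞ (fun q : ℂ ↦ conj q) := (conjCLE : ℂ →L[ℝ] ℂ).contDiff
  have hs : ∀ i, ContDiff ℝ ∞ (fun q : ℂ ↦ sphereVec q (conj q) i) := by
    intro i
    fin_cases i
    · exact contDiff_id.add hc
    · exact contDiff_const.mul (contDiff_id.sub hc)
    · exact contDiff_const.sub (contDiff_id.mul hc)
  have hn : ContDiff ℝ ∞ (fun q : ℂ ↦ 1 + q * conj q) := contDiff_const.add (contDiff_id.mul hc)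
  refine ((contDiff_const.mul (hn.pow 2)).sub (contDiff_const.mul (ContDiff.sum fun i _ ↦
    ContDiff.sum fun j _ ↦ contDiff_const.mul ((hs i).mul (hs j))))).sub (hn.mul
      (ContDiff.sum fun i _ ↦ contDiff_const.mul (hs i)))

/-- The Weierstrass datum `u_z / R(u)` of a prospective Gauss map `u`. -/
def gaussDatum (L : Fin 3 → Fin 3 → ℝ) (H : ℝ) (u : ℂ → ℂ) (w : ℂ) : ℂ :=
  dz u w * (pot L H (u w))⁻¹

theorem contDiffAt_gaussDatum (hu : ContDiffAt ℝ ∞ u w) (hR : pot L H (u w) ≠ 0) :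
    ContDiffAt ℝ ∞ (gaussDatum L H u) w :=
  (contDiffAt_dz hu).mul (((contDiff_pot L H).contDiffAt.comp w hu).inv hR)

theorem weierstrassSystemAt_gaussDatum (hu : ContDiffAt ℝ ∞ u w) (hR : pot L H (u w) ≠ 0)
    (h : GaussEquationAt (pot L H) u w) : WeierstrassSystemAt L H u (gaussDatum L H u) w :=
  ⟨by rw [gaussDatum]; field_simp,
    (gaussEquationAt_iff hu (differentiableAt_pot L H _) hR).1 h⟩

theorem WeierstrassSystemAt.gaussEquationAt (hu : ContDiffAt ℝ ∞ u w) (hR : pot L H (u w) ≠ 0)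
    (h : ∀ᶠ w' in 𝓝 w, WeierstrassSystemAt L H u ζ w') : GaussEquationAt (pot L H) u w := by
  have e : ∀ᶠ w' in 𝓝 w, ζ w' = gaussDatum L H u w' := by
    have h1 : ContinuousAt (fun w ↦ pot L H (u w)) w :=
      (contDiff_pot L H).continuous.continuousAt.comp hu.continuousAt
    filter_upwards [h, h1.eventually_ne hR] with w' h2 h3
    rw [gaussDatum, h2.1]
    field_simp
  have h2 := h.self_of_nhds.2
  refine (gaussEquationAt_iff hu (differentiableAt_pot L H _) hR).2 ?_
  have e' : fderiv ℝ ζ w = fderiv ℝ (gaussDatum L H u) w := Filter.EventuallyEq.fderiv_eq e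
  rw [dzbar, e', ← dzbar, e.self_of_nhds] at h2
  exact h2

/-- The Gauss map equation does not depend on the affine coordinate: the change of the system under
`u ↦ 1/u`, given the potential `L', H` in the coordinate `1/q`. -/
theorem WeierstrassSystemAt.inv {L' : Fin 3 → Fin 3 → ℝ}
    (hL : ∀ q : ℂ, q ≠ 0 → pot L' H q = (q * conj q) ^ 2 * pot L H q⁻¹)
    (h : WeierstrassSystemAt L H u ζ w) (hu : DifferentiableAt ℝ u w) (hζ : DifferentiableAt ℝ ζ w)
    (hu0 : u w ≠ 0) :
    WeierstrassSystemAt L' H (fun w ↦ (u w)⁻¹)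
      (fun w ↦ -1 * (ζ w * (conj (u w) * conj (u w)))) w := by
  have hU := hasWirtingerAt_of_differentiableAt hu
  have hZ := hasWirtingerAt_of_differentiableAt hζ
  have hc0 : conj (u w) ≠ 0 := by simpa using hu0
  have hq0 : (u w)⁻¹ ≠ 0 := inv_ne_zero hu0
  have hR := (hasWirtingerAt_of_differentiableAt (differentiableAt_pot L H (u w)))
  have hid : HasWirtingerAt (fun q : ℂ ↦ q) 1 0 (u w)⁻¹ := hasWirtingerAt_id
  have hcid := hid.conj
  have hR' : dz (pot L' H) (u w)⁻¹ = 2 * pot L H (u w) / (u w * conj (u w) ^ 2)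
      - dz (pot L H) (u w) / conj (u w) ^ 2 := by
    have h1 := (inv_inv (u w)).symm
    have h2 := ((hid.mul hcid).mul (hid.mul hcid)).mul
      (HasWirtingerAt.comp (u := fun q ↦ q⁻¹) (h1 ▸ hR) (hid.inv hq0))
    have h3 : pot L' H =ᶠ[𝓝 (u w)⁻¹] fun q ↦ (q * conj q) * (q * conj q) * pot L H q⁻¹ := by
      filter_upwards [isOpen_ne.mem_nhds hq0] with q hq
      rw [hL q hq]; ring
    rw [(h2.congr_of_eventuallyEq h3).dz_eq]
    simp only [inv_inv, map_inv₀, map_zero, neg_zero, zero_div, mul_zero, add_zero]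
    field_simp
    ring
  constructor
  · rw [(hU.inv hu0).dz_eq, hL _ hq0, h.1, inv_inv, map_inv₀]
    field_simp
  · rw [((hZ.mul (hU.conj.mul hU.conj)).const_mul (-1)).dzbar_eq, h.2, h.1, hR']
    simp only [map_mul, map_sub, map_div₀, map_pow, conj_conj, map_neg, map_one, map_ofNat]
    field_simp
    ring

end LocalConverse

/-! ### The canonical basis and the two affine coordinates of the sphere -/

section Canonical

open Complex Filter

local notation "conj" => starRingEnd ℂ

variable {X : Type*} [TopologicalSpace X] [ChartedSpace E3 X] [Group X] [LieGroup I3 ∞ X]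
  {γ : LeftInvariantMetric X} {b e : Module.Basis (Fin 3) ℝ (GroupLieAlgebra I3 X)}
  {L : Fin 3 → Fin 3 → ℝ} {H : ℝ}

/-- The matrix `L` of the bracket in a canonical basis. -/
def structMatrix : StructureConstants → Fin 3 → Fin 3 → ℝ
  | .unimodular c₁ c₂ c₃ => ![![c₁, 0, 0], ![0, c₂, 0], ![0, 0, c₃]]
  | .nonUnimodular a b => ![![(1 - a) * b, -(1 - a), 0], ![1 + a, (1 + a) * b, 0], ![0, 0, 0]]

theorem IsOrthoFrame.of_bracket
    (ho : ∀ i j, γ.metric.inner 1 (b i) (b j) = if i = j then 1 else 0)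
    (h0 : ⁅b 1, b 2⁆ = ∑ k, L 0 k • b k) (h1 : ⁅b 2, b 0⁆ = ∑ k, L 1 k • b k)
    (h2 : ⁅b 0, b 1⁆ = ∑ k, L 2 k • b k) : IsOrthoFrame γ b L := by
  refine ⟨ho, fun x y k ↦ ?_⟩
  have h0' : ⁅b 2, b 1⁆ = -∑ k, L 0 k • b k := by rw [← h0, lie_skew]
  have h1' : ⁅b 0, b 2⁆ = -∑ k, L 1 k • b k := by rw [← h1, lie_skew]
  have h2' : ⁅b 1, b 0⁆ = -∑ k, L 2 k • b k := by rw [← h2, lie_skew]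
  have key : ⁅x, y⁆ = ∑ i, ∑ j, (b.repr x i * b.repr y j) • ⁅b i, b j⁆ := by
    conv_lhs => rw [← b.sum_repr x, ← b.sum_repr y]
    simp only [Fin.sum_univ_three, add_lie, lie_add, smul_lie, lie_smul]
    module
  rw [key]
  simp only [Fin.sum_univ_three, h0, h1, h2, h0', h1', h2', lie_self, map_add, map_smul, map_neg,
    smul_zero, map_zero, Finsupp.add_apply, Finsupp.smul_apply, Finsupp.neg_apply,
    Finsupp.zero_apply, Module.Basis.repr_self, smul_eq_mul, milnorBracket]
  fin_cases k <;> simp <;> ring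

theorem IsCanonicalBasis.isOrthoFrame {s : StructureConstants} (hs : IsCanonicalBasis γ e s) :
    IsOrthoFrame γ e (structMatrix s) := by
  obtain ⟨ho, hs⟩ := hs
  cases s with
  | unimodular c₁ c₂ c₃ =>
    obtain ⟨h0, h1, h2, -⟩ := hs
    exact .of_bracket ho (by simp [h0, structMatrix, Fin.sum_univ_three])
      (by simp [h1, structMatrix, Fin.sum_univ_three])
      (by simp [h2, structMatrix, Fin.sum_univ_three])
  | nonUnimodular a b =>
    obtain ⟨h2, h1, h0, -⟩ := hs
    refine .of_bracket ho ?_ (by simp [h1, structMatrix, Fin.sum_univ_three])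
      (by simp [h2, structMatrix, Fin.sum_univ_three])
    rw [← lie_skew, h0]
    simp [structMatrix, Fin.sum_univ_three]
    module

theorem norm_sq_eq_mul_conj (q : ℂ) : (‖q‖ : ℂ) ^ 2 = q * conj q := (mul_conj' q).symm

theorem norm_pow_four_eq (q : ℂ) : (‖q‖ : ℂ) ^ 4 = (q * conj q) ^ 2 := by
  rw [← norm_sq_eq_mul_conj]; ring

theorem hPotential_eq_pot (H : ℝ) (s : StructureConstants) :
    hPotential H s = pot (structMatrix s) H := by
  ext q
  cases s with
  | unimodular c₁ c₂ c₃ =>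
    simp only [hPotential, norm_sq_eq_mul_conj, pot, potPoly, structMatrix, axial, sphereVec,
      Fin.sum_univ_three, Matrix.cons_val_zero, Matrix.cons_val_one, Matrix.cons_val, map_add,
      map_sub, map_one, map_pow]
    push_cast
    ring_nf
    simp only [I_pow_three]
    ring
  | nonUnimodular a b =>
    simp only [hPotential, norm_sq_eq_mul_conj, norm_pow_four_eq, pot, potPoly, structMatrix, axial,
      sphereVec, Fin.sum_univ_three, Matrix.cons_val_zero, Matrix.cons_val_one, Matrix.cons_val]
    push_cast
    ring_nf
    simp only [I_sq, I_pow_three]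
    ring

/-- The signs of the half turn about the first axis, which exchanges the poles of the sphere. -/
def flipSign : Fin 3 → ℝ := ![1, -1, -1]

/-- The bracket in the basis `(b₀, -b₁, -b₂)`. -/
def flipMatrix (L : Fin 3 → Fin 3 → ℝ) (i j : Fin 3) : ℝ := flipSign i * flipSign j * L i j

/-- The basis `(b₀, -b₁, -b₂)`. The stereographic projection with respect to it is the inverse of
the one with respect to `b`. -/
def flipBasis (b : Module.Basis (Fin 3) ℝ (GroupLieAlgebra I3 X)) :
    Module.Basis (Fin 3) ℝ (GroupLieAlgebra I3 X) :=
  b.unitsSMul ![1, -1, -1]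

theorem flipBasis_apply (b : Module.Basis (Fin 3) ℝ (GroupLieAlgebra I3 X)) (i : Fin 3) :
    flipBasis b i = flipSign i • b i := by
  rw [flipBasis, Module.Basis.unitsSMul_apply]
  fin_cases i <;> simp [flipSign, Units.smul_def]

theorem flipBasis_repr (b : Module.Basis (Fin 3) ℝ (GroupLieAlgebra I3 X))
    (x : GroupLieAlgebra I3 X) (k : Fin 3) : (flipBasis b).repr x k = flipSign k * b.repr x k := by
  rw [flipBasis, Module.Basis.repr_unitsSMul]
  fin_cases k <;> simp [flipSign, Units.smul_def]

theorem IsOrthoFrame.flip (hb : IsOrthoFrame γ b L) :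
    IsOrthoFrame γ (flipBasis b) (flipMatrix L) := by
  refine ⟨fun i j ↦ ?_, fun x y k ↦ ?_⟩
  · rw [hb.inner_eq]
    simp only [flipBasis_apply, map_smul, Finsupp.smul_apply, Module.Basis.repr_self, smul_eq_mul]
    fin_cases i <;> fin_cases j <;> simp [flipSign, Fin.sum_univ_three]
  · rw [flipBasis_repr, hb.bracket]
    simp only [milnorBracket, flipBasis_repr, flipMatrix]
    fin_cases k <;> simp [flipSign] <;> ring

theorem flipBasis_det (b : Module.Basis (Fin 3) ℝ (GroupLieAlgebra I3 X))
    (x y z : GroupLieAlgebra I3 X) : (flipBasis b).det ![x, y, z] = b.det ![x, y, z] := by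
  rw [det_eq_tripleProduct, det_eq_tripleProduct]
  simp only [tripleProduct, flipBasis_repr, flipSign, Matrix.cons_val_zero, Matrix.cons_val_one,
    Matrix.cons_val]
  ring

theorem pot_flipMatrix (L : Fin 3 → Fin 3 → ℝ) (H : ℝ) {q : ℂ} (hq : q ≠ 0) :
    pot (flipMatrix L) H q = (q * conj q) ^ 2 * pot L H q⁻¹ := by
  have hc : conj q ≠ 0 := by simpa using hq
  simp only [pot, potPoly, flipMatrix, flipSign, axial, sphereVec, Fin.sum_univ_three,
    Matrix.cons_val_zero, Matrix.cons_val_one, Matrix.cons_val, map_inv₀]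
  push_cast
  generalize conj q = c at *
  field_simp
  ring

theorem tendsto_pot_div (L : Fin 3 → Fin 3 → ℝ) (H : ℝ) :
    Tendsto (fun q : ℂ ↦ pot L H q / ‖q‖ ^ 4) (cocompact ℂ) (𝓝 (pot (flipMatrix L) H 0)) := by
  have hinv : Tendsto (fun q : ℂ ↦ q⁻¹) (cocompact ℂ) (𝓝 0) := by
    rw [← Metric.cobounded_eq_cocompact]
    exact tendsto_inv₀_cobounded
  have hne : ∀ᶠ q : ℂ in cocompact ℂ, q ≠ 0 := by
    rw [← Metric.cobounded_eq_cocompact]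
    exact Bornology.eventually_ne_cobounded 0
  refine (((contDiff_pot (flipMatrix L) H).continuous.tendsto 0).comp hinv).congr'
    (hne.mono fun q hq ↦ ?_)
  have hc : conj q ≠ 0 := by simpa using hq
  change pot (flipMatrix L) H q⁻¹ = pot L H q / (‖q‖ : ℂ) ^ 4
  rw [pot_flipMatrix L H (inv_ne_zero hq), norm_pow_four_eq, inv_inv, map_inv₀]
  field_simp

theorem potentialAtInfinity_pot (L : Fin 3 → Fin 3 → ℝ) (H : ℝ) :
    potentialAtInfinity (pot L H) = pot (flipMatrix L) H := by
  ext h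
  rw [potentialAtInfinity]
  split_ifs with h0
  · rw [h0]
    exact (tendsto_pot_div L H).limUnder_eq
  · rw [pot_flipMatrix L H h0, norm_pow_four_eq]

theorem potentialVanishesAt_infty_iff (L : Fin 3 → Fin 3 → ℝ) (H : ℝ) :
    PotentialVanishesAt (pot L H) OnePoint.infty ↔ pot (flipMatrix L) H 0 = 0 :=
  ⟨fun h ↦ tendsto_nhds_unique (tendsto_pot_div L H) h, fun h ↦ by
    have := tendsto_pot_div L H
    rw [h] at this
    exact this⟩

/-- The basis adapted to a point of the sphere: its stereographic projection is the affine
coordinate around that point. -/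
def adaptedBasis (b : Module.Basis (Fin 3) ℝ (GroupLieAlgebra I3 X)) :
    OnePoint ℂ → Module.Basis (Fin 3) ℝ (GroupLieAlgebra I3 X)
  | .infty => flipBasis b
  | .some _ => b

/-- The bracket in the adapted basis. -/
def adaptedMatrix (L : Fin 3 → Fin 3 → ℝ) : OnePoint ℂ → Fin 3 → Fin 3 → ℝ
  | .infty => flipMatrix L
  | .some _ => L

theorem IsOrthoFrame.adapted (hb : IsOrthoFrame γ b L) (q₀ : OnePoint ℂ) :
    IsOrthoFrame γ (adaptedBasis b q₀) (adaptedMatrix L q₀) :=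
  match q₀ with
  | .infty => hb.flip
  | .some _ => hb

theorem potentialCoord_pot (L : Fin 3 → Fin 3 → ℝ) (H : ℝ) (q₀ : OnePoint ℂ) :
    potentialCoord (pot L H) q₀ = pot (adaptedMatrix L q₀) H :=
  match q₀ with
  | .infty => potentialAtInfinity_pot L H
  | .some _ => rfl

theorem pot_adaptedMatrix_ne_zero {q₀ : OnePoint ℂ} (h : ¬ PotentialVanishesAt (pot L H) q₀) :
    pot (adaptedMatrix L q₀) H (sphereCoord q₀ q₀) ≠ 0 :=
  match q₀ with
  | .infty => fun h' ↦ h ((potentialVanishesAt_infty_iff L H).2 h')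
  | .some _ => h

theorem isHSurfaceAt_adaptedBasis_iff (q₀ : OnePoint ℂ) {F : ℂ → X} {ν : GroupLieAlgebra I3 X}
    {w : ℂ} : IsHSurfaceAt γ (adaptedBasis b q₀) H F ν w ↔ IsHSurfaceAt γ b H F ν w :=
  match q₀ with
  | .infty => ⟨fun h ↦ ⟨h.1, h.2, h.3, h.4, flipBasis_det b _ _ _ ▸ h.5, h.6⟩,
      fun h ↦ ⟨h.1, h.2, h.3, h.4, (flipBasis_det b _ _ _).symm ▸ h.5, h.6⟩⟩
  | .some _ => Iff.rfl

/-- The unit vector with given stereographic projection. -/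
def invStereo (b : Module.Basis (Fin 3) ℝ (GroupLieAlgebra I3 X)) :
    OnePoint ℂ → GroupLieAlgebra I3 X
  | .infty => -b 2
  | .some q => ∑ k, sphereVecReal q k • b k

/-- The domain of the affine coordinate of the sphere around `q₀`. -/
def sphereDomain (q₀ : OnePoint ℂ) : Set (OnePoint ℂ) :=
  match q₀ with
  | .infty => {q | q ≠ ((0 : ℂ) : OnePoint ℂ)}
  | .some _ => {q | q ≠ OnePoint.infty}

theorem isOpen_sphereDomain (q₀ : OnePoint ℂ) : IsOpen (sphereDomain q₀) :=
  match q₀ with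
  | .infty => isOpen_ne
  | .some _ => isOpen_ne

theorem mem_sphereDomain_self (q₀ : OnePoint ℂ) : q₀ ∈ sphereDomain q₀ :=
  match q₀ with
  | .infty => OnePoint.infty_ne_coe 0
  | .some q => OnePoint.coe_ne_infty q

theorem invStereo_coe_repr (b : Module.Basis (Fin 3) ℝ (GroupLieAlgebra I3 X)) (q : ℂ) (k : Fin 3) :
    b.repr (invStereo b (q : OnePoint ℂ)) k = sphereVecReal q k :=
  b.repr_sum_self (sphereVecReal q) ▸ rfl

theorem invStereo_infty_repr (b : Module.Basis (Fin 3) ℝ (GroupLieAlgebra I3 X)) (k : Fin 3) :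
    b.repr (invStereo b OnePoint.infty) k = ![0, 0, -1] k := by
  change b.repr (-b 2) k = _
  rw [map_neg, Finsupp.neg_apply, Module.Basis.repr_self]
  fin_cases k <;> simp

theorem sphereVecReal_inv {q : ℂ} (hq : q ≠ 0) (k : Fin 3) :
    sphereVecReal q⁻¹ k = flipSign k * sphereVecReal q k := by
  have h0 : normSq q ≠ 0 := (normSq_pos.2 hq).ne'
  have h1 : 1 + normSq q ≠ 0 := by linarith [normSq_nonneg q]
  have h2 : (1 + (normSq q)⁻¹)⁻¹ = normSq q * (1 + normSq q)⁻¹ := by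
    rw [show 1 + (normSq q)⁻¹ = (1 + normSq q) * (normSq q)⁻¹ by field_simp; ring, mul_inv, inv_inv,
      mul_comm]
  simp only [sphereVecReal_apply, map_inv₀, inv_re, inv_im, flipSign, div_eq_mul_inv, h2]
  fin_cases k
  · simp
    field_simp
  · simp
    field_simp
  · simp
    field_simp
    ring

theorem adaptedBasis_repr_invStereo (b : Module.Basis (Fin 3) ℝ (GroupLieAlgebra I3 X))
    {q₀ q : OnePoint ℂ} (h : q ∈ sphereDomain q₀) (k : Fin 3) :
    (adaptedBasis b q₀).repr (invStereo b q) k = sphereVecReal (sphereCoord q₀ q) k := by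
  induction q₀ using OnePoint.rec with
  | infty =>
    change (flipBasis b).repr _ k = _
    rw [flipBasis_repr]
    induction q using OnePoint.rec with
    | infty =>
      rw [invStereo_infty_repr]
      change _ = sphereVecReal 0 k
      rw [sphereVecReal_apply]
      fin_cases k <;> simp [flipSign]
    | coe q =>
      rw [invStereo_coe_repr]
      exact (sphereVecReal_inv (fun h0 ↦ h (by rw [h0])) k).symm
  | coe q₀ =>
    induction q using OnePoint.rec with
    | infty => exact absurd rfl h
    | coe q => exact invStereo_coe_repr b q k

/-- A point whose unit vector is not the south pole of the adapted basis lies in the domain of the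
affine coordinate. -/
theorem mem_sphereDomain_of_repr (b : Module.Basis (Fin 3) ℝ (GroupLieAlgebra I3 X))
    {q₀ q : OnePoint ℂ} (h : (adaptedBasis b q₀).repr (invStereo b q) 2 ≠ -1) :
    q ∈ sphereDomain q₀ := by
  induction q₀ using OnePoint.rec with
  | infty =>
    rintro rfl
    refine h ?_
    change (flipBasis b).repr _ 2 = _
    rw [flipBasis_repr, invStereo_coe_repr, sphereVecReal_apply]
    simp [flipSign]
  | coe q₀ =>
    rintro rfl
    refine h ?_
    change b.repr _ 2 = _
    rw [invStereo_infty_repr]; rfl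

theorem stereographic_invStereo (b : Module.Basis (Fin 3) ℝ (GroupLieAlgebra I3 X))
    (q : OnePoint ℂ) : stereographic b (invStereo b q) = q := by
  induction q using OnePoint.rec with
  | infty =>
    rw [stereographic, if_pos]
    rw [invStereo_infty_repr]; rfl
  | coe q =>
    rw [stereographic, if_neg]
    · simp only [invStereo_coe_repr]
      exact congrArg _ (stereo_sphereVecReal q)
    · rw [invStereo_coe_repr]
      exact sphereVecReal_two_ne q

theorem invStereo_stereographic (b : Module.Basis (Fin 3) ℝ (GroupLieAlgebra I3 X))
    {ν : GroupLieAlgebra I3 X} (hν : ∑ k, b.repr ν k * b.repr ν k = 1) :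
    invStereo b (stereographic b ν) = ν := by
  refine b.repr.injective (Finsupp.ext fun k ↦ ?_)
  rw [stereographic]
  split_ifs with h
  · rw [invStereo_infty_repr]
    simp only [Fin.sum_univ_three, h] at hν
    have n0 : b.repr ν 0 = 0 := pow_eq_zero_iff two_ne_zero |>.1
      (by linarith [sq_nonneg (b.repr ν 0), mul_self_nonneg (b.repr ν 1)])
    have n1 : b.repr ν 1 = 0 := pow_eq_zero_iff two_ne_zero |>.1
      (by linarith [mul_self_nonneg (b.repr ν 0), sq_nonneg (b.repr ν 1)])
    fin_cases k
    · exact n0.symm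
    · exact n1.symm
    · exact h.symm
  · rw [invStereo_coe_repr]
    exact congrFun (sphereVecReal_stereo hν h) k

end Canonical

/-! ### Surfaces with a given map to the sphere, locally -/

section Planar

open Complex Filter

local notation "conj" => starRingEnd ℂ

variable {X : Type*} [TopologicalSpace X] [ChartedSpace E3 X] [Group X] [LieGroup I3 ∞ X]
  {γ : LeftInvariantMetric X} {e : Module.Basis (Fin 3) ℝ (GroupLieAlgebra I3 X)}
  {L : Fin 3 → Fin 3 → ℝ} {H : ℝ} {F F₁ F₂ : ℂ → X} {G : ℂ → OnePoint ℂ} {w₀ : ℂ}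

/-- The map `G` to the sphere solves the Gauss map equation at `w`, with `G_z ≠ 0`, in the affine
coordinate around `G w`. -/
structure IsRegularSolutionAt (R : ℂ → ℂ) (G : ℂ → OnePoint ℂ) (w : ℂ) : Prop where
  smooth : ContDiffAt ℝ ∞ (sphereCoord (G w) ∘ G) w
  equation : GaussEquationAt (potentialCoord R (G w)) (sphereCoord (G w) ∘ G) w
  dz_ne : dz (sphereCoord (G w) ∘ G) w ≠ 0

/-- The map `G` to the sphere solves the system with Weierstrass datum `ζ` at `w`, in the affine
coordinate around `q₀`. -/
structure SolvesSystemAt (L : Fin 3 → Fin 3 → ℝ) (H : ℝ) (q₀ : OnePoint ℂ) (G : ℂ → OnePoint ℂ)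
    (ζ : ℂ → ℂ) (w : ℂ) : Prop where
  mem : G w ∈ sphereDomain q₀
  datum_ne : ζ w ≠ 0
  smooth : ContDiffAt ℝ ∞ (sphereCoord q₀ ∘ G) w
  smooth_datum : ContDiffAt ℝ ∞ ζ w
  system : WeierstrassSystemAt (adaptedMatrix L q₀) H (sphereCoord q₀ ∘ G) ζ w

theorem WeierstrassSystemAt.congr {u u' ζ ζ' : ℂ → ℂ} {w : ℂ} (h : WeierstrassSystemAt L H u ζ w)
    (hu : u' =ᶠ[𝓝 w] u) (hζ : ζ' =ᶠ[𝓝 w] ζ) : WeierstrassSystemAt L H u' ζ' w := by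
  have h1 : fderiv ℝ u' w = fderiv ℝ u w := hu.fderiv_eq
  have h2 : fderiv ℝ ζ' w = fderiv ℝ ζ w := hζ.fderiv_eq
  obtain ⟨h3, h4⟩ := h
  refine ⟨?_, ?_⟩
  · rw [dz, h1, ← dz, hu.self_of_nhds, hζ.self_of_nhds, h3]
  · rw [dzbar, h2, ← dzbar, hu.self_of_nhds, hζ.self_of_nhds, h4]

/-- The Gauss map of an `H`-surface solves the system, and determines the logarithmic derivative up
to the Weierstrass datum. -/
theorem solvesSystemAt_of_isHSurfaceAt (he : IsOrthoFrame γ e L)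
    (h : ∀ᶠ w in 𝓝 w₀, IsHSurfaceAt γ e H F (invStereo e (G w)) w) :
    ∃ ζ : ℂ → ℂ, ∀ᶠ w in 𝓝 w₀, SolvesSystemAt L H (G w₀) G ζ w ∧
      ∀ k, logForm (adaptedBasis e (G w₀)) F k w =
        weierstrassForm ζ (sphereCoord (G w₀) ∘ G) k w := by
  set b := adaptedBasis e (G w₀) with hb
  have hrepr : ∀ w, G w ∈ sphereDomain (G w₀) →
      (⇑(b.repr (invStereo e (G w))) : Fin 3 → ℝ) = sphereVecReal (sphereCoord (G w₀) (G w)) :=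
    fun w hw ↦ funext (adaptedBasis_repr_invStereo e hw)
  have h' : ∀ᶠ w in 𝓝 w₀, IsHSurfaceAt γ b H F (invStereo e (G w)) w :=
    h.mono fun w hw ↦ (isHSurfaceAt_adaptedBasis_iff _).2 hw
  have h2 : b.repr (invStereo e (G w₀)) 2 ≠ -1 := by
    rw [hrepr w₀ (mem_sphereDomain_self _)]
    exact sphereVecReal_two_ne _
  have key := weierstrassSystemAt_of_isHSurfaceAt (he.adapted (G w₀)) h' h2
  have hu : ∀ᶠ w in 𝓝 w₀, G w ∈ sphereDomain (G w₀) ∧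
      (sphereCoord (G w₀) ∘ G) w = stereo (b.repr (invStereo e (G w))) := by
    filter_upwards [key] with w hw
    have hm := mem_sphereDomain_of_repr e hw.1
    exact ⟨hm, by rw [hrepr w hm, stereo_sphereVecReal]; rfl⟩
  refine ⟨weierstrassDatum b F, ?_⟩
  filter_upwards [key, hu.eventually_nhds] with w hw hw'
  have e1 : (sphereCoord (G w₀) ∘ G) =ᶠ[𝓝 w] fun w ↦ stereo (b.repr (invStereo e (G w))) :=
    hw'.mono fun w h ↦ h.2
  obtain ⟨-, k1, k2, k3, k4, k5⟩ := hw
  refine ⟨⟨hw'.self_of_nhds.1, k1, k2.congr_of_eventuallyEq e1, k3,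
    k5.congr e1 EventuallyEq.rfl⟩, fun k ↦ eq_weierstrassForm ?_⟩
  rw [k4 k, hw'.self_of_nhds.2]

/-- The surface defined by a solution of the system is an `H`-surface. -/
theorem SolvesSystemAt.isHSurfaceAt (he : IsOrthoFrame γ e L) {q₀ : OnePoint ℂ} {ζ : ℂ → ℂ}
    {w : ℂ} (h : SolvesSystemAt L H q₀ G ζ w) (hF : ContMDiffAt 𝓘(ℝ, ℂ) I3 ∞ F w)
    (hl : ∀ᶠ w' in 𝓝 w, ∀ k, logForm (adaptedBasis e q₀) F k w' =
      weierstrassForm ζ (sphereCoord q₀ ∘ G) k w') :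
    IsHSurfaceAt γ e H F (invStereo e (G w)) w :=
  (isHSurfaceAt_adaptedBasis_iff q₀).1 (h.system.isHSurfaceAt (he.adapted q₀)
    (h.smooth_datum.differentiableAt (by simp)) (h.smooth.differentiableAt (by simp)) h.datum_ne hF
    hl (adaptedBasis_repr_invStereo e h.mem))

theorem exists_isHSurfaceAt_of_solvesSystemAt (he : IsOrthoFrame γ e L) {q₀ : OnePoint ℂ}
    {ζ : ℂ → ℂ} (h : ∀ᶠ w in 𝓝 w₀, SolvesSystemAt L H q₀ G ζ w) :
    ∃ F : ℂ → X, ∀ᶠ w in 𝓝 w₀, IsHSurfaceAt γ e H F (invStereo e (G w)) w := by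
  obtain ⟨F, -, hF⟩ := exists_logForm_eq (adaptedBasis e q₀) (1 : X)
    (h.mono fun w hw k ↦ contDiffAt_weierstrassForm hw.smooth_datum hw.smooth k)
    (h.mono fun w hw v v' l ↦ hw.system.maurerCartan_eq_zero (he.adapted q₀) hw.smooth_datum
      hw.smooth v v' l)
  refine ⟨F, ?_⟩
  filter_upwards [h, hF.eventually_nhds] with w h1 h2
  exact h1.isHSurfaceAt he h2.self_of_nhds.1 (h2.mono fun w' h ↦ h.2)

/-- The parametrization of the sphere by the affine coordinate around `q₀`. -/
def sphereParam : OnePoint ℂ → ℂ → OnePoint ℂ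
  | .infty => fun x ↦ if x = 0 then OnePoint.infty else ((x⁻¹ : ℂ) : OnePoint ℂ)
  | .some _ => fun x ↦ x

theorem sphereParam_sphereCoord {q₀ q : OnePoint ℂ} (h : q ∈ sphereDomain q₀) :
    sphereParam q₀ (sphereCoord q₀ q) = q := by
  induction q₀ using OnePoint.rec with
  | infty =>
    induction q using OnePoint.rec with
    | infty => exact if_pos rfl
    | coe q =>
      have hq : q ≠ 0 := fun h0 ↦ h (by rw [h0])
      change (if q⁻¹ = 0 then OnePoint.infty else ((q⁻¹⁻¹ : ℂ) : OnePoint ℂ)) = q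
      rw [if_neg (inv_ne_zero hq), inv_inv]
  | coe q₀ =>
    induction q using OnePoint.rec with
    | infty => exact absurd rfl h
    | coe q => rfl

theorem continuousAt_sphereParam (q₀ : OnePoint ℂ) :
    ContinuousAt (sphereParam q₀) (sphereCoord q₀ q₀) := by
  induction q₀ using OnePoint.rec with
  | infty =>
    change ContinuousAt (fun x : ℂ ↦ if x = 0 then OnePoint.infty else ((x⁻¹ : ℂ) : OnePoint ℂ)) 0
    rw [← continuousWithinAt_compl_self, ContinuousWithinAt, if_pos rfl]
    have h1 : Tendsto (fun x : ℂ ↦ x⁻¹) (𝓝[≠] 0) (coclosedCompact ℂ) := by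
      rw [coclosedCompact_eq_cocompact, ← Metric.cobounded_eq_cocompact]
      exact tendsto_inv₀_nhdsNE_zero
    refine (OnePoint.tendsto_coe_infty.comp h1).congr' ?_
    filter_upwards [self_mem_nhdsWithin] with x hx
    exact (if_neg hx).symm
  | coe q₀ => exact OnePoint.continuous_coe.continuousAt

theorem SolvesSystemAt.continuousAt {ζ : ℂ → ℂ}
    (h : ∀ᶠ w in 𝓝 w₀, SolvesSystemAt L H (G w₀) G ζ w) : ContinuousAt G w₀ := by
  have h1 : ContinuousAt (sphereParam (G w₀) ∘ (sphereCoord (G w₀) ∘ G)) w₀ :=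
    ContinuousAt.comp (continuousAt_sphereParam (G w₀)) h.self_of_nhds.smooth.continuousAt
  exact h1.congr (h.mono fun w hw ↦ sphereParam_sphereCoord hw.mem)

theorem SolvesSystemAt.isRegularSolutionAt {ζ : ℂ → ℂ}
    (h : ∀ᶠ w in 𝓝 w₀, SolvesSystemAt L H (G w₀) G ζ w)
    (hR : ¬ PotentialVanishesAt (pot L H) (G w₀)) : IsRegularSolutionAt (pot L H) G w₀ := by
  have hR' := pot_adaptedMatrix_ne_zero hR
  have h0 := h.self_of_nhds
  refine ⟨h0.smooth, ?_, ?_⟩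
  · rw [potentialCoord_pot]
    exact WeierstrassSystemAt.gaussEquationAt h0.smooth hR' (h.mono fun w hw ↦ hw.system)
  · rw [h0.system.1]
    exact mul_ne_zero hR' h0.datum_ne

/-- The Weierstrass datum is determined by the map to the sphere. -/
theorem SolvesSystemAt.eq_gaussDatum {ζ : ℂ → ℂ}
    (h : ∀ᶠ w in 𝓝 w₀, SolvesSystemAt L H (G w₀) G ζ w)
    (hR : ¬ PotentialVanishesAt (pot L H) (G w₀)) :
    ∀ᶠ w in 𝓝 w₀, ζ w = gaussDatum (adaptedMatrix L (G w₀)) H (sphereCoord (G w₀) ∘ G) w := by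
  have h1 : ContinuousAt (fun w ↦ pot (adaptedMatrix L (G w₀)) H ((sphereCoord (G w₀) ∘ G) w)) w₀ :=
    (contDiff_pot _ H).continuous.continuousAt.comp h.self_of_nhds.smooth.continuousAt
  filter_upwards [h, h1.eventually_ne (pot_adaptedMatrix_ne_zero hR)] with w h2 h3
  rw [gaussDatum, h2.system.1]
  field_simp

/-- Two `H`-surfaces with the same Gauss map differ by a left translation. -/
theorem eventually_eq_mul_of_isHSurfaceAt (he : IsOrthoFrame γ e L)
    (hR : ¬ PotentialVanishesAt (pot L H) (G w₀))
    (h₁ : ∀ᶠ w in 𝓝 w₀, IsHSurfaceAt γ e H F₁ (invStereo e (G w)) w)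
    (h₂ : ∀ᶠ w in 𝓝 w₀, IsHSurfaceAt γ e H F₂ (invStereo e (G w)) w) :
    ∀ᶠ w in 𝓝 w₀, F₂ w = F₂ w₀ * (F₁ w₀)⁻¹ * F₁ w := by
  obtain ⟨ζ₁, k₁⟩ := solvesSystemAt_of_isHSurfaceAt he h₁
  obtain ⟨ζ₂, k₂⟩ := solvesSystemAt_of_isHSurfaceAt he h₂
  refine eventually_eq_mul_of_logForm_eq (adaptedBasis e (G w₀)) h₁.self_of_nhds.smooth
    h₂.self_of_nhds.smooth ?_
  filter_upwards [k₁, k₂, SolvesSystemAt.eq_gaussDatum (k₁.mono fun _ h ↦ h.1) hR,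
    SolvesSystemAt.eq_gaussDatum (k₂.mono fun _ h ↦ h.1) hR] with w a₁ a₂ b₁ b₂ k
  rw [a₁.2, a₂.2, weierstrassForm, weierstrassForm, b₁, b₂]

theorem sphereCoord_infty_eq_inv (q : ℂ) (x : OnePoint ℂ) :
    sphereCoord OnePoint.infty x = (sphereCoord (q : OnePoint ℂ) x)⁻¹ := by
  induction x using OnePoint.rec with
  | infty => exact inv_zero.symm
  | coe x => rfl

/-- A regular solution of the Gauss map equation solves the system, also in the affine coordinate
around a nearby value. -/
theorem IsRegularSolutionAt.solvesSystemAt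
    (h : ∀ᶠ w in 𝓝 w₀, IsRegularSolutionAt (pot L H) G w) (hG : ContinuousAt G w₀)
    (hR : ∀ w, ¬ PotentialVanishesAt (pot L H) (G w)) :
    ∀ᶠ w in 𝓝 w₀, SolvesSystemAt L H (G w₀) G
      (gaussDatum (adaptedMatrix L (G w₀)) H (sphereCoord (G w₀) ∘ G)) w := by
  have hdom : ∀ᶠ w in 𝓝 w₀, G w ∈ sphereDomain (G w₀) :=
    hG.eventually ((isOpen_sphereDomain (G w₀)).mem_nhds (mem_sphereDomain_self (G w₀)))
  have hpot : ∀ᶠ w in 𝓝 w₀, pot (adaptedMatrix L (G w₀)) H ((sphereCoord (G w₀) ∘ G) w) ≠ 0 := by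
    have h1 : ContinuousAt (fun w ↦ pot (adaptedMatrix L (G w₀)) H ((sphereCoord (G w₀) ∘ G) w))
        w₀ := (contDiff_pot _ H).continuous.continuousAt.comp h.self_of_nhds.smooth.continuousAt
    exact h1.eventually_ne (pot_adaptedMatrix_ne_zero (hR w₀))
  suffices hs : ∀ᶠ w in 𝓝 w₀, ContDiffAt ℝ ∞ (sphereCoord (G w₀) ∘ G) w ∧
      GaussEquationAt (pot (adaptedMatrix L (G w₀)) H) (sphereCoord (G w₀) ∘ G) w ∧
      dz (sphereCoord (G w₀) ∘ G) w ≠ 0 by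
    filter_upwards [hdom, hpot, hs] with w h1 h2 h3
    exact ⟨h1, mul_ne_zero h3.2.2 (inv_ne_zero h2), h3.1, contDiffAt_gaussDatum h3.1 h2,
      weierstrassSystemAt_gaussDatum h3.1 h2 h3.2.1⟩
  filter_upwards [hdom, (hdom.and h).eventually_nhds, hpot] with w h1 h2 h3
  have hreg := h2.self_of_nhds.2
  -- where the two affine coordinates are different, the value is neither `0` nor `∞`
  have hsame : (G w = OnePoint.infty ↔ G w₀ = OnePoint.infty) →
      ContDiffAt ℝ ∞ (sphereCoord (G w₀) ∘ G) w ∧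
      GaussEquationAt (pot (adaptedMatrix L (G w₀)) H) (sphereCoord (G w₀) ∘ G) w ∧
      dz (sphereCoord (G w₀) ∘ G) w ≠ 0 := by
    intro hiff
    have e1 : sphereCoord (G w) = sphereCoord (G w₀) ∧ adaptedMatrix L (G w) =
        adaptedMatrix L (G w₀) := by
      generalize G w = q at *
      generalize G w₀ = q₀ at *
      induction q using OnePoint.rec with
      | infty => rw [hiff.1 rfl]; exact ⟨rfl, rfl⟩
      | coe q =>
        induction q₀ using OnePoint.rec with
        | infty => exact absurd (hiff.2 rfl) (OnePoint.coe_ne_infty q)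
        | coe q₀ => exact ⟨rfl, rfl⟩
    obtain ⟨k1, k2, k3⟩ := hreg
    rw [potentialCoord_pot] at k2
    rw [e1.1] at k1 k2 k3
    rw [e1.2] at k2
    exact ⟨k1, k2, k3⟩
  by_cases hw₀ : G w₀ = OnePoint.infty
  swap
  · refine hsame ⟨fun hw ↦ ?_, fun hw ↦ absurd hw hw₀⟩
    exfalso
    generalize G w₀ = q₀ at *
    induction q₀ using OnePoint.rec with
    | infty => exact hw₀ rfl
    | coe q₀ => exact h1 hw
  by_cases hw : G w = OnePoint.infty
  · exact hsame ⟨fun _ ↦ hw₀, fun _ ↦ hw⟩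
  rw [hw₀] at h1 h2 h3 ⊢
  obtain ⟨q, hq⟩ := OnePoint.ne_infty_iff_exists.1 hw
  have hq0 : q ≠ 0 := fun h0 ↦ h1 (by rw [← hq, h0])
  set v : ℂ → ℂ := sphereCoord (q : OnePoint ℂ) ∘ G with hv
  have hvw : v w = q := by rw [hv, Function.comp_apply, ← hq]; rfl
  have huv : sphereCoord OnePoint.infty ∘ G = fun w ↦ (v w)⁻¹ :=
    funext fun w ↦ sphereCoord_infty_eq_inv q (G w)
  have hvs : ContDiffAt ℝ ∞ v w := by
    have := hreg.smooth
    rwa [← hq] at this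
  -- near `w`, the values are finite and nonzero
  have hnear : ∀ᶠ w' in 𝓝 w, v w' ≠ 0 := hvs.continuousAt.eventually_ne (by rwa [hvw])
  have hsys : ∀ᶠ w' in 𝓝 w, WeierstrassSystemAt (flipMatrix L) H (fun w ↦ (v w)⁻¹)
      (fun w ↦ -1 * (gaussDatum L H v w * (conj (v w) * conj (v w)))) w' := by
    filter_upwards [hnear, h2] with w' n1 n2
    have n3 : G w' ≠ OnePoint.infty := fun h0 ↦ n1 (by
      rw [hv, Function.comp_apply, h0]; rfl)
    obtain ⟨q', hq'⟩ := OnePoint.ne_infty_iff_exists.1 n3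
    have r := n2.2
    have r1 := r.smooth
    have r2 := r.equation
    rw [← hq'] at r1 r2
    have r3 : v w' = q' := by rw [hv, Function.comp_apply, ← hq']; rfl
    have hR' : pot L H (v w') ≠ 0 := by
      have := hR w'
      rw [← hq'] at this
      rw [r3]
      exact this
    have s := weierstrassSystemAt_gaussDatum (u := v) r1 hR' r2
    exact s.inv (fun q hq ↦ pot_flipMatrix L H hq) (r1.differentiableAt (by simp))
      ((contDiffAt_gaussDatum (u := v) r1 hR').differentiableAt (by simp)) n1
  have hus : ContDiffAt ℝ ∞ (fun w ↦ (v w)⁻¹) w := hvs.inv hnear.self_of_nhds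
  rw [huv] at h3 ⊢
  refine ⟨hus, WeierstrassSystemAt.gaussEquationAt hus h3 hsys, ?_⟩
  rw [((hasWirtingerAt_of_differentiableAt (hvs.differentiableAt (by simp))).inv
    hnear.self_of_nhds).dz_eq]
  have hd := hreg.dz_ne
  rw [← hq] at hd
  exact div_ne_zero (neg_ne_zero.2 hd) (pow_ne_zero 2 hnear.self_of_nhds)

theorem leftLogDeriv_congr {F F' : ℂ → X} {w : ℂ} (h : F' =ᶠ[𝓝 w] F) (v : ℂ) :
    leftLogDeriv F' w v = leftLogDeriv F w v := by
  rw [leftLogDeriv_eq_iff]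
  have h1 : surfaceDeriv F' w v = surfaceDeriv F w v := by
    rw [surfaceDeriv, surfaceDeriv]
    exact congrArg (fun A : ℂ →L[ℝ] E3 ↦ A v) h.mfderiv_eq
  have h2 : mulInvariantVectorField (leftLogDeriv F w v) (F' w) =
      (mulInvariantVectorField (leftLogDeriv F w v) (F w) : E3) := by
    rw [h.self_of_nhds]
  rw [h2, h1]
  exact surfaceDeriv_eq F w v

/-- Being an `H`-surface is a condition on the logarithmic derivative. -/
theorem IsHSurfaceAt.congr {F F' : ℂ → X} {ν : GroupLieAlgebra I3 X} {w : ℂ}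
    (h : IsHSurfaceAt γ e H F ν w) (hF' : ContMDiffAt 𝓘(ℝ, ℂ) I3 ∞ F' w)
    (hl : ∀ᶠ w' in 𝓝 w, ∀ v, leftLogDeriv F' w' v = leftLogDeriv F w' v) :
    IsHSurfaceAt γ e H F' ν w := by
  have hw := hl.self_of_nhds
  have h1 : ∀ v v', firstForm γ F' w v v' = firstForm γ F w v v' := fun v v' ↦ by
    rw [firstForm_eq, firstForm_eq, hw, hw]
  have h2 : ∀ v v', secondForm γ F' ν w v v' = secondForm γ F ν w v v' := fun v v' ↦ by
    have h3 : (fun w' ↦ γ.metric.inner 1 (leftLogDeriv F' w' v') ν) =ᶠ[𝓝 w]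
        fun w' ↦ γ.metric.inner 1 (leftLogDeriv F w' v') ν := hl.mono fun w' h' ↦ by
      change γ.metric.inner 1 (leftLogDeriv F' w' v') ν = γ.metric.inner 1 (leftLogDeriv F w' v') ν
      rw [h' v']
    rw [secondForm, secondForm, h3.fderiv_eq, hw, hw]
  refine ⟨hF', ?_, ?_, fun v ↦ ?_, ?_, ?_⟩
  · obtain ⟨lam, hlam, hc⟩ := h.conformal
    exact ⟨lam, hlam, fun v ↦ (h1 v v).trans (hc v)⟩
  · rw [inner_mulInvariantVectorField, ← inner_mulInvariantVectorField γ (F w)]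
    exact h.unit
  · rw [surfaceDeriv_eq, inner_mulInvariantVectorField, hw,
      ← inner_mulInvariantVectorField γ (F w), ← surfaceDeriv_eq]
    exact h.normal v
  · rw [hw, hw]; exact h.oriented
  · rw [← h.curvature]
    simp only [meanCurvature, h1, h2]

theorem leftLogDeriv_comp {τ : ℂ → ℂ} {w : ℂ} (hF : MDifferentiableAt 𝓘(ℝ, ℂ) I3 F (τ w))
    (hτ : DifferentiableAt ℝ τ w) (v : ℂ) :
    leftLogDeriv (F ∘ τ) w v = leftLogDeriv F (τ w) (fderiv ℝ τ w v) := by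
  rw [leftLogDeriv, leftLogDeriv, surfaceDeriv, surfaceDeriv,
    mfderiv_comp w hF hτ.mdifferentiableAt, mfderiv_eq_fderiv]
  rfl

/-- Being an `H`-surface does not depend on the conformal parameter. -/
theorem IsHSurfaceAt.comp_analytic (he : IsOrthoFrame γ e L) {τ : ℂ → ℂ} {w₁ : ℂ}
    (hτ : AnalyticAt ℂ τ w₁) (hτ' : deriv τ w₁ ≠ 0) (hw₁ : τ w₁ = w₀)
    (h : ∀ᶠ w in 𝓝 w₀, IsHSurfaceAt γ e H F (invStereo e (G w)) w) :
    ∀ᶠ w in 𝓝 w₁, IsHSurfaceAt γ e H (F ∘ τ) (invStereo e ((G ∘ τ) w)) w := by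
  subst hw₁
  obtain ⟨ζ, hζ⟩ := solvesSystemAt_of_isHSurfaceAt he h
  set b := adaptedBasis e (G (τ w₁)) with hb
  have hd : ∀ᶠ w in 𝓝 w₁, AnalyticAt ℂ τ w := hτ.eventually_analyticAt
  have hne : ∀ᶠ w in 𝓝 w₁, deriv τ w ≠ 0 := hτ.deriv.continuousAt.eventually_ne hτ'
  have hD : ∀ w, AnalyticAt ℂ τ w → HasWirtingerAt τ (deriv τ w) 0 w := fun w hw ↦
    MetricLie.HasDerivAt.hasWirtingerAt hw.differentiableAt.hasDerivAt
  have hsm : ∀ w, AnalyticAt ℂ τ w → ContDiffAt ℝ ∞ τ w := fun w hw ↦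
    hw.contDiffAt.restrict_scalars ℝ
  have hsys : ∀ᶠ w in 𝓝 w₁, SolvesSystemAt L H (G (τ w₁)) (G ∘ τ)
      (fun w ↦ ζ (τ w) * deriv τ w) w := by
    filter_upwards [hτ.continuousAt.eventually hζ, hd, hne] with w k1 k2 k3
    have k := k1.1
    refine ⟨k.mem, mul_ne_zero k.datum_ne k3, k.smooth.comp w (hsm w k2),
      (k.smooth_datum.comp w (hsm w k2)).mul (k2.deriv.contDiffAt.restrict_scalars ℝ), ?_, ?_⟩
    · have := ((hasWirtingerAt_of_differentiableAt (k.smooth.differentiableAt (by simp))).comp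
        (hD w k2)).dz_eq
      simp only [map_zero, mul_zero, add_zero] at this
      refine this.trans ?_
      rw [k.system.1]
      exact mul_assoc _ _ _
    · have := (((hasWirtingerAt_of_differentiableAt (k.smooth_datum.differentiableAt
        (by simp))).comp (hD w k2)).mul (MetricLie.HasDerivAt.hasWirtingerAt
          k2.deriv.differentiableAt.hasDerivAt)).dzbar_eq
      simp only [mul_zero, zero_add, add_zero] at this
      refine this.trans ?_
      rw [k.system.2, map_mul]
      simp only [Function.comp_apply]
      ring
  have hlog : ∀ᶠ w in 𝓝 w₁, ∀ k, logForm b (F ∘ τ) k w =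
      weierstrassForm (fun w ↦ ζ (τ w) * deriv τ w) (sphereCoord (G (τ w₁)) ∘ (G ∘ τ)) k w := by
    filter_upwards [hτ.continuousAt.eventually (hζ.and h), hd] with w k1 k2 k
    ext1 v
    rw [logForm_apply, leftLogDeriv_comp (k1.2.smooth.mdifferentiableAt (by simp))
      (HasFDerivAt.differentiableAt (hD w k2)), ← logForm_apply, k1.1.2 k,
      HasFDerivAt.fderiv (hD w k2), weierstrassForm_apply, weierstrassForm_apply,
      wirtingerCLM_apply]
    congr 2
    simp only [Function.comp_apply]
    ring
  filter_upwards [hsys, hlog.eventually_nhds, hτ.continuousAt.eventually h, hd] with w k1 k2 k3 k4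
  exact k1.isHSurfaceAt he (k3.smooth.comp w (hsm w k4).contMDiffAt) k2

end Planar

/-! ### Global solutions on simply connected spaces -/

section Monodromy

open Filter

/-- A condition on group valued maps on a simply connected space, which is local and invariant under
left translations, and whose local solutions exist and are unique up to left translations, has
global solutions: the germs of solutions form a covering space. -/
theorem exists_global_solution {S A : Type*} [TopologicalSpace S] [SimplyConnectedSpace S]
    [LocallyPathConnectedSpace S] [Group A] {Sol : (S → A) → S → Prop}
    (hcongr : ∀ f f' p, Sol f p → f' =ᶠ[𝓝 p] f → Sol f' p)
    (hopen : ∀ f p, Sol f p → ∀ᶠ q in 𝓝 p, Sol f q)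
    (hmul : ∀ f p a, Sol f p → Sol (fun q ↦ a * f q) p)
    (hunique : ∀ f f' p, Sol f p → Sol f' p → ∃ a, ∀ᶠ q in 𝓝 p, f' q = a * f q)
    (hex : ∀ p, ∃ f, Sol f p) : ∃ f, ∀ p, Sol f p := by
  choose fam hfam using hex
  let _ : TopologicalSpace A := ⊥
  have _ : DiscreteTopology A := ⟨rfl⟩
  let Z : FiberBundleCore S S A :=
    { baseSet := fun i ↦ {q | Sol (fam i) q}
      isOpen_baseSet := fun i ↦ isOpen_iff_mem_nhds.2 fun q hq ↦ hopen _ _ hq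
      indexAt := id
      mem_baseSet_at := hfam
      coordChange := fun i j q x ↦ x * fam i q * (fam j q)⁻¹
      coordChange_self := fun i q _ x ↦ by group
      continuousOn_coordChange := fun i j ↦ by
        rintro ⟨q, x⟩ ⟨⟨hi, hj⟩, -⟩
        refine ContinuousAt.continuousWithinAt ?_
        obtain ⟨a, ha⟩ := hunique _ _ q hi hj
        have h1 : Continuous (fun p : S × A ↦ p.2 * a⁻¹) :=
          (continuous_of_discreteTopology (f := fun x : A ↦ x * a⁻¹)).comp continuous_snd
        refine h1.continuousAt.congr ?_
        have h2 : ∀ᶠ p : S × A in 𝓝 (q, x), fam j p.1 = a * fam i p.1 :=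
          (continuousAt_fst (p := (q, x))).eventually ha
        filter_upwards [h2] with p hp
        rw [hp]; group
      coordChange_comp := fun i j k q _ x ↦ by group }
  have hcov : IsCoveringMap Z.proj := IsFiberBundle.isCoveringMap fun q ↦ ⟨Z.localTriv q, hfam q⟩
  obtain ⟨p₀⟩ : Nonempty S := inferInstance
  obtain ⟨σ, ⟨-, hσ⟩, -⟩ := hcov.existsUnique_continuousMap_lifts (ContinuousMap.id S) p₀
    (⟨p₀, (1 : A)⟩ : Z.TotalSpace) rfl
  have hσ' : ∀ q, (σ q).1 = q := fun q ↦ congrFun hσ q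
  let sec : S → A := fun q ↦ (σ q).2
  refine ⟨fun q ↦ sec q * fam q q, fun p ↦ ?_⟩
  let x : S → A := fun q ↦ (Z.localTriv p (σ q)).2
  have hx : ∀ q, x q = sec q * fam q q * (fam p q)⁻¹ := fun q ↦ by
    have h1 : x q = sec q * fam (σ q).1 (σ q).1 * (fam p (σ q).1)⁻¹ := rfl
    rw [h1, hσ']
  have hc : ContinuousAt x p := by
    have h1 : ContinuousAt (Z.localTriv p) (σ p) := by
      refine (Z.localTriv p).continuousAt ?_
      change Sol (fam p) (σ p).1
      rw [hσ']
      exact hfam p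
    exact continuous_snd.continuousAt.comp (h1.comp σ.continuous.continuousAt)
  have hloc : ∀ᶠ q in 𝓝 p, x q = x p :=
    hc.eventually ((isOpen_discrete {x p}).mem_nhds rfl)
  refine hcongr _ _ p (hmul (fam p) p (x p) (hfam p)) (hloc.mono fun q hq ↦ ?_)
  change sec q * fam q q = x p * fam p q
  rw [← hq, hx]; group

/-- Two global solutions which agree locally up to left translations agree up to a left
translation. -/
theorem exists_eq_mul_of_eventually {S A : Type*} [TopologicalSpace S] [PreconnectedSpace S]
    [Nonempty S] [Group A] {f f' : S → A}
    (h : ∀ p, ∃ a, ∀ᶠ q in 𝓝 p, f' q = a * f q) : ∃ a, ∀ p, f' p = a * f p := by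
  have hl : IsLocallyConstant fun q ↦ f' q * (f q)⁻¹ := by
    rw [IsLocallyConstant.iff_eventually_eq]
    intro p
    obtain ⟨a, ha⟩ := h p
    filter_upwards [ha] with q hq
    rw [hq, ha.self_of_nhds]; group
  obtain ⟨p₀⟩ : Nonempty S := inferInstance
  refine ⟨f' p₀ * (f p₀)⁻¹, fun p ↦ ?_⟩
  rw [← hl.apply_eq_of_preconnectedSpace p p₀]; group

end Monodromy

/-! ### Surfaces parametrized by a Riemann surface -/

section RiemannSurface

open Complex Filter

variable {S : Type*} [TopologicalSpace S] [ChartedSpace ℂ S]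

/-- Biholomorphic maps are real diffeomorphisms. -/
theorem contDiffGroupoid_complex_le_real :
    contDiffGroupoid ω 𝓘(ℂ) ≤ contDiffGroupoid ∞ 𝓘(ℝ, ℂ) := by
  rw [contDiffGroupoid, contDiffGroupoid]
  refine groupoid_of_pregroupoid_le _ _ fun f s hfs ↦ ?_
  have h : ContDiffOn ℂ ω (𝓘(ℂ) ∘ f ∘ 𝓘(ℂ).symm) (𝓘(ℂ).symm ⁻¹' s ∩ Set.range 𝓘(ℂ)) := hfs
  exact (h.restrict_scalars ℝ).of_le le_top

theorem isManifold_real [IsManifold 𝓘(ℂ) ω S] : IsManifold 𝓘(ℝ, ℂ) ∞ S where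
  toHasGroupoid := hasGroupoid_of_le inferInstance contDiffGroupoid_complex_le_real

theorem conformalParameters_subset :
    conformalParameters S ⊆ IsManifold.maximalAtlas 𝓘(ℝ, ℂ) ∞ S :=
  StructureGroupoid.maximalAtlas_mono contDiffGroupoid_complex_le_real

variable {φ φ' : OpenPartialHomeomorph S ℂ} {p : S}

theorem analyticAt_transition (hφ : φ ∈ conformalParameters S) (hφ' : φ' ∈ conformalParameters S)
    (hp : p ∈ φ.source) (hp' : p ∈ φ'.source) : AnalyticAt ℂ (φ ∘ φ'.symm) (φ' p) := by
  have h := ((contDiffGroupoid ω 𝓘(ℂ)).compatible_of_mem_maximalAtlas hφ' hφ)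
  have h1 : ContDiffOn ℂ ω (φ ∘ φ'.symm) (φ'.symm.trans φ).source := by
    have h2 : ContDiffOn ℂ ω (𝓘(ℂ) ∘ (φ'.symm.trans φ) ∘ 𝓘(ℂ).symm)
      (𝓘(ℂ).symm ⁻¹' (φ'.symm.trans φ).source ∩ Set.range 𝓘(ℂ)) := h.1
    simpa using h2
  have hm : φ' p ∈ (φ'.symm.trans φ).source := by
    simp [hp, hp', φ'.map_source hp']
  refine DifferentiableOn.analyticAt (h1.differentiableOn (by simp))
    ((φ'.symm.trans φ).open_source.mem_nhds hm)

theorem deriv_transition_ne_zero (hφ : φ ∈ conformalParameters S)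
    (hφ' : φ' ∈ conformalParameters S) (hp : p ∈ φ.source) (hp' : p ∈ φ'.source) :
    deriv (φ ∘ φ'.symm) (φ' p) ≠ 0 := by
  have h1 := (analyticAt_transition hφ hφ' hp hp').differentiableAt.hasDerivAt
  have h2 := (analyticAt_transition hφ' hφ hp' hp).differentiableAt.hasDerivAt
  have e : (φ ∘ φ'.symm) (φ' p) = φ p := by simp [φ'.left_inv hp']
  rw [← e] at h2
  have h3 := h2.comp (φ' p) h1
  have h4 : (φ' ∘ φ.symm) ∘ (φ ∘ φ'.symm) =ᶠ[𝓝 (φ' p)] fun w ↦ w := by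
    have ht : φ'.target ∈ 𝓝 (φ' p) := φ'.open_target.mem_nhds (φ'.map_source hp')
    have hc : φ'.symm ⁻¹' φ.source ∈ 𝓝 (φ' p) := by
      refine (φ'.continuousAt_symm (φ'.map_source hp')).preimage_mem_nhds ?_
      rw [φ'.left_inv hp']
      exact φ.open_source.mem_nhds hp
    filter_upwards [ht, hc] with w hw hw'
    have hw'' : φ'.symm w ∈ φ.source := hw'
    simp [φ.left_inv hw'', φ'.right_inv hw]
  have h5 := h3.unique ((hasDerivAt_id' (φ' p)).congr_of_eventuallyEq h4)
  intro h0
  rw [h0, mul_zero] at h5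
  exact zero_ne_one h5

variable {X : Type*} [TopologicalSpace X] [ChartedSpace E3 X] [Group X] [LieGroup I3 ∞ X]
  {γ : LeftInvariantMetric X} {e : Module.Basis (Fin 3) ℝ (GroupLieAlgebra I3 X)}
  {L : Fin 3 → Fin 3 → ℝ} {H : ℝ} {f f' : S → X} {g : S → OnePoint ℂ}

/-- `f` is, near `p`, an `H`-surface with Gauss map `g`. -/
def IsSurfaceNear (γ : LeftInvariantMetric X)
    (e : Module.Basis (Fin 3) ℝ (GroupLieAlgebra I3 X)) (H : ℝ) (g : S → OnePoint ℂ) (f : S → X)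
    (p : S) : Prop :=
  ∀ᶠ w in 𝓝 (chartAt ℂ p p), IsHSurfaceAt γ e H (f ∘ (chartAt ℂ p).symm)
    (invStereo e ((g ∘ (chartAt ℂ p).symm) w)) w

theorem eventually_comp_chart_symm {P : S → Prop} (h : ∀ᶠ q in 𝓝 p, P q) :
    ∀ᶠ w in 𝓝 (chartAt ℂ p p), P ((chartAt ℂ p).symm w) := by
  have hc := (chartAt ℂ p).continuousAt_symm ((chartAt ℂ p).map_source (mem_chart_source ℂ p))
  rw [ContinuousAt, (chartAt ℂ p).left_inv (mem_chart_source ℂ p)] at hc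
  exact hc.eventually h

theorem IsSurfaceNear.congr (h : IsSurfaceNear γ e H g f p) (hf : f' =ᶠ[𝓝 p] f) :
    IsSurfaceNear γ e H g f' p := by
  filter_upwards [h, (eventually_comp_chart_symm hf).eventually_nhds] with w h1 h2
  exact h1.congr (h1.smooth.congr_of_eventuallyEq h2)
    (h2.eventually_nhds.mono fun w' h' v ↦ leftLogDeriv_congr h' v)

theorem IsSurfaceNear.mul_left (h : IsSurfaceNear γ e H g f p) (a : X) :
    IsSurfaceNear γ e H g (fun q ↦ a * f q) p := by
  filter_upwards [h.eventually_nhds] with w h1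
  have hm := contMDiff_mul_left (I := I3) (n := ∞) (a := a)
  exact h1.self_of_nhds.congr (hm.contMDiffAt.comp w h1.self_of_nhds.smooth)
    (h1.mono fun w' h' v ↦ leftLogDeriv_mul_left (h'.smooth.mdifferentiableAt (by simp)) a v)

theorem IsSurfaceNear.eventually_eq_mul (he : IsOrthoFrame γ e L)
    (hR : ¬ PotentialVanishesAt (pot L H) (g p)) (h : IsSurfaceNear γ e H g f p)
    (h' : IsSurfaceNear γ e H g f' p) : ∃ a, ∀ᶠ q in 𝓝 p, f' q = a * f q := by
  have hl := (chartAt ℂ p).left_inv (mem_chart_source ℂ p)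
  have key := eventually_eq_mul_of_isHSurfaceAt he (by simpa [hl] using hR) h h'
  refine ⟨f' p * (f p)⁻¹, ?_⟩
  have h1 := ((chartAt ℂ p).continuousAt (mem_chart_source ℂ p)).eventually key
  filter_upwards [h1, (chartAt ℂ p).open_source.mem_nhds (mem_chart_source ℂ p)] with q hq hq'
  simpa [(chartAt ℂ p).left_inv hq', hl] using hq

variable [IsManifold 𝓘(ℂ) ω S]

theorem contMDiffAt_iff_comp_symm (hφ : φ ∈ conformalParameters S) (hp : p ∈ φ.source) :
    ContMDiffAt 𝓘(ℝ, ℂ) I3 ∞ f p ↔ ContMDiffAt 𝓘(ℝ, ℂ) I3 ∞ (f ∘ φ.symm) (φ p) := by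
  have _ : IsManifold 𝓘(ℝ, ℂ) ∞ S := isManifold_real
  have hφr := conformalParameters_subset hφ
  constructor
  · intro h
    rw [← φ.left_inv hp] at h
    exact h.comp (φ p) (contMDiffAt_symm_of_mem_maximalAtlas hφr (φ.map_source hp))
  · intro h
    refine (h.comp p (contMDiffAt_of_mem_maximalAtlas hφr hp)).congr_of_eventuallyEq ?_
    filter_upwards [φ.open_source.mem_nhds hp] with q hq
    simp [φ.left_inv hq]

theorem eventually_isHSurfaceAt_of_chart (he : IsOrthoFrame γ e L) (hφ : φ ∈ conformalParameters S)
    (hφ' : φ' ∈ conformalParameters S) (hp : p ∈ φ.source) (hp' : p ∈ φ'.source)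
    (h : ∀ᶠ w in 𝓝 (φ p), IsHSurfaceAt γ e H (f ∘ φ.symm) (invStereo e ((g ∘ φ.symm) w)) w) :
    ∀ᶠ w in 𝓝 (φ' p), IsHSurfaceAt γ e H (f ∘ φ'.symm) (invStereo e ((g ∘ φ'.symm) w)) w := by
  have key := IsHSurfaceAt.comp_analytic he (analyticAt_transition hφ hφ' hp hp')
    (deriv_transition_ne_zero hφ hφ' hp hp') (by simp [φ'.left_inv hp']) h
  have hc : φ'.symm ⁻¹' φ.source ∈ 𝓝 (φ' p) := by
    refine (φ'.continuousAt_symm (φ'.map_source hp')).preimage_mem_nhds ?_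
    rw [φ'.left_inv hp']
    exact φ.open_source.mem_nhds hp
  have heq : ∀ᶠ w in 𝓝 (φ' p), φ.symm ((φ ∘ φ'.symm) w) = φ'.symm w := by
    filter_upwards [hc] with w hw
    exact φ.left_inv hw
  filter_upwards [key, heq.eventually_nhds] with w h1 h2
  have h3 : f ∘ φ'.symm =ᶠ[𝓝 w] (f ∘ φ.symm) ∘ (φ ∘ φ'.symm) := h2.mono fun w' h' ↦
    congrArg f h'.symm
  have h4 : (g ∘ φ'.symm) w = ((g ∘ φ.symm) ∘ (φ ∘ φ'.symm)) w :=
    congrArg g h2.self_of_nhds.symm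
  rw [h4]
  exact h1.congr (h1.smooth.congr_of_eventuallyEq h3)
    (h3.eventually_nhds.mono fun w' h' v ↦ leftLogDeriv_congr h' v)

theorem isSurfaceNear_iff (he : IsOrthoFrame γ e L) (hφ : φ ∈ conformalParameters S)
    (hp : p ∈ φ.source) : IsSurfaceNear γ e H g f p ↔
      ∀ᶠ w in 𝓝 (φ p), IsHSurfaceAt γ e H (f ∘ φ.symm) (invStereo e ((g ∘ φ.symm) w)) w :=
  ⟨fun h ↦ eventually_isHSurfaceAt_of_chart he (IsManifold.chart_mem_maximalAtlas p) hφ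
      (mem_chart_source ℂ p) hp h,
    fun h ↦ eventually_isHSurfaceAt_of_chart he hφ (IsManifold.chart_mem_maximalAtlas p) hp
      (mem_chart_source ℂ p) h⟩

theorem IsSurfaceNear.eventually (he : IsOrthoFrame γ e L) (h : IsSurfaceNear γ e H g f p) :
    ∀ᶠ q in 𝓝 p, IsSurfaceNear γ e H g f q := by
  have h1 := ((chartAt ℂ p).continuousAt (mem_chart_source ℂ p)).eventually h.eventually_nhds
  filter_upwards [h1, (chartAt ℂ p).open_source.mem_nhds (mem_chart_source ℂ p)] with q hq hq'
  exact (isSurfaceNear_iff he (IsManifold.chart_mem_maximalAtlas p) hq').2 hq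

/-- Being an `H`-surface with Gauss map `g` is a local condition. -/
theorem isHSurface_and_hasGaussMap_iff (he : IsOrthoFrame γ e L) :
    (IsHSurface γ e H f ∧ HasGaussMap γ e f g) ↔ ∀ p, IsSurfaceNear γ e H g f p := by
  constructor
  · rintro ⟨⟨⟨hs, hc⟩, G₁, hG₁, hH⟩, G₂, hG₂, hg⟩ p
    have hall : ∀ φ ∈ conformalParameters S, ∀ q ∈ φ.source,
        IsHSurfaceAt γ e H (f ∘ φ.symm) (invStereo e (g q)) (φ q) := by
      intro φ hφ q hq
      have hsm := (contMDiffAt_iff_comp_symm hφ hq).1 (hs q)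
      have hcf := hc φ hφ (φ q) (φ.map_source hq)
      have k₁ : IsHSurfaceAt γ e H (f ∘ φ.symm) (G₁ q) (φ q) := by
        obtain ⟨a1, a2, a3⟩ := hG₁ φ hφ q hq
        exact ⟨hsm, hcf, a1, a2, a3, hH φ hφ q hq⟩
      have k₂ : IsHSurfaceAt γ e (meanCurvature γ (f ∘ φ.symm) (G₂ q) (φ q)) (f ∘ φ.symm) (G₂ q)
          (φ q) := by
        obtain ⟨a1, a2, a3⟩ := hG₂ φ hφ q hq
        exact ⟨hsm, hcf, a1, a2, a3, rfl⟩
      rw [hg q, ← k₁.normal_unique he k₂, invStereo_stereographic e (k₁.unit_repr he)]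
      exact k₁
    have ht := (chartAt ℂ p).open_target.mem_nhds ((chartAt ℂ p).map_source (mem_chart_source ℂ p))
    filter_upwards [ht] with w hw
    have := hall _ (IsManifold.chart_mem_maximalAtlas p) _ ((chartAt ℂ p).map_target hw)
    rwa [(chartAt ℂ p).right_inv hw] at this
  · intro h
    have hall : ∀ φ ∈ conformalParameters S, ∀ q ∈ φ.source,
        IsHSurfaceAt γ e H (f ∘ φ.symm) (invStereo e (g q)) (φ q) := by
      intro φ hφ q hq
      have := ((isSurfaceNear_iff he hφ hq).1 (h q)).self_of_nhds
      rwa [Function.comp_apply, φ.left_inv hq] at this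
    have hG : IsLeftGaussMap γ e f fun q ↦ invStereo e (g q) := fun φ hφ q hq ↦
      ⟨(hall φ hφ q hq).unit, (hall φ hφ q hq).normal, (hall φ hφ q hq).oriented⟩
    refine ⟨⟨⟨fun q ↦ ?_, fun φ hφ w hw ↦ ?_⟩, _, hG, fun φ hφ q hq ↦ (hall φ hφ q hq).curvature⟩,
      _, hG, fun q ↦ (stereographic_invStereo e (g q)).symm⟩
    · exact (contMDiffAt_iff_comp_symm (IsManifold.chart_mem_maximalAtlas q)
        (mem_chart_source ℂ q)).2 (hall _ (IsManifold.chart_mem_maximalAtlas q) q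
          (mem_chart_source ℂ q)).smooth
    · have := (hall φ hφ _ (φ.map_target hw)).conformal
      rwa [φ.right_inv hw] at this

/-- Local existence. -/
theorem exists_isSurfaceNear (he : IsOrthoFrame γ e L)
    (hR : ∀ q, ¬ PotentialVanishesAt (pot L H) (g q)) (hg : SolvesGaussEquation (pot L H) g)
    (hz : NowhereAntiholomorphic g) (p : S) : ∃ f : S → X, IsSurfaceNear γ e H g f p := by
  set φ := chartAt ℂ p with hφdef
  have hφ : φ ∈ conformalParameters S := IsManifold.chart_mem_maximalAtlas p
  have hp : p ∈ φ.source := mem_chart_source ℂ p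
  have ht : φ.target ∈ 𝓝 (φ p) := φ.open_target.mem_nhds (φ.map_source hp)
  have hreg : ∀ᶠ w in 𝓝 (φ p), IsRegularSolutionAt (pot L H) (g ∘ φ.symm) w := by
    filter_upwards [ht] with w hw
    have k1 := hg.1.2 φ hφ _ (φ.map_target hw)
    have k2 := hg.2 φ hφ _ (φ.map_target hw)
    have k3 := hz φ hφ _ (φ.map_target hw)
    rw [φ.right_inv hw] at k1 k2 k3
    exact ⟨k1, k2, k3⟩
  have hcont : ContinuousAt (g ∘ φ.symm) (φ p) :=
    hg.1.1.continuousAt.comp (φ.continuousAt_symm (φ.map_source hp))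
  obtain ⟨F, hF⟩ := exists_isHSurfaceAt_of_solvesSystemAt he
    (IsRegularSolutionAt.solvesSystemAt hreg hcont fun w ↦ hR (φ.symm w))
  refine ⟨F ∘ φ, ?_⟩
  filter_upwards [hF, ht, eventually_mem_nhds_iff.2 ht] with w h1 _ h2
  have h3 : (F ∘ φ) ∘ φ.symm =ᶠ[𝓝 w] F := by
    filter_upwards [h2] with w' hw'
    exact congrArg F (φ.right_inv hw')
  exact h1.congr (h1.smooth.congr_of_eventuallyEq h3)
    (h3.eventually_nhds.mono fun w' h' v ↦ leftLogDeriv_congr h' v)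

/-- The Gauss map of an `H`-surface is a solution of the Gauss map equation. -/
theorem solvesGaussEquation_of_isSurfaceNear (he : IsOrthoFrame γ e L)
    (hR : ∀ q, ¬ PotentialVanishesAt (pot L H) (g q)) (h : ∀ p, IsSurfaceNear γ e H g f p) :
    SolvesGaussEquation (pot L H) g ∧ NowhereAntiholomorphic g := by
  have hall : ∀ φ ∈ conformalParameters S, ∀ p ∈ φ.source,
      ContinuousAt (g ∘ φ.symm) (φ p) ∧ IsRegularSolutionAt (pot L H) (g ∘ φ.symm) (φ p) := by
    intro φ hφ p hp
    obtain ⟨ζ, hζ⟩ := solvesSystemAt_of_isHSurfaceAt he ((isSurfaceNear_iff he hφ hp).1 (h p))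
    have hζ' := hζ.mono fun _ h ↦ h.1
    exact ⟨SolvesSystemAt.continuousAt hζ', SolvesSystemAt.isRegularSolutionAt hζ' (hR _)⟩
  have hreg : ∀ φ ∈ conformalParameters S, ∀ p ∈ φ.source,
      ContDiffAt ℝ ∞ (localRep g φ p) (φ p) ∧
      GaussEquationAt (potentialCoord (pot L H) (g p)) (localRep g φ p) (φ p) ∧
      dz (localRep g φ p) (φ p) ≠ 0 := by
    intro φ hφ p hp
    obtain ⟨k1, k2, k3⟩ := (hall φ hφ p hp).2
    rw [Function.comp_apply, φ.left_inv hp] at k1 k2 k3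
    exact ⟨k1, k2, k3⟩
  refine ⟨⟨⟨continuous_iff_continuousAt.2 fun p ↦ ?_, fun φ hφ p hp ↦ (hreg φ hφ p hp).1⟩,
    fun φ hφ p hp ↦ (hreg φ hφ p hp).2.1⟩, fun φ hφ p hp ↦ (hreg φ hφ p hp).2.2⟩
  have hp := mem_chart_source ℂ p
  have hc := (hall _ (IsManifold.chart_mem_maximalAtlas p) p hp).1
  refine (hc.comp ((chartAt ℂ p).continuousAt hp)).congr ?_
  filter_upwards [(chartAt ℂ p).open_source.mem_nhds hp] with q hq
  simp [(chartAt ℂ p).left_inv hq]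

end RiemannSurface

end MetricLie

end

theorem mainTheorem3
    {S : Type*} [TopologicalSpace S] [T2Space S] [ChartedSpace ℂ S] [IsManifold 𝓘(ℂ) ω S]
    [SimplyConnectedSpace S]
    {X : Type*} [TopologicalSpace X] [ChartedSpace E3 X] [Group X] [LieGroup I3 ∞ X]
    [SimplyConnectedSpace X]
    (γ : LeftInvariantMetric X) (e : Module.Basis (Fin 3) ℝ (GroupLieAlgebra I3 X))
    (s : StructureConstants) (hs : IsCanonicalBasis γ e s)
    (H : ℝ) (g : S → OnePoint ℂ)
    (hR : ∀ p, ¬ PotentialVanishesAt (hPotential H s) (g p)) :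
    (SolvesGaussEquation (hPotential H s) g → NowhereAntiholomorphic g →
      (∃ f : S → X, IsHSurface γ e H f ∧ HasGaussMap γ e f g) ∧
      (∀ f₁ f₂ : S → X, IsHSurface γ e H f₁ → HasGaussMap γ e f₁ g →
        IsHSurface γ e H f₂ → HasGaussMap γ e f₂ g → ∃ a : X, ∀ p, f₂ p = a * f₁ p)) ∧
    (∀ f : S → X, IsHSurface γ e H f → HasGaussMap γ e f g →
      SolvesGaussEquation (hPotential H s) g ∧ NowhereAntiholomorphic g) := by
  have he := hs.isOrthoFrame
  rw [hPotential_eq_pot] at hR ⊢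
  have _ : LocallyPathConnectedSpace S := ChartedSpace.locallyPathConnectedSpace ℂ S
  refine ⟨fun hg hz ↦ ⟨?_, fun f₁ f₂ h₁ g₁ h₂ g₂ ↦ ?_⟩, fun f h hf ↦ ?_⟩
  · obtain ⟨f, hf⟩ := exists_global_solution (Sol := fun f p ↦ IsSurfaceNear γ e H g f p)
      (fun f f' p h hf ↦ h.congr hf) (fun f p h ↦ h.eventually he) (fun f p a h ↦ h.mul_left a)
      (fun f f' p h h' ↦ h.eventually_eq_mul he (hR p) h') (exists_isSurfaceNear he hR hg hz)
    exact ⟨f, (isHSurface_and_hasGaussMap_iff he).2 hf⟩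
  · have k₁ := (isHSurface_and_hasGaussMap_iff he).1 ⟨h₁, g₁⟩
    have k₂ := (isHSurface_and_hasGaussMap_iff he).1 ⟨h₂, g₂⟩
    exact exists_eq_mul_of_eventually fun p ↦ (k₁ p).eventually_eq_mul he (hR p) (k₂ p)
  · exact solvesGaussEquation_of_isSurfaceNear he hR
      ((isHSurface_and_hasGaussMap_iff he).1 ⟨h, hf⟩)
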